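/- Let $n\ge 1$. Work in type $A_{2n+1}$ with index set $I=\{1,\dots,2n+1\}$, simple roots $\alpha_i=\varepsilon_i-\varepsilon_{i+1}$, positive roots $\Phi^+$, longest element $w_0$, $i^*=i^\vee=2n+2-i$, and orbit set $\overline I=\{1,\dots,n+1\}$ of $\vee$ (the orbit of $i$ is identified with $\min(i,2n+2-i)$). For a word $u=i_1\cdots i_N$ put $\beta^u_t=s_{i_1}\cdots s_{i_{t-1}}(\alpha_{i_t})$. *Twisted adapted classes.* $[u]$ denotes the commutation class of a word $u$. A reflection functor replaces a class $[i\,u]$ by $[u\,i^*]$, or $[u\,i]$ by $[i^*u]$. A class of reduced words of $w_0$ is twisted adapted if it is obtained by finitely many reflection functors from the class of $\prod_{k=0}^{2n}(1\,2\cdots n{+}1)^{k\vee}$, where $(j_1\cdots j_l)^\vee=j_1^\vee\cdots j_l^\vee$. Fix a reduced word $w=i_1\cdots i_N$ whose class $[w]$ is twisted adapted. *Minimal pairs.* Write $\beta^u_k<_u\beta^u_l$ if $k<l$, and $\alpha\prec_{[w]}\beta$ if $\alpha<_{u}\beta$ for all $u\in[w]$. For sequences $m,m'\in\mathbb Z_{\ge0}^{\Phi^+}$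 write $m'<^{b}_{u}m$ if there are $k\le s$ with $m'(\beta^u_t)=m(\beta^u_t)$ for $t<k$ and for $t>s$, $m'(\beta^u_k)<m(\beta^u_k)$ and $m'(\beta^u_s)<m(\beta^u_s)$; write $m'\prec^b_{[w]}m$ if $m'<^b_{u}m$ for all $u\in[w]$; and put $\mathrm{wt}(m)=\sum_\beta m(\beta)\beta$. Roots and pairs of distinct roots are identified with their indicator sequences. For $\gamma\in\Phi^+$, $(\alpha,\beta)$ is a $[w]$-minimal pair of $\gamma$ if $\alpha\prec_{[w]}\beta$, $\alpha+\beta=\gamma$, $\gamma\prec^b_{[w]}(\alpha,\beta)$ and there is no sequence $m'$ of weight $\gamma$ with $\gamma\prec^b_{[w]}m'\prec^b_{[w]}(\alpha,\beta)$. *Coordinates.* Let $P(w)$ be the word in $\{1,\dots,2n\}$ obtained from $w$ by deleting the letters $n+1$ and replacing each letter $j>n+1$ by $j-1$; it is adapted to a unique Dynkin quiver $Q$ of type $A_{2n}$ (each letter is a sink of the quiver obtained from $Q$ by reversing successively the arrows at the preceding letters). Fix a height function $\xi$ of $Q$, that is, $\xi(j)=\xi(i)+1$ for every arrow $i\to j$.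 Let $c=c_1\cdots c_{2n}$ be a word adapted to $Q$ that contains each letter once, and $\phi_Q=s_{c_1}\cdots s_{c_{2n}}$. Define $\Omega_Q$ on the positive roots of type $A_{2n}$ by $\Omega_Q(\beta^c_t)=(c_t,\xi(c_t))$, and $\Omega_Q(\phi_Q\beta)=(i,p-2)$ if $\Omega_Q(\beta)=(i,p)$ and $\phi_Q\beta$ is positive. The quiver $\Upsilon_{[w]}$ has vertices $1,\dots,N$, the vertex $t$ having residue $i_t$ and label $\beta^w_t$, and an arrow $k\to j$ whenever $j<k$, $|i_k-i_j|=1$, and neither $i_j$ nor $i_k$ occurs in $w$ strictly between the positions $j$ and $k$. If $i_t\ne n+1$ and the letter at position $t$ gives the $t'$-th letter of $P(w)$, and $\Omega_Q(\beta^{P(w)}_{t'})=(i,x)$, then the vertex $t$ gets the coordinate $(i,x)$ if $i\le n$ and $(i+1,x)$ if $i>n$. A vertex of residue $n+1$ gets $(n+1,x+\tfrac12)$ if it is a sink of $\Upsilon_{[w]}$ with an arrow from a vertex of coordinate $(j,x)$; $(n+1,x-\tfrac12)$ if it is a source with an arrow to a vertex of coordinate $(j,x)$; and $(n+1,x+\tfrac12)$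 if it lies on a path $(j,x)\to\bullet\to(j',x+1)$ with $\{j,j'\}=\{n,n+2\}$. If the vertex labelled $\beta$ has coordinate $(i,\tfrac p2)$, the folded coordinate of $\beta$ is $\widehat\Omega_{[w]}(\beta)=(\overline i,p)\in\overline I\times\mathbb Z$. **Proposition.** Let $\alpha,\beta,\gamma\in\Phi^+$ with $\alpha+\beta=\gamma$, $\widehat\Omega_{[w]}(\alpha)=(i,p)$, $\widehat\Omega_{[w]}(\beta)=(j,q)$, $\widehat\Omega_{[w]}(\gamma)=(k,r)$. Then $(\alpha,\beta)$ is a $[w]$-minimal pair of $\gamma$ if and only if one of the following holds: (i) $\ell:=\max(i,j,k)\le n$, $i+j+k=2\ell$ and $$\Big(\frac{q-r}2,\frac{p-r}2\Big)=\begin{cases}(-i,\ j)&\text{if }\ell=k,\\(i-(2n+1),\ j)&\text{if }\ell=i,\\(-i,\ 2n+1-j)&\text{if }\ell=j;\end{cases}$$ (ii) $s:=\min(i,j,k)\le n$, the other two are equal to $n+1$, and $$(q-r,\ p-r)=\begin{cases}(-2(n-k)-1,\ 2(n-k)+1)&\text{if }s=k,\\(-4i,\ 2(n-i)+1)&\text{if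 }s=i,\\(-2(n-j)-1,\ 4j)&\text{if }s=j.\end{cases}$$ -/

import Mathlib

namespace TwAR

noncomputable section

/-! ## Roots and words of type `A_m`

The letters (vertices of the Dynkin diagram of type `A_m`) are `1, …, m`, the simple reflection `s_i`
is the transposition `(i, i+1)`, and `α_i = ε_i - ε_{i+1}`. -/

/-- The lattice spanned by `ε_0, ε_1, ε_2, …`, which contains the root lattices of all types `A_m`. -/
abbrev Lat : Type := ℕ →₀ ℤ

/-- The simple root `α_i = ε_i - ε_{i+1}`. -/
def simpleRoot (i : ℕ) : Lat := Finsupp.single i 1 - Finsupp.single (i + 1) 1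

/-- The positive root `[a,b] = α_a + α_{a+1} + ⋯ + α_b`. -/
def segRoot (a b : ℕ) : Lat := ∑ k ∈ Finset.Icc a b, simpleRoot k

/-- The set `Φ⁺` of positive roots of type `A_m`. -/
def PosRoots (m : ℕ) : Set Lat :=
  {v | ∃ a b : ℕ, 1 ≤ a ∧ a ≤ b ∧ b ≤ m ∧ v = segRoot a b}

/-- The Weyl group element `s_{i_1} s_{i_2} ⋯ s_{i_l}` of the word `i_1 i_2 ⋯ i_l`. -/
def wordPerm (w : List ℕ) : Equiv.Perm ℕ := (w.map fun i => Equiv.swap i (i + 1)).prod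

/-- The action of the Weyl group on the lattice, `σ (ε_a) = ε_{σ a}`. -/
def act (σ : Equiv.Perm ℕ) (v : Lat) : Lat := Finsupp.equivMapDomain σ v

/-- The letter at position `k` of a word (positions are counted from `0`). -/
def letter (w : List ℕ) (k : ℕ) : ℕ := w.getD k 0

/-- The root `s_{i_1} ⋯ s_{i_{k-1}} (α_{i_k})` attached to a position of a word
(positions are counted from `0`, so position `k` is preceded by `k` letters). -/
def rootAt (w : List ℕ) (k : ℕ) : Lat := act (wordPerm (w.take k)) (simpleRoot (letter w k))

/-! ## Commutation classes and reflection functors -/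

/-- One commutation relation `i j = j i` with `i, j` distinct and not adjacent. -/
inductive CommStep : List ℕ → List ℕ → Prop
  | swap (u v : List ℕ) (i j : ℕ) (h : i + 1 < j ∨ j + 1 < i) :
      CommStep (u ++ i :: j :: v) (u ++ j :: i :: v)

/-- Two words are in the same commutation class. -/
def CommEquiv : List ℕ → List ℕ → Prop := Relation.ReflTransGen CommStep

/-- The involution `i ↦ i^*` induced by the longest element of type `A_m`. -/
def star (m i : ℕ) : ℕ := m + 1 - i

/-- The class of `w'` is obtained from the class of `w` by a reflection functor acting from the
right, `[i u] ↦ [u i^*]`, or from the left, `[u i] ↦ [i^* u]`. -/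
def ReflStep (m : ℕ) (w w' : List ℕ) : Prop :=
  (∃ (i : ℕ) (u : List ℕ), CommEquiv w (i :: u) ∧ CommEquiv (u ++ [star m i]) w') ∨
  (∃ (i : ℕ) (u : List ℕ), CommEquiv w (u ++ [i]) ∧ CommEquiv (star m i :: u) w')

/-- The class of `w'` is in the `r`-cluster point of the class of `w`: it is obtained from it by a
finite sequence of reflection functors. -/
def ReflEquiv (m : ℕ) : List ℕ → List ℕ → Prop :=
  Relation.ReflTransGen fun w w' => CommEquiv w w' ∨ ReflStep m w w'

/-- The word `∏_{k=0}^{2n} (1 2 ⋯ n+1)^{k∨}` of type `A_{2n+1}`, where `i^∨ = 2n+2-i`. -/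
def baseWord (n : ℕ) : List ℕ :=
  (List.range (2 * n + 1)).flatMap fun k =>
    (List.map fun i => 2 * n + 2 - i)^[k] (List.range' 1 (n + 1))

/-- `w` represents a twisted adapted class of type `A_{2n+1}`. -/
def TwistedAdapted (n : ℕ) (w : List ℕ) : Prop := ReflEquiv (2 * n + 1) (baseWord n) w

/-! ## Orders on positive roots and on sequences of positive roots -/

/-- `α <_w β` for the total order on `Φ⁺` given by the reduced word `w`. -/
def Before (w : List ℕ) (α β : Lat) : Prop :=
  ∃ k l : ℕ, k < l ∧ l < w.length ∧ rootAt w k = α ∧ rootAt w l = β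

/-- The partial order `α ≺_{[w]} β` of the commutation class of `w`. -/
def Prec (w : List ℕ) (α β : Lat) : Prop := ∀ w', CommEquiv w w' → Before w' α β

/-- A sequence `(m_1, …, m_N)` of nonnegative integers indexed by the positive roots is modelled as
the multiset of positive roots that contains `β_t` exactly `m_t` times; its weight
`∑ m_t β_t` is `Multiset.sum`. -/
def IsSeq (m : ℕ) (s : Multiset Lat) : Prop := ∀ β ∈ s, β ∈ PosRoots m

/-- The bi-lexicographical order `s' <^b_w s`. -/
def BLt (w : List ℕ) (s' s : Multiset Lat) : Prop :=
  ∃ k l : ℕ, k ≤ l ∧ l < w.length ∧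
    (∀ t, t < w.length → (t < k ∨ l < t) → s'.count (rootAt w t) = s.count (rootAt w t)) ∧
    s'.count (rootAt w k) < s.count (rootAt w k) ∧
    s'.count (rootAt w l) < s.count (rootAt w l)

/-- The order `s' ≺^b_{[w]} s` of the commutation class of `w`. -/
def BPrec (w : List ℕ) (s' s : Multiset Lat) : Prop := ∀ w', CommEquiv w w' → BLt w' s' s

/-- `s` is a `[w]`-minimal sequence of the `[w]`-simple sequence `s₀` (type `A_m`). -/
def IsMinimalSeq (m : ℕ) (w : List ℕ) (s₀ s : Multiset Lat) : Prop :=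
  IsSeq m s ∧ BPrec w s₀ s ∧ s.sum = s₀.sum ∧
    ¬ ∃ s', IsSeq m s' ∧ s'.sum = s₀.sum ∧ BPrec w s₀ s' ∧ BPrec w s' s

/-- `(α, β)` is a `[w]`-minimal pair of the positive root `γ`. A pair is written with its smaller
root first. The sequence `{γ}`, having only one nonzero entry, is `[w]`-simple. -/
def IsMinimalPair (m : ℕ) (w : List ℕ) (α β γ : Lat) : Prop :=
  Prec w α β ∧ IsMinimalSeq m w {γ} {α, β}

/-! ## Dynkin quivers and the Auslander–Reiten quiver of type `A_m` -/

/-- Adjacency of letters in a Dynkin diagram of type `A`. -/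
def Adj (a b : ℕ) : Prop := a + 1 = b ∨ b + 1 = a

/-- `Q a b` says that there is an arrow `a → b`: every edge of the Dynkin diagram of type `A_m` is
given exactly one of its two orientations, and there are no other arrows. -/
def IsDynkinQuiver (m : ℕ) (Q : ℕ → ℕ → Prop) : Prop :=
  (∀ a b, Q a b → 1 ≤ a ∧ a ≤ m ∧ 1 ≤ b ∧ b ≤ m ∧ Adj a b) ∧
  ∀ a, 1 ≤ a → a + 1 ≤ m → Xor (Q a (a + 1)) (Q (a + 1) a)

/-- `i` is a sink of `Q`. -/
def IsSink (m : ℕ) (Q : ℕ → ℕ → Prop) (i : ℕ) : Prop := 1 ≤ i ∧ i ≤ m ∧ ∀ j, ¬ Q i j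

/-- The quiver `i Q`: all arrows incident with `i` are reversed. -/
def reverseAt (i : ℕ) (Q : ℕ → ℕ → Prop) (a b : ℕ) : Prop :=
  if a = i ∨ b = i then Q b a else Q a b

/-- The word `i_1 ⋯ i_l` is adapted to `Q`: `i_k` is a sink of `i_{k-1} ⋯ i_1 Q` for every `k`. -/
def AdaptedTo (m : ℕ) : (ℕ → ℕ → Prop) → List ℕ → Prop
  | _, [] => True
  | Q, i :: w => IsSink m Q i ∧ AdaptedTo m (reverseAt i Q) w

/-- `ξ` is a height function of `Q`. -/
def IsHeight (Q : ℕ → ℕ → Prop) (ξ : ℕ → ℤ) : Prop := ∀ i j, Q i j → ξ j = ξ i + 1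

/-- `c` is a reduced word of the Coxeter element `φ_Q`: it contains every letter exactly once and is
adapted to `Q`. -/
def IsCoxeterWord (m : ℕ) (Q : ℕ → ℕ → Prop) (c : List ℕ) : Prop :=
  c.Perm (List.range' 1 m) ∧ AdaptedTo m Q c

/-- `ARCoord m Q ξ β i p` says `Ω_Q(β) = (i,p)`, the coordinate of `β` in `Γ_Q`. -/
inductive ARCoord (m : ℕ) (Q : ℕ → ℕ → Prop) (ξ : ℕ → ℤ) : Lat → ℕ → ℤ → Prop
  | base {c : List ℕ} (hc : IsCoxeterWord m Q c) {t : ℕ} (ht : t < c.length) :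
      ARCoord m Q ξ (rootAt c t) (letter c t) (ξ (letter c t))
  | step {c : List ℕ} (hc : IsCoxeterWord m Q c) {β : Lat} {i : ℕ} {p : ℤ}
      (h : ARCoord m Q ξ β i p) (hpos : act (wordPerm c) β ∈ PosRoots m) :
      ARCoord m Q ξ (act (wordPerm c) β) i (p - 2)

/-! ## Twisted and folded Auslander–Reiten quivers -/

/-- The map `P` from words of type `A_{2n+1}` to words of type `A_{2n}`: the letter `n+1` is deleted
and the letters `j > n+1` become `j-1`. -/
def deleteMiddle (n : ℕ) (w : List ℕ) : List ℕ :=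
  w.filterMap fun i => if i ≤ n then some i else if i = n + 1 then none else some (i - 1)

/-- There is an arrow in the combinatorial AR-quiver of `w` from the vertex at position `k` to the
vertex at position `j`. -/
def Arrow (w : List ℕ) (k j : ℕ) : Prop :=
  j < k ∧ k < w.length ∧ Adj (letter w k) (letter w j) ∧
    (∀ j', j' < k → letter w j' = letter w j → j' ≤ j) ∧
    (∀ k', j < k' → k' < w.length → letter w k' = letter w k → k ≤ k')

/-- Coordinates of the induced vertices (those whose residue is not `n+1`). The vertex at position
`t` of `w` is identified with the vertex of `Γ_Q` given by the corresponding letter of `P(w)`; a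
coordinate `(i,p)` in `Γ_Q` becomes `(i⁺,p)`. -/
def InducedCoord (n : ℕ) (Q : ℕ → ℕ → Prop) (ξ : ℕ → ℤ) (w : List ℕ) (t i : ℕ) (x : ℚ) : Prop :=
  t < w.length ∧ letter w t ≠ n + 1 ∧
    ∃ (i' : ℕ) (p : ℤ),
      ARCoord (2 * n) Q ξ (rootAt (deleteMiddle n w) (deleteMiddle n (w.take t)).length) i' p ∧
      i = (if n < i' then i' + 1 else i') ∧ x = p

/-- Coordinates in `I × ½ℤ` of all vertices of the twisted AR-quiver. A vertex of residue `n+1` is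
placed half a step after (before) its neighbours if it is a sink (source) of the quiver, and
half-way between its two neighbours otherwise. -/
inductive VertexCoord (n : ℕ) (Q : ℕ → ℕ → Prop) (ξ : ℕ → ℤ) (w : List ℕ) : ℕ → ℕ → ℚ → Prop
  | induced {t i : ℕ} {x : ℚ} (h : InducedCoord n Q ξ w t i x) : VertexCoord n Q ξ w t i x
  | sink {t k j : ℕ} {x : ℚ} (ht : letter w t = n + 1) (hs : ∀ l, ¬ Arrow w t l)
      (hk : Arrow w k t) (hx : InducedCoord n Q ξ w k j x) :
      VertexCoord n Q ξ w t (n + 1) (x + 1 / 2)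
  | source {t l j : ℕ} {x : ℚ} (ht : letter w t = n + 1) (hs : ∀ k, ¬ Arrow w k t)
      (hl : Arrow w t l) (hx : InducedCoord n Q ξ w l j x) :
      VertexCoord n Q ξ w t (n + 1) (x - 1 / 2)
  | middle {t k l j j' : ℕ} {x : ℚ} (ht : letter w t = n + 1)
      (hk : Arrow w k t) (hl : Arrow w t l)
      (hx : InducedCoord n Q ξ w k j x) (hx' : InducedCoord n Q ξ w l j' (x + 1))
      (hj : (j = n ∧ j' = n + 2) ∨ (j = n + 2 ∧ j' = n)) :
      VertexCoord n Q ξ w t (n + 1) (x + 1 / 2)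

/-- `TwistedCoord n Q ξ w β i x` says `Ω_{[w]}(β) = (i,x)`, where `P([w]) = [Q]` and `ξ` is the
height function that fixes the coordinates of `Γ_Q`. -/
def TwistedCoord (n : ℕ) (Q : ℕ → ℕ → Prop) (ξ : ℕ → ℤ) (w : List ℕ) (β : Lat) (i : ℕ) (x : ℚ) :
    Prop :=
  ∃ t, t < w.length ∧ rootAt w t = β ∧ VertexCoord n Q ξ w t i x

/-- `FoldedCoord n Q ξ w β i p` says that the folded coordinate of `β` is `(i,p)`: if
`Ω_{[w]}(β) = (i', p/2)`, then `i` is the orbit of `i'` under `i' ↦ 2n+2-i'`, and the orbit of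
`i' ≤ n+1` is identified with `i'`. -/
def FoldedCoord (n : ℕ) (Q : ℕ → ℕ → Prop) (ξ : ℕ → ℤ) (w : List ℕ) (β : Lat) (i : ℕ) (p : ℤ) :
    Prop :=
  ∃ (i' : ℕ) (x : ℚ), TwistedCoord n Q ξ w β i' x ∧ i = min i' (2 * n + 2 - i') ∧ x = (p : ℚ) / 2

end

end TwAR

namespace TwAR

noncomputable section

/-! A twisted adapted word is encoded by integer heights on the letters 1, …, 2n+1. A letter can be
read when its height is a local maximum; reading it lowers the height by 4, or by 2 for the middle
letter n+1. Positions of the word thus become points (row, height) of a planar grid. Its rows `rho`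
are the rows of type A_{2n}, doubled, with the middle row 2n+1 inserted between 2n and 2n+2. Each
diagonal height ± rho carries a label in {1, …, 2n+2}: multiples of 4 use 2n+1 labels with period
8n+4, all other diagonals share one label. The root at a point is ε_a - ε_b, where a and b label its
two diagonals. These data (`Sys`) exist for the base word and survive commutations and reflection
functors (`sys_of_twistedAdapted`).

The order of the class becomes the cone order `Ge` of the grid (`prec_iff`). Deleting the middle row
leaves the grid of Q, so the prescribed coordinates are the grid points up to a constant shift of
the heights (`FoldedCoord.exists_point`). An equation α+β=γ says that the three points share
diagonals. The points read by the word are too close together for more than one wrap-around by a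
period, so only the eight configurations of `Pat` remain, and in each of them γ lies between α and
β.

A sequence below the pair (α,β) consists of roots strictly between α and β; if it has weight γ, it
is γ itself or can be regrouped into a pair of γ inside the same interval
(`eq_or_exists_of_sum_eq`). One pair of γ lies inside another only if the outer pair and γ avoid the
middle row and γ is on the opposite side of it from α and β (`Pat.not_nested`). In that case the two
middle points on the diagonals of γ form a pair in between, because their other diagonals carry the
common label (`not_isMinimalPair_of_offMid`). In folded residues the exceptional case is i+j+k=2n+1,
and the other patterns are exactly (i) and (ii) (`pat_iff`). -/

/-! ### Roots of type A as differences of basis vectors. -/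

/-- The root `ε_a - ε_b`. -/
def rt (a b : ℕ) : Lat := Finsupp.single a 1 - Finsupp.single b 1

lemma segRoot_eq (a d : ℕ) : segRoot a (a + d) = rt a (a + d + 1) := by
  induction d with
  | zero => simp [segRoot, simpleRoot, rt]
  | succ d ih =>
    have : segRoot a (a + (d + 1)) = segRoot a (a + d) + simpleRoot (a + d + 1) := by
      unfold segRoot
      rw [← add_assoc, Finset.sum_Icc_succ_top (by omega)]
    rw [this, ih]
    simp only [rt, simpleRoot, ← add_assoc]
    abel

lemma mem_posRoots {m : ℕ} {v : Lat} :
    v ∈ PosRoots m ↔ ∃ a b : ℕ, 1 ≤ a ∧ a < b ∧ b ≤ m + 1 ∧ v = rt a b := by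
  constructor
  · rintro ⟨a, b, h1, h2, h3, rfl⟩
    obtain ⟨d, rfl⟩ := Nat.exists_eq_add_of_le h2
    exact ⟨a, a + d + 1, h1, by omega, by omega, segRoot_eq a d⟩
  · rintro ⟨a, b, h1, h2, h3, rfl⟩
    obtain ⟨d, rfl⟩ := Nat.exists_eq_add_of_lt h2
    exact ⟨a, a + d, h1, by omega, by omega, (segRoot_eq a d).symm⟩

lemma act_rt (σ : Equiv.Perm ℕ) (a b : ℕ) : act σ (rt a b) = rt (σ a) (σ b) := by
  have h : ∀ v : Lat, act σ v = Finsupp.mapDomain σ v := fun v =>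
    Finsupp.equivMapDomain_eq_mapDomain σ v
  rw [h, rt, rt, sub_eq_add_neg, Finsupp.mapDomain_add, ← Finsupp.single_neg,
    Finsupp.mapDomain_single, Finsupp.mapDomain_single, sub_eq_add_neg, ← Finsupp.single_neg]

lemma act_simpleRoot (σ : Equiv.Perm ℕ) (i : ℕ) :
    act σ (simpleRoot i) = rt (σ i) (σ (i + 1)) := act_rt σ i (i + 1)

lemma rt_apply (a b x : ℕ) :
    rt a b x = (if a = x then 1 else 0) - (if b = x then 1 else 0) := by
  simp only [rt, Finsupp.sub_apply, Finsupp.single_apply]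

lemma rt_inj {a b c d : ℕ} (hab : a ≠ b) (h : rt a b = rt c d) : a = c ∧ b = d := by
  have h1 := DFunLike.congr_fun h a
  have h2 := DFunLike.congr_fun h b
  simp only [rt_apply] at h1 h2
  constructor
  · by_contra hc
    split_ifs at h1 <;> omega
  · by_contra hc
    split_ifs at h2 <;> omega

lemma rt_add (a b c : ℕ) : rt a b + rt b c = rt a c := by
  simp only [rt]; abel

/-- Compare coefficients: one summand must start at e, and its end must cancel the start of the
other. -/
lemma rt_add_eq {a b c d e f : ℕ} (hab : a ≠ b) (hcd : c ≠ d) (hef : e ≠ f)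
    (h : rt a b + rt c d = rt e f) :
    (a = e ∧ b = c ∧ d = f) ∨ (c = e ∧ d = a ∧ b = f) := by
  have key : ∀ x, ((if a = x then 1 else 0) - (if b = x then 1 else 0) +
      ((if c = x then 1 else 0) - (if d = x then 1 else 0)) : ℤ) =
      (if e = x then 1 else 0) - (if f = x then 1 else 0) := fun x => by
    simpa only [Finsupp.add_apply, rt_apply] using DFunLike.congr_fun h x
  have aux : ∀ {a b c d f : ℕ}, a ≠ b → c ≠ d → (∀ x, ((if a = x then 1 else 0) -
      (if b = x then 1 else 0) + ((if c = x then 1 else 0) - (if d = x then 1 else 0)) : ℤ) =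
      (if a = x then 1 else 0) - (if f = x then 1 else 0)) → b = c ∧ d = f := by
    intro a b c d f hab hcd key
    have h1 := key c
    have hbc : b = c := by omega
    subst hbc
    have h2 := key d
    exact ⟨rfl, by omega⟩
  by_cases hae : a = e
  · subst hae
    exact Or.inl ⟨rfl, aux hab hcd key⟩
  · have h1 := key e
    have hce : c = e := by omega
    subst hce
    obtain ⟨h2, h3⟩ := aux hcd hab fun x => by rw [← key x]; ring
    exact Or.inr ⟨rfl, h2, h3⟩

/-! ### Reading a word -/

/-- Twice the row of residue `L`: the middle residue lies half-way between its neighbours. -/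
def rho (n L : ℕ) : ℤ := if L ≤ n then 2 * L else if L = n + 1 then 2 * n + 1 else 2 * L - 2

/-- The correction of the step length `4` at the middle residue. -/
def slack (n L : ℕ) : ℤ := if L = n + 1 then 2 else 0

lemma rho_slack (n L : ℕ) :
    (L ≤ n ∧ rho n L = 2 * L ∧ slack n L = 0) ∨
    (L = n + 1 ∧ rho n L = 2 * n + 1 ∧ slack n L = 2) ∨
    (n + 2 ≤ L ∧ rho n L = 2 * L - 2 ∧ slack n L = 0) := by
  unfold rho slack
  split_ifs <;> omega

/-- The heights after reading the letter `L`. -/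
def low (n : ℕ) (h : ℕ → ℤ) (L : ℕ) : ℕ → ℤ := Function.update h L (h L - (4 - slack n L))

/-- The heights after reading the word `u`. -/
def st (n : ℕ) (h : ℕ → ℤ) (u : List ℕ) : ℕ → ℤ :=
  fun L => h L - (4 - slack n L) * (u.count L : ℤ)

lemma low_apply (n : ℕ) (h : ℕ → ℤ) (L M : ℕ) :
    low n h L M = if M = L then h L - (4 - slack n L) else h M := by
  simp [low, Function.update_apply]

@[simp] lemma st_nil (n : ℕ) (h : ℕ → ℤ) : st n h [] = h := by
  funext L; simp [st]

lemma st_cons (n : ℕ) (h : ℕ → ℤ) (L : ℕ) (u : List ℕ) :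
    st n h (L :: u) = st n (low n h L) u := by
  funext M
  simp only [st, low_apply, List.count_cons]
  by_cases hM : M = L
  · subst hM; simp; ring
  · have : (L == M) = false := by simp [Ne.symm hM]
    simp [hM, this]

lemma st_append (n : ℕ) (h : ℕ → ℤ) (u v : List ℕ) :
    st n h (u ++ v) = st n (st n h u) v := by
  funext M
  simp only [st, List.count_append]
  push_cast; ring

lemma st_singleton (n : ℕ) (h : ℕ → ℤ) (L : ℕ) : st n h [L] = low n h L := by
  rw [st_cons, st_nil]

/-- The letter `L` is a local maximum of the heights. -/
def Readable (n : ℕ) (h : ℕ → ℤ) (L : ℕ) : Prop :=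
  1 ≤ L ∧ L ≤ 2 * n + 1 ∧ (1 < L → h (L - 1) < h L) ∧ (L ≤ 2 * n → h (L + 1) < h L)

/-- Every letter of the word is a local maximum when it is read. -/
def Adm (n : ℕ) : (ℕ → ℤ) → List ℕ → Prop
  | _, [] => True
  | h, L :: u => Readable n h L ∧ Adm n (low n h L) u

lemma adm_append {n : ℕ} {h : ℕ → ℤ} {u v : List ℕ} :
    Adm n h (u ++ v) ↔ Adm n h u ∧ Adm n (st n h u) v := by
  induction u generalizing h with
  | nil => simp [Adm]
  | cons L u ih => simp [Adm, ih, st_cons, and_assoc]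

/-- The heights that occur in the twisted Auslander–Reiten quiver. -/
structure Valid (n : ℕ) (h : ℕ → ℤ) : Prop where
  cong : ∀ L, 1 ≤ L → L ≤ 2 * n + 1 → L ≠ n + 1 → 4 ∣ h L + rho n L
  mid : ¬ 2 ∣ h (n + 1)
  le : ∀ L M, 1 ≤ L → L ≤ M → M ≤ 2 * n + 1 →
    h L - h M ≤ rho n M - rho n L + slack n L ∧ h M - h L ≤ rho n M - rho n L + slack n M

/-- The slack in `Valid.le` is asymmetric: the middle letter may stand 3 above a neighbour, but a
neighbour only 1 above the middle, since the middle moves in steps of 2 and its neighbours in steps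
of 4. -/
lemma valid_low {n : ℕ} (hn : 1 ≤ n) {h : ℕ → ℤ} (hv : Valid n h) {K : ℕ}
    (hr : Readable n h K) : Valid n (low n h K) := by
  obtain ⟨hK1, hK2, hr1, hr2⟩ := hr
  have sK := rho_slack n K
  refine ⟨?_, ?_, ?_⟩
  · intro L h1 h2 h3
    have := hv.cong L h1 h2 h3
    rw [low_apply]
    split_ifs with e
    · subst e; omega
    · exact this
  · have := hv.mid
    rw [low_apply]
    split_ifs with e
    · subst e; omega
    · exact this
  · intro L M h1 h2 h3
    have c0 := hv.le L M h1 h2 h3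
    have cn1 := hv.le n (n + 1) hn (by omega) (by omega)
    have cn2 := hv.le (n + 1) (n + 2) (by omega) (by omega) (by omega)
    have cc1 := hv.cong n hn (by omega) (by omega)
    have cc2 := hv.cong (n + 2) (by omega) (by omega) (by omega)
    have sn := rho_slack n n
    have sn1 := rho_slack n (n + 1)
    have sn2 := rho_slack n (n + 2)
    have sL := rho_slack n L
    have sM := rho_slack n M
    rw [low_apply, low_apply]
    by_cases eL : L = K
    · subst eL
      by_cases eM : M = L
      · subst eM; simp; omega
      · rw [if_pos rfl, if_neg eM]
        have hr2' := hr2 (by omega)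
        have d1 := hv.le (L + 1) M (by omega) (by omega) h3
        have g0 := hv.cong L hK1 hK2
        have g1 := hv.cong (L + 1) (by omega) (by omega)
        have s1 := rho_slack n (L + 1)
        -- Comparing with the middle row is too weak for a step of 4 in row n. The congruences
        -- modulo 4 in rows n and n+2 give `h (n+2) ≤ h n - 2`, so the bound is taken through row
        -- n+2.
        by_cases en : L = n
        · subst en
          by_cases eM' : M = L + 1
          · subst eM'
            omega
          · have d2 := hv.le (L + 2) M (by omega) (by omega) h3
            omega
        · omega
    · by_cases eM : M = K
      · subst eM
        rw [if_pos rfl, if_neg eL]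
        have hr1' := hr1 (by omega)
        have d1 := hv.le L (M - 1) (by omega) (by omega) (by omega)
        have g0 := hv.cong M hK1 hK2
        have g1 := hv.cong (M - 1) (by omega) (by omega)
        have s1 := rho_slack n (M - 1)
        by_cases en : M = n + 2
        · subst en
          by_cases eL' : L = n + 1
          · subst eL'
            rw [show n + 2 - 1 = n + 1 by omega] at *
            omega
          · have d2 := hv.le L n (by omega) (by omega) (by omega)
            rw [show n + 2 - 1 = n + 1 by omega] at *
            omega
        · omega
      · rw [if_neg eL, if_neg eM]; exact c0

lemma valid_st {n : ℕ} (hn : 1 ≤ n) {h : ℕ → ℤ} (hv : Valid n h) {u : List ℕ}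
    (hu : Adm n h u) : Valid n (st n h u) := by
  induction u generalizing h with
  | nil => simpa using hv
  | cons L u ih => rw [st_cons]; exact ih (valid_low hn hv hu.1) hu.2

/-! ### Heights and the Weyl group elements that they encode. -/

/-- The height that determines the image of `ε_a`. -/
def edge (n : ℕ) (h : ℕ → ℤ) (a : ℕ) : ℤ :=
  if a = 1 ∨ (a ≤ 2 * n + 1 ∧ h (a - 1) < h a) then h a + rho n a
  else h (a - 1) - rho n (a - 1)

/-- `σ` is the Weyl group element that belongs to the heights `h`. -/
def Lab (n : ℕ) (h : ℕ → ℤ) (σ : ℕ → ℕ) (T : ℤ → ℕ) : Prop :=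
  ∀ a, 1 ≤ a → a ≤ 2 * n + 2 → σ a = T (edge n h a)

/-- `T` labels the diagonals of the grid by the numbers `1, …, 2n+2`; all diagonals that are
not divisible by `4` get the same label. -/
structure TGood (n : ℕ) (T : ℤ → ℕ) : Prop where
  eq_iff : ∀ x y, T x = T y ↔ (4 ∣ x ∧ (8 * (n : ℤ) + 4) ∣ x - y) ∨ (¬ 4 ∣ x ∧ ¬ 4 ∣ y)
  range : ∀ x, 1 ≤ T x ∧ T x ≤ 2 * n + 2

lemma TGood.comp_swap {n : ℕ} {T : ℤ → ℕ} (hT : TGood n T) {i : ℕ} (h1 : 1 ≤ i)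
    (h2 : i ≤ 2 * n + 1) : TGood n fun x => Equiv.swap i (i + 1) (T x) := by
  refine ⟨fun x y => ?_, fun x => ?_⟩
  · rw [Equiv.apply_eq_iff_eq]; exact hT.eq_iff x y
  · have := hT.range x
    simp only [Equiv.swap_apply_def]
    split_ifs <;> omega

lemma edge_up {n : ℕ} {h : ℕ → ℤ} {L : ℕ} (hr : Readable n h L) :
    edge n h L = h L + rho n L := by
  obtain ⟨h1, h2, h3, h4⟩ := hr
  rw [edge, if_pos]
  by_cases e : L = 1
  · exact Or.inl e
  · exact Or.inr ⟨h2, h3 (by omega)⟩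

lemma edge_down {n : ℕ} {h : ℕ → ℤ} {L : ℕ} (hr : Readable n h L) :
    edge n h (L + 1) = h L - rho n L := by
  obtain ⟨h1, h2, h3, h4⟩ := hr
  rw [edge, if_neg]
  · simp
  · rintro (h5 | ⟨h5, h6⟩)
    · omega
    · have := h4 (by omega)
      simp at h6; omega

/-- Lowering a local maximum moves edge L from its upper to its lower diagonal. The diagonal may
change where it meets the middle row, but then only among diagonals with the common label. -/
lemma edge_low_self {n : ℕ} {h : ℕ → ℤ} {T : ℤ → ℕ} (hT : TGood n T) (hv : Valid n h) {L : ℕ}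
    (hr : Readable n h L) (hn : 1 ≤ n) : T (h L - rho n L) = T (edge n (low n h L) L) := by
  obtain ⟨h1, h2, h3, h4⟩ := hr
  have s0 := rho_slack n L
  rcases Nat.lt_or_ge 1 L with hL | hL
  · have h3 := h3 hL
    have e1 : low n h L (L - 1) = h (L - 1) := by rw [low_apply, if_neg (by omega)]
    have e2 : low n h L L = h L - (4 - slack n L) := by rw [low_apply, if_pos rfl]
    rw [edge, e1, e2]
    have s1 := rho_slack n (L - 1)
    have g0 := hv.cong L h1 h2
    have g1 := hv.cong (L - 1) (by omega) (by omega)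
    have g2 := hv.mid
    have d1 := hv.le (L - 1) L (by omega) (by omega) (by omega)
    by_cases e : L = n + 1
    · subst e
      rw [Nat.add_one_sub_one] at *
      split_ifs with hc
      -- Here the middle stood 3 above its left neighbour, so both diagonals are 2 modulo 4.
      · rw [hT.eq_iff]
        omega
      · congr 1
        omega
    · have g2' : L = n + 2 → ¬ 2 ∣ h (L - 1) := by rintro rfl; exact g2
      split_ifs with hc
      · omega
      · congr 1
        omega
  · have e : L = 1 := by omega
    subst e
    rw [edge, if_pos (Or.inl rfl), low_apply, if_pos rfl]
    congr 1
    omega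

lemma edge_low_succ {n : ℕ} {h : ℕ → ℤ} {T : ℤ → ℕ} (hT : TGood n T) (hv : Valid n h) {L : ℕ}
    (hr : Readable n h L) (hn : 1 ≤ n) : T (h L + rho n L) = T (edge n (low n h L) (L + 1)) := by
  obtain ⟨h1, h2, h3, h4⟩ := hr
  have s0 := rho_slack n L
  rcases Nat.lt_or_ge L (2 * n + 1) with hL | hL
  · have h4 := h4 (by omega)
    have e1 : low n h L (L + 1) = h (L + 1) := by rw [low_apply, if_neg (by omega)]
    have e2 : low n h L L = h L - (4 - slack n L) := by rw [low_apply, if_pos rfl]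
    rw [edge, Nat.add_one_sub_one, e1, e2]
    have s1 := rho_slack n (L + 1)
    have g0 := hv.cong L h1 h2
    have g1 := hv.cong (L + 1) (by omega) (by omega)
    have g2 := hv.mid
    have d1 := hv.le L (L + 1) (by omega) (by omega) (by omega)
    by_cases e : L = n + 1
    · subst e
      split_ifs with hc
      · congr 1
        omega
      · rw [hT.eq_iff]
        omega
    · have g2' : L = n → ¬ 2 ∣ h (L + 1) := by rintro rfl; exact g2
      split_ifs with hc
      · congr 1
        omega
      · omega
  · have e : L = 2 * n + 1 := by omega
    subst e
    -- At the end of the diagram the two diagonals differ by exactly one period 8n+4.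
    rw [edge, if_neg (by omega), Nat.add_one_sub_one, low_apply, if_pos rfl, hT.eq_iff]
    left
    have g0 := hv.cong (2 * n + 1) h1 h2 (by omega)
    refine ⟨g0, ⟨1, ?_⟩⟩
    omega

/-- Only the edges L and L+1 involve the height of L, and reading L makes them trade diagonals; this
is right multiplication by s_L. -/
lemma lab_low {n : ℕ} (hn : 1 ≤ n) {h : ℕ → ℤ} {σ : ℕ → ℕ} {T : ℤ → ℕ} (hT : TGood n T)
    (hv : Valid n h) (hl : Lab n h σ T) {L : ℕ} (hr : Readable n h L) :
    Lab n (low n h L) (fun a => σ (Equiv.swap L (L + 1) a)) T := by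
  intro a ha1 ha2
  have hL1 := hr.1
  have hL2 := hr.2.1
  by_cases e1 : a = L
  · subst e1
    simp only [Equiv.swap_apply_left]
    rw [hl _ (by omega) (by omega), edge_down hr]
    exact edge_low_self hT hv hr hn
  · by_cases e2 : a = L + 1
    · subst e2
      simp only [Equiv.swap_apply_right]
      rw [hl _ hL1 (by omega), edge_up hr]
      exact edge_low_succ hT hv hr hn
    · simp only [Equiv.swap_apply_of_ne_of_ne e1 e2]
      rw [hl a ha1 ha2]
      congr 1
      have : a ≠ 1 → a - 1 ≠ L := by omega
      by_cases e3 : a = 1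
      · simp [edge, e3, low_apply, show 1 ≠ L by omega]
      · simp [edge, e3, low_apply, e1, this e3]

lemma wordPerm_cons (i : ℕ) (u : List ℕ) :
    wordPerm (i :: u) = Equiv.swap i (i + 1) * wordPerm u := by simp [wordPerm]

lemma lab_st {n : ℕ} (hn : 1 ≤ n) {h : ℕ → ℤ} {σ : Equiv.Perm ℕ} {T : ℤ → ℕ} (hT : TGood n T)
    (hv : Valid n h) (hl : Lab n h σ T) {u : List ℕ} (hu : Adm n h u) :
    Lab n (st n h u) (σ * wordPerm u : Equiv.Perm ℕ) T := by
  induction u generalizing h σ with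
  | nil => simpa [wordPerm] using hl
  | cons L u ih =>
    rw [st_cons, wordPerm_cons, ← mul_assoc]
    exact ih (σ := σ * Equiv.swap L (L + 1)) (valid_low hn hv hu.1) (lab_low hn hT hv hl hu.1) hu.2

/-- Equality of heights on the letters `1, …, 2n+1`. -/
def HEq' (n : ℕ) (h h' : ℕ → ℤ) : Prop := ∀ L, 1 ≤ L → L ≤ 2 * n + 1 → h L = h' L

lemma HEq'.symm {n : ℕ} {h h' : ℕ → ℤ} (e : HEq' n h h') : HEq' n h' h :=
  fun L h1 h2 => (e L h1 h2).symm

lemma HEq'.low {n : ℕ} {h h' : ℕ → ℤ} (e : HEq' n h h') {L : ℕ} (h1 : 1 ≤ L)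
    (h2 : L ≤ 2 * n + 1) : HEq' n (low n h L) (low n h' L) := by
  intro M h3 h4
  rw [low_apply, low_apply, e L h1 h2, e M h3 h4]

lemma HEq'.st {n : ℕ} {h h' : ℕ → ℤ} (e : HEq' n h h') (u : List ℕ) :
    HEq' n (st n h u) (st n h' u) := by
  intro M h3 h4
  simp only [TwAR.st, e M h3 h4]

lemma HEq'.readable {n : ℕ} {h h' : ℕ → ℤ} (e : HEq' n h h') {L : ℕ} (hr : Readable n h L) :
    Readable n h' L := by
  obtain ⟨h1, h2, h3, h4⟩ := hr
  refine ⟨h1, h2, fun h5 => ?_, fun h5 => ?_⟩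
  · rw [← e _ (by omega) (by omega), ← e L h1 h2]; exact h3 h5
  · rw [← e _ (by omega) (by omega), ← e L h1 h2]; exact h4 h5

lemma HEq'.adm {n : ℕ} {h h' : ℕ → ℤ} (e : HEq' n h h') {u : List ℕ} (hu : Adm n h u) :
    Adm n h' u := by
  induction u generalizing h h' with
  | nil => trivial
  | cons L u ih => exact ⟨e.readable hu.1, ih (e.low hu.1.1 hu.1.2.1) hu.2⟩

lemma HEq'.lab {n : ℕ} {h h' : ℕ → ℤ} (e : HEq' n h h') {σ : ℕ → ℕ} {T : ℤ → ℕ}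
    (hl : Lab n h σ T) : Lab n h' σ T := by
  intro a h1 h2
  rw [hl a h1 h2]
  congr 1
  by_cases e1 : a = 1
  · subst e1; simp [edge, e 1 (by omega) (by omega)]
  · have e2 := e (a - 1) (by omega) (by omega)
    by_cases e3 : a ≤ 2 * n + 1
    · have e4 := e a h1 e3
      simp [edge, e2, e4]
    · simp [edge, e1, e3, e2]

lemma Adm.range {n : ℕ} {h : ℕ → ℤ} {u : List ℕ} (hu : Adm n h u) :
    ∀ L ∈ u, 1 ≤ L ∧ L ≤ 2 * n + 1 := by
  induction u generalizing h with
  | nil => simp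
  | cons L u ih =>
    intro M hM
    rcases List.mem_cons.1 hM with rfl | hM
    · exact ⟨hu.1.1, hu.1.2.1⟩
    · exact ih hu.2 M hM

/-! ### Duality of the diagram acting on heights. -/

/-- The heights reflected by the involution of the Dynkin diagram, and shifted. -/
def flip (n : ℕ) (c : ℤ) (h : ℕ → ℤ) : ℕ → ℤ := fun L => h (2 * n + 2 - L) + c

lemma HEq'.flip {n : ℕ} {h h' : ℕ → ℤ} (e : HEq' n h h') (c : ℤ) :
    HEq' n (flip n c h) (flip n c h') := by
  intro L h1 h2
  simp only [TwAR.flip, e (2 * n + 2 - L) (by omega) (by omega)]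

lemma slack_flip {n L : ℕ} (h2 : L ≤ 2 * n + 1) : slack n (2 * n + 2 - L) = slack n L := by
  have := rho_slack n L
  have := rho_slack n (2 * n + 2 - L)
  omega

lemma readable_flip {n : ℕ} {h : ℕ → ℤ} (c : ℤ) {L : ℕ} (hr : Readable n h L) :
    Readable n (flip n c h) (2 * n + 2 - L) := by
  obtain ⟨h1, h2, h3, h4⟩ := hr
  refine ⟨by omega, by omega, fun h5 => ?_, fun h5 => ?_⟩
  · have := h4 (by omega)
    simp only [flip, show 2 * n + 2 - (2 * n + 2 - L - 1) = L + 1 by omega,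
      show 2 * n + 2 - (2 * n + 2 - L) = L by omega]
    omega
  · have := h3 (by omega)
    simp only [flip, show 2 * n + 2 - (2 * n + 2 - L + 1) = L - 1 by omega,
      show 2 * n + 2 - (2 * n + 2 - L) = L by omega]
    omega

lemma low_flip {n : ℕ} (h : ℕ → ℤ) (c : ℤ) {L : ℕ} (h1 : 1 ≤ L) (h2 : L ≤ 2 * n + 1) :
    HEq' n (low n (flip n c h) (2 * n + 2 - L)) (flip n c (low n h L)) := by
  intro M h3 h4
  simp only [low_apply, flip, show 2 * n + 2 - (2 * n + 2 - L) = L by omega, slack_flip h2]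
  by_cases e : M = 2 * n + 2 - L
  · rw [if_pos e, if_pos (by omega)]; ring
  · rw [if_neg e, if_neg (by omega)]

lemma adm_flip {n : ℕ} {h : ℕ → ℤ} (c : ℤ) {u : List ℕ} (hu : Adm n h u) :
    Adm n (flip n c h) (u.map fun i => 2 * n + 2 - i) := by
  induction u generalizing h with
  | nil => trivial
  | cons L u ih =>
    exact ⟨readable_flip c hu.1, (low_flip h c hu.1.1 hu.1.2.1).symm.adm (ih hu.2)⟩

lemma st_flip {n : ℕ} {h : ℕ → ℤ} (c : ℤ) {u : List ℕ} (hu : Adm n h u) :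
    HEq' n (st n (flip n c h) (u.map fun i => 2 * n + 2 - i)) (flip n c (st n h u)) := by
  induction u generalizing h with
  | nil => intro L _ _; simp
  | cons L u ih =>
    intro M h3 h4
    rw [List.map_cons, st_cons, st_cons,
      (low_flip h c hu.1.1 hu.1.2.1).st _ M h3 h4, ih hu.2 M h3 h4]

/-- The dual row has `rho` equal to 4n+2 minus the old one, so the congruence modulo 4 survives for
c ≡ 2. -/
lemma valid_flip {n : ℕ} {h : ℕ → ℤ} {c : ℤ} (hc : 4 ∣ c + 2) (hv : Valid n h) :
    Valid n (flip n c h) := by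
  refine ⟨fun L h1 h2 h3 => ?_, ?_, fun L M h1 h2 h3 => ?_⟩
  · have := hv.cong (2 * n + 2 - L) (by omega) (by omega) (by omega)
    have := rho_slack n L
    have := rho_slack n (2 * n + 2 - L)
    simp only [flip]
    omega
  · have := hv.mid
    simp only [flip, show 2 * n + 2 - (n + 1) = n + 1 by omega]
    omega
  · have := hv.le (2 * n + 2 - M) (2 * n + 2 - L) (by omega) (by omega) (by omega)
    have := rho_slack n L
    have := rho_slack n (2 * n + 2 - L)
    have := rho_slack n M
    have := rho_slack n (2 * n + 2 - M)
    simp only [flip]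
    omega

lemma Valid.ne {n : ℕ} {h : ℕ → ℤ} (hv : Valid n h) {L : ℕ} (h1 : 1 ≤ L) (h2 : L ≤ 2 * n) :
    h L ≠ h (L + 1) := by
  have g0 := hv.cong L h1 (by omega)
  have g1 := hv.cong (L + 1) (by omega) (by omega)
  have g2 := hv.mid
  have s0 := rho_slack n L
  have s1 := rho_slack n (L + 1)
  by_cases e : L = n
  · subst e; omega
  · by_cases e : L = n + 1
    · subst e; omega
    · omega

/-- Duality exchanges the two branches of `edge`; each branch produces one of the two signs. -/
lemma edge_flip {n : ℕ} {h : ℕ → ℤ} (c : ℤ) (hv : Valid n h) {a : ℕ} (h1 : 1 ≤ a)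
    (h2 : a ≤ 2 * n + 2) : edge n (flip n c h) a = edge n h (2 * n + 3 - a) + c + (4 * n + 2) ∨
      edge n (flip n c h) a = edge n h (2 * n + 3 - a) + c - (4 * n + 2) := by
  have s0 := rho_slack n a
  have s1 := rho_slack n (a - 1)
  have s2 := rho_slack n (2 * n + 2 - a)
  have s3 := rho_slack n (2 * n + 3 - a)
  by_cases e1 : a = 1
  · subst e1
    simp only [edge, flip, true_or, if_true, show 2 * n + 2 - 1 = 2 * n + 1 by omega,
      show 2 * n + 3 - 1 = 2 * n + 2 by omega] at *
    rw [if_neg (by omega)]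
    omega
  by_cases e2 : a = 2 * n + 2
  · subst e2
    simp only [edge, flip, show 2 * n + 3 - (2 * n + 2) = 1 by omega,
      show 2 * n + 2 - (2 * n + 2 - 1) = 1 by omega, true_or] at *
    rw [if_neg (by omega), if_pos trivial]
    omega
  have hne := hv.ne (L := 2 * n + 2 - a) (by omega) (by omega)
  simp only [edge, flip, show 2 * n + 3 - a - 1 = 2 * n + 2 - a by omega,
    show 2 * n + 2 - (a - 1) = 2 * n + 3 - a by omega,
    show 2 * n + 2 - a + 1 = 2 * n + 3 - a by omega] at *
  by_cases hc : h (2 * n + 2 - a) < h (2 * n + 3 - a)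
  · rw [if_neg (by omega), if_pos (by omega)]
    omega
  · rw [if_pos (by omega), if_neg (by omega)]
    omega

lemma TGood.congr {n : ℕ} {T : ℤ → ℕ} (hT : TGood n T) {x y : ℤ}
    (hxy : y = x ∨ y = x + (8 * n + 4) ∨ y = x - (8 * n + 4)) : T y = T x := by
  rcases hxy with rfl | rfl | rfl
  · rfl
  · rw [hT.eq_iff]
    by_cases h4 : 4 ∣ x
    · left
      exact ⟨by omega, ⟨1, by ring⟩⟩
    · right; omega
  · rw [hT.eq_iff]
    by_cases h4 : 4 ∣ x
    · left
      exact ⟨by omega, ⟨-1, by ring⟩⟩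
    · right; omega

/-- For these two values of c the edges move by 0 or by a full period, so the same labels describe
the precomposition with w_0. -/
lemma lab_flip {n : ℕ} {h : ℕ → ℤ} {c : ℤ} (hc : c = 4 * n + 2 ∨ c = -(4 * n + 2))
    (hv : Valid n h) {σ : ℕ → ℕ} {T : ℤ → ℕ} (hT : TGood n T) (hl : Lab n h σ T) :
    Lab n (flip n c h) (fun a => σ (2 * n + 3 - a)) T := by
  intro a h1 h2
  simp only
  rw [hl _ (by omega) (by omega)]
  have := edge_flip c hv h1 h2
  refine (hT.congr ?_).symm
  omega

/-! ### The base word -/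

/-- The heights of the base word. -/
def baseHt (n L : ℕ) : ℤ :=
  if L ≤ n then -2 * L else if L = n + 1 then -2 * n - 1 else 2 * L - 4 * n - 6

lemma valid_base (n : ℕ) : Valid n (baseHt n) := by
  refine ⟨fun L h1 h2 h3 => ?_, ?_, fun L M h1 h2 h3 => ?_⟩
  · simp only [baseHt, rho]
    split_ifs <;> omega
  · simp only [baseHt]
    split_ifs <;> omega
  · simp only [baseHt, rho, slack]
    split_ifs <;> omega

lemma st_baseHt (n k M : ℕ) : st n (baseHt n) (List.range' 1 k) M =
    baseHt n M - (4 - slack n M) * (if 1 ≤ M ∧ M ≤ k then 1 else 0) := by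
  have e : List.count M (List.range' 1 k) = if M ∈ List.range' 1 k then 1 else 0 :=
    List.Nodup.count List.nodup_range'
  rw [st, e]
  congr 2
  simp only [List.mem_range'_1]
  split_ifs <;> omega

lemma adm_block (n k : ℕ) (hk : k ≤ n + 1) : Adm n (baseHt n) (List.range' 1 k) := by
  induction k with
  | zero => trivial
  | succ k ih =>
    rw [List.range'_1_concat, adm_append]
    refine ⟨ih (by omega), ⟨by omega, by omega, fun h1 => ?_, fun h1 => ?_⟩, trivial⟩
    · rw [st_baseHt, st_baseHt]
      simp only [baseHt, slack]
      split_ifs <;> omega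
    · rw [st_baseHt, st_baseHt]
      simp only [baseHt, slack]
      split_ifs <;> omega

lemma st_block (n : ℕ) : HEq' n (st n (baseHt n) (List.range' 1 (n + 1))) (flip n (-2) (baseHt n)) := by
  intro L h1 h2
  rw [st_baseHt]
  simp only [baseHt, slack, flip]
  split_ifs <;> omega

/-- Reading the first block acts on the base heights as the twisted shift by -2; the later blocks
are the iterated flips of this. -/
lemma block_iterate (n K : ℕ) :
    Adm n ((flip n (-2))^[K] (baseHt n)) ((List.map fun i => 2 * n + 2 - i)^[K] (List.range' 1 (n + 1))) ∧
    HEq' n (st n ((flip n (-2))^[K] (baseHt n))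
      ((List.map fun i => 2 * n + 2 - i)^[K] (List.range' 1 (n + 1)))) ((flip n (-2))^[K + 1] (baseHt n)) := by
  induction K with
  | zero => exact ⟨adm_block n (n + 1) le_rfl, st_block n⟩
  | succ K ih =>
    simp only [Function.iterate_succ_apply'] at *
    refine ⟨adm_flip _ ih.1, fun L h1 h2 => ?_⟩
    rw [st_flip _ ih.1 L h1 h2]
    exact ih.2.flip (-2) L h1 h2

lemma base_prefix (n K : ℕ) :
    Adm n (baseHt n) ((List.range K).flatMap fun k =>
      (List.map fun i => 2 * n + 2 - i)^[k] (List.range' 1 (n + 1))) ∧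
    HEq' n (st n (baseHt n) ((List.range K).flatMap fun k =>
      (List.map fun i => 2 * n + 2 - i)^[k] (List.range' 1 (n + 1)))) ((flip n (-2))^[K] (baseHt n)) := by
  induction K with
  | zero => exact ⟨trivial, fun L _ _ => by simp⟩
  | succ K ih =>
    rw [List.range_succ, List.flatMap_append, List.flatMap_singleton, adm_append, st_append]
    have hb := block_iterate n K
    exact ⟨⟨ih.1, ih.2.symm.adm hb.1⟩, fun L h1 h2 => (ih.2.st _ L h1 h2).trans (hb.2 L h1 h2)⟩

lemma flip_iterate (n : ℕ) (h : ℕ → ℤ) (K : ℕ) :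
    HEq' n ((flip n (-2))^[2 * K] h) fun L => h L - 4 * K := by
  induction K with
  | zero => intro L _ _; simp
  | succ K ih =>
    intro L h1 h2
    rw [show 2 * (K + 1) = 2 * K + 1 + 1 by ring, Function.iterate_succ_apply',
      Function.iterate_succ_apply']
    simp only [flip, show 2 * n + 2 - (2 * n + 2 - L) = L by omega]
    rw [ih L h1 h2]
    push_cast; ring

lemma st_baseWord (n : ℕ) :
    HEq' n (st n (baseHt n) (baseWord n)) (flip n (-(4 * n + 2)) (baseHt n)) := by
  intro L h1 h2
  rw [baseWord, (base_prefix n (2 * n + 1)).2 L h1 h2, Function.iterate_succ_apply']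
  simp only [flip]
  rw [flip_iterate n _ n _ (by omega) (by omega)]
  ring

/-- The labels of the diagonals for the base word. -/
def baseDiag (n : ℕ) (x : ℤ) : ℕ :=
  if 4 ∣ x then
    if (x / 4 + n) % (2 * n + 1) ≤ n then (1 + n - (x / 4 + n) % (2 * n + 1)).toNat
    else ((x / 4 + n) % (2 * n + 1) + 2).toNat
  else n + 2

lemma baseDiag_good (n : ℕ) : TGood n (baseDiag n) := by
  have hr : ∀ x : ℤ, 0 ≤ (x / 4 + n) % (2 * n + 1) ∧ (x / 4 + n) % (2 * n + 1) < 2 * n + 1 :=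
    fun x => ⟨Int.emod_nonneg _ (by omega), Int.emod_lt_of_pos _ (by omega)⟩
  refine ⟨fun x y => ?_, fun x => ?_⟩
  · have h1 := hr x
    have h2 := hr y
    by_cases hx : 4 ∣ x
    · by_cases hy : 4 ∣ y
      · have key : (8 * (n : ℤ) + 4) ∣ x - y ↔
            (x / 4 + n) % (2 * n + 1) = (y / 4 + n) % (2 * n + 1) := by
          obtain ⟨x, rfl⟩ := hx
          obtain ⟨y, rfl⟩ := hy
          rw [Int.mul_ediv_cancel_left _ (by norm_num), Int.mul_ediv_cancel_left _ (by norm_num),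
            show 8 * (n : ℤ) + 4 = 4 * (2 * n + 1) by ring, ← mul_sub,
            mul_dvd_mul_iff_left (by norm_num), eq_comm (a := (x + n) % _)]
          change _ ↔ _ ≡ _ [ZMOD _]
          rw [Int.modEq_iff_dvd, add_sub_add_right_eq_sub]
        simp only [baseDiag, hx, hy, if_true, key, not_true, false_and, or_false, true_and]
        split_ifs <;> omega
      · simp only [baseDiag, hx, hy, if_true, if_false, not_true, false_and, or_false, true_and]
        constructor
        · intro h; split_ifs at h <;> omega
        · rintro ⟨k, hk⟩
          exact absurd ((Int.dvd_iff_dvd_of_dvd_sub ⟨k * (2 * n + 1), by rw [hk]; ring⟩).1 hx) hy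
    · by_cases hy : 4 ∣ y
      · simp only [baseDiag, hx, hy, if_true, if_false, not_true, false_and, and_false, or_false]
        constructor
        · intro h; split_ifs at h <;> omega
        · simp
      · simp [baseDiag, hx, hy]
  · have h1 := hr x
    simp only [baseDiag]
    split_ifs <;> omega

/-- Up to a period, ε_b lies on the diagonal -4(b-1) for b ≤ n+1 and on 4(b-n-2) for b ≥ n+3;
ε_{n+2} lies on -4n-2, which is not divisible by 4. -/
lemma lab_base (n : ℕ) (hn : 1 ≤ n) : Lab n (baseHt n) id (baseDiag n) := by
  intro a h1 h2
  have hT := baseDiag_good n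
  have v1 : ∀ b : ℕ, 1 ≤ b → b ≤ n + 1 → baseDiag n (-4 * ((b : ℤ) - 1)) = b := by
    intro b h3 h4
    have : (-4 * ((b : ℤ) - 1)) / 4 + n = n + 1 - b := by omega
    rw [baseDiag, if_pos (by omega), this, Int.emod_eq_of_lt (by omega) (by omega)]
    rw [if_pos (by omega)]; omega
  have v2 : ∀ b : ℕ, n + 3 ≤ b → b ≤ 2 * n + 2 → baseDiag n (4 * ((b : ℤ) - n - 2)) = b := by
    intro b h3 h4
    have : (4 * ((b : ℤ) - n - 2)) / 4 + n = b - 2 := by omega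
    rw [baseDiag, if_pos (by omega), this, Int.emod_eq_of_lt (by omega) (by omega)]
    rw [if_neg (by omega)]; omega
  have b0 : (a ≤ n ∧ baseHt n a = -2 * a) ∨ (a = n + 1 ∧ baseHt n a = -2 * n - 1) ∨
      (n + 2 ≤ a ∧ baseHt n a = 2 * a - 4 * n - 6) := by
    simp only [baseHt]; split_ifs <;> omega
  have b1 : (a - 1 ≤ n ∧ baseHt n (a - 1) = -2 * (a - 1)) ∨
      (a = n + 2 ∧ baseHt n (a - 1) = -2 * n - 1) ∨
      (n + 3 ≤ a ∧ baseHt n (a - 1) = 2 * (a - 1) - 4 * n - 6) := by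
    simp only [baseHt]; split_ifs <;> omega
  have s0 := rho_slack n a
  have s1 := rho_slack n (a - 1)
  rcases Nat.lt_or_ge (n + 1) a with h3 | h3
  · rcases Nat.lt_or_ge (n + 2) a with h4 | h4
    · rw [id, ← v2 a (by omega) h2]
      refine (hT.congr ?_).symm
      rw [v2 a (by omega) h2]
      rw [edge]
      split_ifs <;> omega
    · have : a = n + 2 := by omega
      rw [edge, if_neg (by omega), baseDiag, if_neg (by omega)]
      simpa using this
  · rw [id, ← v1 a h1 h3]
    refine (hT.congr ?_).symm
    rw [v1 a h1 h3]
    rw [edge]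
    split_ifs <;> omega

/-! ### Twisted adapted classes -/

/-- The word `w` reads the slice of the grid that starts at the heights `h`, and `T` labels
the diagonals. -/
structure Sys (n : ℕ) (w : List ℕ) (h : ℕ → ℤ) (T : ℤ → ℕ) : Prop where
  valid : Valid n h
  good : TGood n T
  lab : Lab n h id T
  adm : Adm n h w
  fin : HEq' n (st n h w) (flip n (-(4 * n + 2)) h)

lemma sys_base (n : ℕ) (hn : 1 ≤ n) : Sys n (baseWord n) (baseHt n) (baseDiag n) :=
  ⟨valid_base n, baseDiag_good n, lab_base n hn, (base_prefix n (2 * n + 1)).1, st_baseWord n⟩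

lemma CommStep.perm {w w' : List ℕ} (h : CommStep w w') : w.Perm w' := by
  obtain ⟨u, v, i, j, h⟩ := h
  exact (List.Perm.swap j i v).append_left u

lemma CommEquiv.perm {w w' : List ℕ} (h : CommEquiv w w') : w.Perm w' := by
  induction h with
  | refl => exact .refl _
  | tail _ h2 ih => exact ih.trans h2.perm

lemma adm_swap {n : ℕ} {h : ℕ → ℤ} {i j : ℕ} {v : List ℕ} (hij : i + 1 < j ∨ j + 1 < i)
    (ha : Adm n h (i :: j :: v)) : Adm n h (j :: i :: v) := by
  obtain ⟨⟨a1, a2, a3, a4⟩, ⟨b1, b2, b3, b4⟩, hv⟩ := ha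
  simp only [low_apply] at b3 b4
  rw [if_neg (by omega), if_neg (by omega)] at b3 b4
  refine ⟨⟨b1, b2, b3, b4⟩, ⟨a1, a2, ?_, ?_⟩, ?_⟩
  · simp only [low_apply]
    rw [if_neg (by omega), if_neg (by omega)]; exact a3
  · simp only [low_apply]
    rw [if_neg (by omega), if_neg (by omega)]; exact a4
  · convert hv using 1
    funext M
    simp only [low_apply]
    split_ifs <;> first | rfl | omega

lemma CommStep.adm {n : ℕ} {h : ℕ → ℤ} {w w' : List ℕ} (hw : CommStep w w') (ha : Adm n h w) :
    Adm n h w' := by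
  obtain ⟨u, v, i, j, hij⟩ := hw
  rw [adm_append] at *
  exact ⟨ha.1, adm_swap hij ha.2⟩

lemma CommEquiv.adm {n : ℕ} {h : ℕ → ℤ} {w w' : List ℕ} (hw : CommEquiv w w')
    (ha : Adm n h w) : Adm n h w' := by
  induction hw with
  | refl => exact ha
  | tail _ h2 ih => exact h2.adm ih

lemma CommEquiv.st_eq {n : ℕ} {h : ℕ → ℤ} {w w' : List ℕ} (hw : CommEquiv w w') :
    st n h w' = st n h w := by
  funext L
  simp only [st, hw.perm.count_eq]

lemma Sys.comm {n : ℕ} {w w' : List ℕ} {h : ℕ → ℤ} {T : ℤ → ℕ} (hs : Sys n w h T)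
    (hw : CommEquiv w w') : Sys n w' h T :=
  ⟨hs.valid, hs.good, hs.lab, hw.adm hs.adm, by rw [hw.st_eq]; exact hs.fin⟩

lemma flip_flip (n : ℕ) (c d : ℤ) (h : ℕ → ℤ) :
    HEq' n (flip n c (flip n d h)) fun L => h L + (d + c) := by
  intro L h1 h2
  simp only [flip, show 2 * n + 2 - (2 * n + 2 - L) = L by omega]
  ring

/-- Dropping i starts the slice at the lowered heights, with labels changed by s_i. The end of the
slice is a dual copy of its start, so the dual letter can be read there. -/
lemma Sys.refl_right {n : ℕ} (hn : 1 ≤ n) {i : ℕ} {u : List ℕ} {h : ℕ → ℤ} {T : ℤ → ℕ}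
    (hs : Sys n (i :: u) h T) : ∃ h' T', Sys n (u ++ [2 * n + 2 - i]) h' T' := by
  obtain ⟨hi, hu⟩ := hs.adm
  have hT' := hs.good.comp_swap hi.1 hi.2.1
  have hfin := hs.fin
  rw [st_cons] at hfin
  refine ⟨low n h i, _, valid_low hn hs.valid hi, hT', ?_, ?_, ?_⟩
  · intro a h1 h2
    have := lab_low hn hs.good hs.valid hs.lab hi a h1 h2
    simp only [id] at this ⊢
    rw [← this, Equiv.swap_apply_self]
  · rw [adm_append]
    exact ⟨hu, hfin.symm.readable (readable_flip _ hi), trivial⟩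
  · rw [st_append, st_singleton]
    intro L h1 h2
    rw [hfin.low (by have := hi.2.1; omega) (by have := hi.1; omega) L h1 h2]
    exact low_flip h _ hi.1 hi.2.1 L h1 h2

/-- The slice is extended upwards: dualizing the heights just before the last letter gives a start
from which the dual letter leads back to h. -/
lemma Sys.refl_left {n : ℕ} (hn : 1 ≤ n) {i : ℕ} {u : List ℕ} {h : ℕ → ℤ} {T : ℤ → ℕ}
    (hs : Sys n (u ++ [i]) h T) : ∃ h' T', Sys n ((2 * n + 2 - i) :: u) h' T' := by
  have hadm := hs.adm
  rw [adm_append] at hadm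
  obtain ⟨hu, hi, -⟩ := hadm
  have hfin := hs.fin
  rw [st_append, st_singleton] at hfin
  have hvu := valid_st hn hs.valid hu
  have hi1 := hi.1
  have hi2 := hi.2.1
  have hlow : HEq' n (low n (flip n (4 * n + 2) (st n h u)) (2 * n + 2 - i)) h := by
    intro L h1 h2
    rw [low_flip _ _ hi.1 hi.2.1 L h1 h2, hfin.flip _ L h1 h2, flip_flip n _ _ h L h1 h2]
    ring
  have hv' : Valid n (flip n (4 * n + 2) (st n h u)) := valid_flip (by omega) hvu
  have hr' := readable_flip (4 * n + 2) hi
  have hT' := hs.good.comp_swap hr'.1 hr'.2.1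
  refine ⟨flip n (4 * n + 2) (st n h u), _, hv', hT', ?_, ⟨hr', hlow.symm.adm hu⟩, ?_⟩
  -- Both `l2` and `hs.lab` label the heights h, so the product of u followed by a ↦ 2n+3-a on the
  -- argument is the simple reflection of the new letter. This is the correction built into the new
  -- labels.
  · have l1 := lab_flip (c := 4 * n + 2) (Or.inl rfl) hvu hs.good
      (lab_st (σ := 1) hn hs.good hs.valid hs.lab hu)
    have l2 := hlow.lab (lab_low hn hs.good hv' l1 hr')
    intro a h1 h2
    simp only [one_mul, id] at l1 l2 ⊢
    have r1 : 1 ≤ Equiv.swap (2 * n + 2 - i) (2 * n + 2 - i + 1) a ∧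
        Equiv.swap (2 * n + 2 - i) (2 * n + 2 - i + 1) a ≤ 2 * n + 2 := by
      simp only [Equiv.swap_apply_def]
      split_ifs <;> omega
    have e1 := l2 _ r1.1 r1.2
    have e2 := hs.lab _ r1.1 r1.2
    simp only [Equiv.swap_apply_self] at e1
    rw [← l1 a h1 h2]
    simp only
    rw [e1, ← e2, id, Equiv.swap_apply_self]
  · rw [st_cons]
    intro L h1 h2
    rw [hlow.st u L h1 h2, flip_flip n _ _ _ L h1 h2]
    ring

lemma sys_of_twistedAdapted {n : ℕ} (hn : 1 ≤ n) {w : List ℕ} (hw : TwistedAdapted n w) :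
    ∃ h T, Sys n w h T := by
  unfold TwistedAdapted ReflEquiv at hw
  induction hw with
  | refl => exact ⟨_, _, sys_base n hn⟩
  | tail _ h2 ih =>
    obtain ⟨h, T, hs⟩ := ih
    rcases h2 with h2 | ⟨i, u, h3, h4⟩ | ⟨i, u, h3, h4⟩
    · exact ⟨h, T, hs.comm h2⟩
    · obtain ⟨h', T', hs'⟩ := (hs.comm h3).refl_right hn
      exact ⟨h', T', hs'.comm h4⟩
    · obtain ⟨h', T', hs'⟩ := (hs.comm h3).refl_left hn
      exact ⟨h', T', hs'.comm h4⟩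

/-! ### Positions of a word as points of the grid. -/

lemma letter_eq {w : List ℕ} {t : ℕ} (ht : t < w.length) : letter w t = w[t] := by
  simp [letter, ht]

lemma take_succ_letter {w : List ℕ} {t : ℕ} (ht : t < w.length) :
    w.take (t + 1) = w.take t ++ [letter w t] := by
  rw [letter_eq ht, List.take_append_getElem ht]

lemma split_at {w : List ℕ} {t : ℕ} (ht : t < w.length) :
    w = w.take t ++ letter w t :: w.drop (t + 1) := by
  rw [letter_eq ht]; simp

lemma letter_mem {w : List ℕ} {t : ℕ} (ht : t < w.length) : letter w t ∈ w := by
  rw [letter_eq ht]; exact List.getElem_mem ht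

/-- The grid point that belongs to a position of a word. -/
def pt (n : ℕ) (h : ℕ → ℤ) (w : List ℕ) (t : ℕ) : ℕ × ℤ :=
  (letter w t, st n h (w.take t) (letter w t))

/-- The root at a grid point. -/
def root (n : ℕ) (T : ℤ → ℕ) (P : ℕ × ℤ) : Lat := rt (T (P.2 + rho n P.1)) (T (P.2 - rho n P.1))

/-- The grid points that are read by the word `w`. -/
def InS (n : ℕ) (h : ℕ → ℤ) (w : List ℕ) (P : ℕ × ℤ) : Prop :=
  ∃ k, k < w.count P.1 ∧ P.2 = h P.1 - (4 - slack n P.1) * (k : ℤ)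

/-- The order of the grid: `P` comes before `Q` in every word. -/
def Ge (n : ℕ) (P Q : ℕ × ℤ) : Prop :=
  rho n P.1 - rho n Q.1 ≤ P.2 - Q.2 ∧ rho n Q.1 - rho n P.1 ≤ P.2 - Q.2

lemma Ge.trans {n : ℕ} {P Q R : ℕ × ℤ} (h1 : Ge n P Q) (h2 : Ge n Q R) : Ge n P R := by
  unfold Ge at *; omega

lemma Adm.take {n : ℕ} {h : ℕ → ℤ} {w : List ℕ} (ha : Adm n h w) (t : ℕ) :
    Adm n h (w.take t) := by
  rw [← List.take_append_drop t w, adm_append] at ha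
  exact ha.1

lemma Adm.readable {n : ℕ} {h : ℕ → ℤ} {w : List ℕ} (ha : Adm n h w) {t : ℕ}
    (ht : t < w.length) : Readable n (st n h (w.take t)) (letter w t) := by
  rw [split_at ht, adm_append] at ha
  exact ha.2.1

lemma st_take_succ {n : ℕ} {h : ℕ → ℤ} {w : List ℕ} {t : ℕ} (ht : t < w.length) :
    st n h (w.take (t + 1)) = low n (st n h (w.take t)) (letter w t) := by
  rw [take_succ_letter ht, st_append, st_singleton]

lemma slack_le (n L : ℕ) : 0 ≤ slack n L ∧ slack n L ≤ 2 := by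
  have := rho_slack n L; omega

lemma st_mono (n : ℕ) (h : ℕ → ℤ) {u v : List ℕ} {L : ℕ} (huv : u.count L ≤ v.count L) :
    st n h v L ≤ st n h u L := by
  have := slack_le n L
  simp only [st]
  have : (u.count L : ℤ) ≤ v.count L := by exact_mod_cast huv
  nlinarith

lemma count_take_mono (w : List ℕ) (L : ℕ) {s t : ℕ} (h : s ≤ t) :
    (w.take s).count L ≤ (w.take t).count L :=
  (List.take_sublist_take_left h).count_le L

lemma st_take_lt {n : ℕ} {h : ℕ → ℤ} {w : List ℕ} {s t : ℕ} (hst : s < t) (hs : s < w.length) :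
    st n h (w.take t) (letter w s) ≤
      st n h (w.take s) (letter w s) - (4 - slack n (letter w s)) := by
  have h1 := st_mono n h (count_take_mono w (letter w s) (show s + 1 ≤ t from hst))
  rw [st_take_succ hs, low_apply, if_pos rfl] at h1
  exact h1

lemma pt_inj {n : ℕ} {h : ℕ → ℤ} {w : List ℕ} {s t : ℕ} (hs : s < w.length) (ht : t < w.length)
    (e : pt n h w s = pt n h w t) : s = t := by
  have key : ∀ {s t : ℕ}, s < t → s < w.length → pt n h w s ≠ pt n h w t := by
    intro s t hst hs e
    obtain ⟨e1, e2⟩ := Prod.mk.inj e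
    have h1 := st_take_lt (n := n) (h := h) hst hs
    have h2 := slack_le n (letter w s)
    rw [← e1] at e2
    omega
  rcases Nat.lt_trichotomy s t with h1 | h1 | h1
  · exact absurd e (key h1 hs)
  · exact h1
  · exact absurd e.symm (key h1 ht)

lemma exists_occurrence {w : List ℕ} {L k : ℕ} (hk : k < w.count L) :
    ∃ t, t < w.length ∧ letter w t = L ∧ (w.take t).count L = k := by
  induction w generalizing k with
  | nil => simp at hk
  | cons c v ih =>
    by_cases hc : c = L
    · subst hc
      rcases k with - | k
      · exact ⟨0, by simp, by simp [letter], by simp⟩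
      · obtain ⟨t, h1, h2, h3⟩ := ih (k := k) (by simpa using hk)
        exact ⟨t + 1, by simpa using h1, by simpa [letter] using h2, by simp [h3]⟩
    · rw [List.count_cons_of_ne hc] at hk
      obtain ⟨t, h1, h2, h3⟩ := ih hk
      refine ⟨t + 1, by simpa using h1, by simpa [letter] using h2, ?_⟩
      rw [List.take_succ_cons, List.count_cons_of_ne hc, h3]

lemma inS_pt {n : ℕ} {h : ℕ → ℤ} {w : List ℕ} {t : ℕ} (ht : t < w.length) :
    InS n h w (pt n h w t) := by
  refine ⟨(w.take t).count (letter w t), ?_, rfl⟩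
  have e := congrArg (List.count (letter w t)) (split_at ht)
  rw [List.count_append, List.count_cons_self] at e
  simp only [pt]
  omega

lemma InS.exists_pt {n : ℕ} {h : ℕ → ℤ} {w : List ℕ} {P : ℕ × ℤ} (hP : InS n h w P) :
    ∃ t, t < w.length ∧ pt n h w t = P := by
  obtain ⟨k, hk, e⟩ := hP
  obtain ⟨t, h1, h2, h3⟩ := exists_occurrence hk
  refine ⟨t, h1, ?_⟩
  apply Prod.ext
  · exact h2
  · simp only [pt, st, h2, h3, e]

lemma InS.comm {n : ℕ} {h : ℕ → ℤ} {w w' : List ℕ} {P : ℕ × ℤ} (hP : InS n h w P)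
    (hw : CommEquiv w w') : InS n h w' P := by
  obtain ⟨k, hk, e⟩ := hP
  exact ⟨k, by rwa [← hw.perm.count_eq], e⟩

/-- Points that are greater in the grid are read earlier. -/
lemma lt_of_ge {n : ℕ} (hn : 1 ≤ n) {h : ℕ → ℤ} {w : List ℕ} (hv : Valid n h) (ha : Adm n h w)
    {s t : ℕ} (hs : s < w.length) (ht : t < w.length) (hg : Ge n (pt n h w s) (pt n h w t))
    (hne : s ≠ t) : s < t := by
  by_contra hc
  have hts : t < s := by omega
  have h1 := st_take_lt (n := n) (h := h) hts ht
  have hv' := valid_st hn hv (ha.take s)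
  have r1 := (ha.readable hs).1
  have r2 := (ha.readable hs).2.1
  have r3 := (ha.readable ht).1
  have r4 := (ha.readable ht).2.1
  have s1 := rho_slack n (letter w s)
  have s2 := rho_slack n (letter w t)
  obtain ⟨g1, g2⟩ := hg
  simp only [pt] at g1 g2
  rcases Nat.lt_trichotomy (letter w s) (letter w t) with e | e | e
  · have := hv'.le _ _ r1 e.le r4
    omega
  · rw [e] at g1 g2
    omega
  · have := hv'.le _ _ r3 e.le r2
    omega

/-! ### Commuting letters past points that are incomparable in the grid. -/

lemma CommEquiv.cons {w w' : List ℕ} (c : ℕ) (h : CommEquiv w w') :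
    CommEquiv (c :: w) (c :: w') := by
  induction h with
  | refl => exact .refl
  | tail _ h2 ih =>
    refine ih.tail ?_
    obtain ⟨u, v, i, j, hij⟩ := h2
    exact CommStep.swap (c :: u) v i j hij

lemma comm_move {c : ℕ} {y : List ℕ} (hy : ∀ M ∈ y, c + 1 < M ∨ M + 1 < c) (z : List ℕ) :
    CommEquiv (c :: (y ++ z)) (y ++ c :: z) := by
  induction y with
  | nil => exact .refl
  | cons M y ih =>
    have h1 : CommStep (c :: M :: (y ++ z)) (M :: c :: (y ++ z)) :=
      CommStep.swap [] (y ++ z) c M (hy M (by simp))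
    exact Relation.ReflTransGen.head h1 ((ih fun K hK => hy K (by simp [hK])).cons M)

lemma pt_cons_succ (n : ℕ) (h : ℕ → ℤ) (c : ℕ) (v : List ℕ) (t : ℕ) :
    pt n h (c :: v) (t + 1) = pt n (low n h c) v t := by
  simp [pt, letter, st_cons]

lemma pt_append (n : ℕ) (h : ℕ → ℤ) {x z : List ℕ} {t : ℕ} (ht : t < x.length) :
    pt n h (x ++ z) t = pt n h x t := by
  have : letter (x ++ z) t = letter x t := by simp [letter, List.getElem?_append_left ht]
  rw [pt, pt, this, List.take_append_of_le_length ht.le]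

lemma st_low_of_ne {n : ℕ} {h : ℕ → ℤ} {c M : ℕ} (hM : c ≠ M) (x : List ℕ) :
    st n (low n h c) x M = st n h x M := by
  simp only [st, low_apply, if_neg hM.symm]

/-- Heights only fall, and the congruences turn a strict inequality between adjacent rows into a gap
of at least their distance. -/
lemma ge_of_adj {n : ℕ} {h : ℕ → ℤ} (hv : Valid n h) {c M : ℕ} (hr : Readable n h c)
    (h1 : 1 ≤ M) (h2 : M ≤ 2 * n + 1) (hM : ¬ (c + 1 < M ∨ M + 1 < c)) (x : List ℕ) :
    Ge n (c, h c) (M, st n (low n h c) x M) := by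
  have s0 := slack_le n c
  have hx : st n (low n h c) x M ≤ low n h c M := by
    simpa using st_mono n (low n h c) (u := []) (v := x) (L := M) (by simp)
  obtain ⟨r1, r2, r3, r4⟩ := hr
  have g1 := hv.cong c r1 r2
  have g2 := hv.cong M h1 h2
  have g3 := hv.mid
  have s1 := rho_slack n c
  have s2 := rho_slack n M
  rw [low_apply] at hx
  unfold Ge
  by_cases e : M = c
  · subst e
    rw [if_pos rfl] at hx
    simp only
    omega
  · rw [if_neg e] at hx
    have hlt : h M < h c := by
      by_cases e2 : M = c + 1
      · subst e2; exact r4 (by omega)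
      · have : M = c - 1 := by omega
        subst this; exact r3 (by omega)
    have m1 : c = n + 1 → ¬ 2 ∣ h c := by rintro rfl; exact g3
    have m2 : M = n + 1 → ¬ 2 ∣ h M := by rintro rfl; exact g3
    simp only
    omega

/-- The points that are not forced to be read before a given point can be moved behind it. -/
lemma exists_sorted {n : ℕ} (hn : 1 ≤ n) {h : ℕ → ℤ} {w : List ℕ} (hv : Valid n h)
    (ha : Adm n h w) {t : ℕ} (ht : t < w.length) :
    ∃ x z, CommEquiv w (x ++ (pt n h w t).1 :: z) ∧
      st n h x (pt n h w t).1 = (pt n h w t).2 ∧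
      ∀ s, s < x.length → Ge n (pt n h x s) (pt n h w t) := by
  induction w generalizing h t with
  | nil => simp at ht
  | cons c v ih =>
    obtain ⟨hc, hav⟩ := ha
    rcases t with - | t
    · exact ⟨[], v, .refl, by simp [pt, letter], by simp⟩
    · rw [pt_cons_succ]
      have ht' : t < v.length := by simpa using ht
      obtain ⟨x, z, h1, h2, h3⟩ := ih (valid_low hn hv hc) hav ht'
      generalize hP : pt n (low n h c) v t = P at *
      have hPr : 1 ≤ P.1 ∧ P.1 ≤ 2 * n + 1 := by
        rw [← hP]; exact hav.range _ (letter_mem ht')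
      have hax : Adm n (low n h c) (x ++ P.1 :: z) := h1.adm hav
      rw [adm_append] at hax
      by_cases hg : Ge n (c, h c) P
      · refine ⟨c :: x, z, h1.cons c, ?_, ?_⟩
        · rw [st_cons]; exact h2
        · intro s hs
          rcases s with - | s
          · simpa [pt, letter] using hg
          · rw [pt_cons_succ]; exact h3 s (by simpa using hs)
      -- All points of x are above P. If c were equal or adjacent to one of their letters, it would
      -- be above P by transitivity; hence c commutes past x and, likewise, past P.
      · have hx : ∀ s, s < x.length → c + 1 < letter x s ∨ letter x s + 1 < c := by
          intro s hs
          by_contra hcon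
          have hr := hax.1.range _ (letter_mem hs)
          exact hg ((ge_of_adj hv hc hr.1 hr.2 hcon (x.take s)).trans (h3 s hs))
        have hL : c + 1 < P.1 ∨ P.1 + 1 < c := by
          by_contra hcon
          have := ge_of_adj hv hc hPr.1 hPr.2 hcon x
          rw [h2] at this
          exact hg this
        refine ⟨x, c :: z, ?_, ?_, ?_⟩
        · have h4 := comm_move (c := c) (y := x ++ [P.1]) (by
            intro M hM
            rcases List.mem_append.1 hM with hM | hM
            · obtain ⟨s, hs, rfl⟩ := List.getElem_of_mem hM
              rw [← letter_eq hs]; exact hx s hs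
            · rw [List.mem_singleton.1 hM]; exact hL) z
          have h5 := h1.cons c
          simp only [List.append_assoc, List.singleton_append] at h4
          exact h5.trans h4
        · rw [← h2, st_low_of_ne (by omega)]
        · intro s hs
          have := h3 s hs
          have h6 := hx s hs
          simp only [pt] at this ⊢
          rwa [st_low_of_ne (by omega)] at this

/-! ### Roots at grid points -/

lemma Sys.rootAt_eq {n : ℕ} (hn : 1 ≤ n) {w : List ℕ} {h : ℕ → ℤ} {T : ℤ → ℕ}
    (hs : Sys n w h T) {t : ℕ} (ht : t < w.length) : rootAt w t = root n T (pt n h w t) := by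
  have hr := hs.adm.readable ht
  have hl := lab_st (σ := 1) hn hs.good hs.valid hs.lab (hs.adm.take t)
  have h1 := hr.1
  have h2 := hr.2.1
  rw [rootAt, act_simpleRoot, root]
  rw [one_mul] at hl
  rw [hl _ h1 (by omega), hl _ (by omega) (by omega), edge_up hr, edge_down hr]
  rfl

lemma InS.range {n : ℕ} {w : List ℕ} {h : ℕ → ℤ} {T : ℤ → ℕ} (hs : Sys n w h T) {P : ℕ × ℤ}
    (hP : InS n h w P) : 1 ≤ P.1 ∧ P.1 ≤ 2 * n + 1 := by
  obtain ⟨k, hk, -⟩ := hP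
  exact hs.adm.range _ (List.count_pos_iff.1 (by omega))

lemma InS.arith {n : ℕ} {w : List ℕ} {h : ℕ → ℤ} {T : ℤ → ℕ} (hs : Sys n w h T) {P : ℕ × ℤ}
    (hP : InS n h w P) :
    (1 ≤ P.1 ∧ P.1 ≤ n ∧ rho n P.1 = 2 * P.1 ∧ 4 ∣ P.2 + rho n P.1) ∨
    (P.1 = n + 1 ∧ rho n P.1 = 2 * n + 1 ∧ ¬ 2 ∣ P.2) ∨
    (n + 2 ≤ P.1 ∧ P.1 ≤ 2 * n + 1 ∧ rho n P.1 = 2 * P.1 - 2 ∧ 4 ∣ P.2 + rho n P.1) := by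
  have hr := hP.range hs
  obtain ⟨k, hk, e⟩ := hP
  have g1 := hs.valid.cong P.1 hr.1 hr.2
  have g2 : P.1 = n + 1 → ¬ 2 ∣ h P.1 := by intro e; rw [e]; exact hs.valid.mid
  rcases rho_slack n P.1 with ⟨e1, e2, e3⟩ | ⟨e1, e2, e3⟩ | ⟨e1, e2, e3⟩ <;> rw [e3] at e <;> omega

/-- The last point of a row is one step `4 - slack` above the final height, which is the starting
height of the dual row minus 4n+2. -/
lemma InS.bounds {n : ℕ} {w : List ℕ} {h : ℕ → ℤ} {T : ℤ → ℕ} (hs : Sys n w h T) {P : ℕ × ℤ}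
    (hP : InS n h w P) :
    P.2 ≤ h P.1 ∧ h (2 * n + 2 - P.1) - 4 * n + 2 - slack n P.1 ≤ P.2 := by
  have hr := hP.range hs
  have hf := hs.fin P.1 hr.1 hr.2
  obtain ⟨k, hk, e⟩ := hP
  have h0 := slack_le n P.1
  simp only [st, flip] at hf
  have hk' : (k : ℤ) + 1 ≤ w.count P.1 := by exact_mod_cast hk
  constructor
  · rw [e]; nlinarith
  · rw [e]; nlinarith

/-- Any two points of the slice are less than half a period apart. -/
lemma InS.near {n : ℕ} {w : List ℕ} {h : ℕ → ℤ} {T : ℤ → ℕ} (hs : Sys n w h T) {P Q : ℕ × ℤ}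
    (hP : InS n h w P) (hQ : InS n h w Q) :
    P.2 - Q.2 ≤ rho n P.1 + rho n Q.1 - 2 ∨ P.2 - Q.2 ≤ 8 * n + 2 - rho n P.1 - rho n Q.1 := by
  have hp := hP.range hs
  have hq := hQ.range hs
  have b1 := hP.bounds hs
  have b2 := hQ.bounds hs
  have s1 := rho_slack n P.1
  have s2 := rho_slack n Q.1
  have s3 := rho_slack n (2 * n + 2 - Q.1)
  rcases Nat.lt_trichotomy P.1 (2 * n + 2 - Q.1) with e | e | e
  -- P is bounded above through its own row and Q below through its dual row, so these two rows are
  -- compared.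
  · have := hs.valid.le P.1 (2 * n + 2 - Q.1) (by omega) (by omega) (by omega)
    omega
  · rw [← e] at b2 s3
    omega
  · have := hs.valid.le (2 * n + 2 - Q.1) P.1 (by omega) (by omega) (by omega)
    omega

lemma eq_zero_of_dvd {N d : ℤ} (hd : N ∣ d) (h1 : -N < d) (h2 : d < N) : d = 0 := by
  obtain ⟨k, rfl⟩ := hd
  have hN : 0 < N := by omega
  have : k < 1 := by nlinarith
  have : -1 < k := by nlinarith
  have : k = 0 := by omega
  simp [this]

/-- Two upper diagonals in the slice differ by less than a period, so equal labels on multiples of 4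
mean equal diagonals. -/
lemma T_add_eq {n : ℕ} {w : List ℕ} {h : ℕ → ℤ} {T : ℤ → ℕ} (hs : Sys n w h T) {P Q : ℕ × ℤ}
    (hP : InS n h w P) (hQ : InS n h w Q)
    (e : T (P.2 + rho n P.1) = T (Q.2 + rho n Q.1)) :
    (P.2 + rho n P.1 = Q.2 + rho n Q.1 ∧ 4 ∣ P.2 + rho n P.1) ∨
      (¬ 4 ∣ P.2 + rho n P.1 ∧ ¬ 4 ∣ Q.2 + rho n Q.1) := by
  have a1 := hP.arith hs
  have a2 := hQ.arith hs
  have n1 := hP.near hs hQ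
  have n2 := hQ.near hs hP
  rw [hs.good.eq_iff] at e
  rcases e with ⟨e1, e2⟩ | e
  · left
    have := eq_zero_of_dvd e2 (by omega) (by omega)
    exact ⟨by omega, e1⟩
  · exact Or.inr e

lemma T_sub_eq {n : ℕ} {w : List ℕ} {h : ℕ → ℤ} {T : ℤ → ℕ} (hs : Sys n w h T) {P Q : ℕ × ℤ}
    (hP : InS n h w P) (hQ : InS n h w Q)
    (e : T (P.2 - rho n P.1) = T (Q.2 - rho n Q.1)) :
    (P.2 - rho n P.1 = Q.2 - rho n Q.1 ∧ 4 ∣ P.2 - rho n P.1) ∨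
      (¬ 4 ∣ P.2 - rho n P.1 ∧ ¬ 4 ∣ Q.2 - rho n Q.1) := by
  have a1 := hP.arith hs
  have a2 := hQ.arith hs
  have n1 := hP.near hs hQ
  have n2 := hQ.near hs hP
  rw [hs.good.eq_iff] at e
  rcases e with ⟨e1, e2⟩ | e
  · left
    have := eq_zero_of_dvd e2 (by omega) (by omega)
    exact ⟨by omega, e1⟩
  · exact Or.inr e

/-- A lower diagonal is less than one period above an upper one but may be almost two periods below
it, which leaves room for one wrap-around. -/
lemma T_sub_eq_add {n : ℕ} {w : List ℕ} {h : ℕ → ℤ} {T : ℤ → ℕ} (hs : Sys n w h T) {P Q : ℕ × ℤ}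
    (hP : InS n h w P) (hQ : InS n h w Q)
    (e : T (P.2 - rho n P.1) = T (Q.2 + rho n Q.1)) :
    ((Q.2 + rho n Q.1 = P.2 - rho n P.1 ∨ Q.2 + rho n Q.1 = P.2 - rho n P.1 + (8 * n + 4)) ∧
      4 ∣ P.2 - rho n P.1) ∨
      (¬ 4 ∣ P.2 - rho n P.1 ∧ ¬ 4 ∣ Q.2 + rho n Q.1) := by
  have a1 := hP.arith hs
  have a2 := hQ.arith hs
  have n1 := hP.near hs hQ
  have n2 := hQ.near hs hP
  rw [hs.good.eq_iff] at e
  rcases e with ⟨e1, e2⟩ | e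
  · left
    refine ⟨?_, e1⟩
    rcases lt_or_ge (P.2 - rho n P.1) (Q.2 + rho n Q.1) with h1 | h1
    · have := eq_zero_of_dvd (dvd_add e2 (dvd_refl _)) (by omega) (by omega)
      omega
    · have := eq_zero_of_dvd e2 (by omega) (by omega)
      omega
  · exact Or.inr e

lemma root_ne {n : ℕ} {w : List ℕ} {h : ℕ → ℤ} {T : ℤ → ℕ} (hs : Sys n w h T) {P : ℕ × ℤ}
    (hP : InS n h w P) : T (P.2 + rho n P.1) ≠ T (P.2 - rho n P.1) := by
  intro e
  have a1 := hP.arith hs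
  have := T_sub_eq_add hs hP hP e.symm
  omega

lemma root_inj {n : ℕ} {w : List ℕ} {h : ℕ → ℤ} {T : ℤ → ℕ} (hs : Sys n w h T) {P Q : ℕ × ℤ}
    (hP : InS n h w P) (hQ : InS n h w Q) (e : root n T P = root n T Q) : P = Q := by
  obtain ⟨e1, e2⟩ := rt_inj (root_ne hs hP) e
  have a1 := hP.arith hs
  have a2 := hQ.arith hs
  have e3 := T_add_eq hs hP hQ e1
  have e4 := T_sub_eq hs hP hQ e2
  apply Prod.ext <;> omega

lemma before_iff {n : ℕ} (hn : 1 ≤ n) {w : List ℕ} {h : ℕ → ℤ} {T : ℤ → ℕ} (hs : Sys n w h T)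
    {P Q : ℕ × ℤ} (hP : InS n h w P) (hQ : InS n h w Q) :
    Before w (root n T P) (root n T Q) ↔
      ∃ k l, k < l ∧ l < w.length ∧ pt n h w k = P ∧ pt n h w l = Q := by
  constructor
  · rintro ⟨k, l, h1, h2, h3, h4⟩
    rw [hs.rootAt_eq hn (by omega)] at h3
    rw [hs.rootAt_eq hn (by omega)] at h4
    exact ⟨k, l, h1, h2, root_inj hs (inS_pt (by omega)) hP h3, root_inj hs (inS_pt h2) hQ h4⟩
  · rintro ⟨k, l, h1, h2, rfl, rfl⟩
    exact ⟨k, l, h1, h2, hs.rootAt_eq hn (by omega), hs.rootAt_eq hn h2⟩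

lemma before_of_ge {n : ℕ} (hn : 1 ≤ n) {w : List ℕ} {h : ℕ → ℤ} {T : ℤ → ℕ} (hs : Sys n w h T)
    {P Q : ℕ × ℤ} (hP : InS n h w P) (hQ : InS n h w Q) (hg : Ge n P Q) (hne : P ≠ Q) :
    ∃ k l, k < l ∧ l < w.length ∧ pt n h w k = P ∧ pt n h w l = Q := by
  obtain ⟨k, hk, rfl⟩ := hP.exists_pt
  obtain ⟨l, hl, rfl⟩ := hQ.exists_pt
  exact ⟨k, l, lt_of_ge hn hs.valid hs.adm hk hl hg fun e => hne (by rw [e]), hl, rfl, rfl⟩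

/-- The partial order of the commutation class is the order of the grid. -/
lemma prec_iff {n : ℕ} (hn : 1 ≤ n) {w : List ℕ} {h : ℕ → ℤ} {T : ℤ → ℕ} (hs : Sys n w h T)
    {P Q : ℕ × ℤ} (hP : InS n h w P) (hQ : InS n h w Q) :
    Prec w (root n T P) (root n T Q) ↔ Ge n P Q ∧ P ≠ Q := by
  constructor
  · intro hp
    obtain ⟨t, ht, rfl⟩ := hQ.exists_pt
    -- In this word of the class only points above Q precede Q, and P must be among them.
    obtain ⟨x, z, h1, h2, h3⟩ := exists_sorted hn hs.valid hs.adm ht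
    have hs' := hs.comm h1
    obtain ⟨k, l, h4, h5, h6, h7⟩ := (before_iff hn hs' (hP.comm h1) (hQ.comm h1)).1 (hp _ h1)
    have h8 : pt n h (x ++ (pt n h w t).1 :: z) x.length = pt n h w t := by
      apply Prod.ext
      · simp [pt, letter]
      · rw [← h2]; simp [pt, letter]
    have h9 := pt_inj h5 (by simp) (h7.trans h8.symm)
    subst h9
    have h10 := pt_append n h (z := (pt n h w t).1 :: z) h4
    refine ⟨?_, ?_⟩
    · rw [← h6, h10]; exact h3 k h4
    · rintro rfl
      have := pt_inj (by omega) h5 (h6.trans h7.symm)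
      omega
  · rintro ⟨hg, hne⟩ w' hw'
    have hs' := hs.comm hw'
    rw [before_iff hn hs' (hP.comm hw') (hQ.comm hw')]
    exact before_of_ge hn hs' (hP.comm hw') (hQ.comm hw') hg hne

/-! ### Words adapted to Dynkin quivers of type `A_m` -/

/-- The heights after reading the letter `L` in type `A_m`. -/
def qlow (g : ℕ → ℤ) (L : ℕ) : ℕ → ℤ := fun M => if M = L then g L - 4 else g M

/-- The heights after reading the word `u` in type `A_m`. -/
def qst (g : ℕ → ℤ) (u : List ℕ) : ℕ → ℤ := fun L => g L - 4 * (u.count L : ℤ)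

/-- The letter `L` is a local maximum of the heights. -/
def QReadable (m : ℕ) (g : ℕ → ℤ) (L : ℕ) : Prop :=
  1 ≤ L ∧ L ≤ m ∧ (1 < L → g (L - 1) < g L) ∧ (L < m → g (L + 1) < g L)

/-- Every letter of the word is a local maximum when it is read. -/
def QAdm (m : ℕ) : (ℕ → ℤ) → List ℕ → Prop
  | _, [] => True
  | g, L :: u => QReadable m g L ∧ QAdm m (qlow g L) u

/-- Adjacent heights differ by `2`. -/
def QValid (m : ℕ) (g : ℕ → ℤ) : Prop :=
  ∀ L, 1 ≤ L → L < m → g L - g (L + 1) = 2 ∨ g L - g (L + 1) = -2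

lemma qst_cons (g : ℕ → ℤ) (L : ℕ) (u : List ℕ) : qst g (L :: u) = qst (qlow g L) u := by
  funext M
  simp only [qst, qlow, List.count_cons]
  by_cases hM : M = L
  · subst hM; simp; ring
  · have : (L == M) = false := by simp [Ne.symm hM]
    simp [hM, this]

lemma qadm_append {m : ℕ} {g : ℕ → ℤ} {u v : List ℕ} :
    QAdm m g (u ++ v) ↔ QAdm m g u ∧ QAdm m (qst g u) v := by
  induction u generalizing g with
  | nil =>
    have : qst g [] = g := by funext L; simp [qst]
    simp [QAdm, this]
  | cons L u ih => simp [QAdm, ih, qst_cons, and_assoc]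

lemma qvalid_low {m : ℕ} {g : ℕ → ℤ} (hv : QValid m g) {L : ℕ} (hr : QReadable m g L) :
    QValid m (qlow g L) := by
  obtain ⟨h1, h2, h3, h4⟩ := hr
  intro M h5 h6
  have h7 := hv M h5 h6
  simp only [qlow]
  by_cases e : M = L
  · subst e
    have := h4 h6
    rw [if_pos rfl, if_neg (by omega)]; omega
  · by_cases e2 : M + 1 = L
    · subst e2
      have := h3 (by omega)
      simp only [Nat.add_one_sub_one] at this
      rw [if_neg (by omega), if_pos rfl]; omega
    · rw [if_neg e, if_neg e2]; exact h7

lemma IsDynkinQuiver.reverseAt {m : ℕ} {Q : ℕ → ℕ → Prop} (hQ : IsDynkinQuiver m Q) (i : ℕ) :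
    IsDynkinQuiver m (reverseAt i Q) := by
  constructor
  · intro a b hab
    unfold TwAR.reverseAt at hab
    split_ifs at hab
    · obtain ⟨h1, h2, h3, h4, h5⟩ := hQ.1 b a hab
      exact ⟨h3, h4, h1, h2, h5.symm⟩
    · exact hQ.1 a b hab
  · intro a h1 h2
    have := hQ.2 a h1 h2
    unfold TwAR.reverseAt
    by_cases hc : a = i ∨ a + 1 = i
    · rw [if_pos hc, if_pos hc.symm]; exact (xor_comm _ _).mp this
    · rw [if_neg hc, if_neg fun h => hc h.symm]; exact this

lemma IsHeight.reverseAt {m : ℕ} {Q : ℕ → ℕ → Prop} (hQ : IsDynkinQuiver m Q) {ξ : ℕ → ℤ}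
    (hξ : IsHeight Q ξ) {i : ℕ} (hi : IsSink m Q i) :
    IsHeight (reverseAt i Q) fun M => if M = i then ξ i - 2 else ξ M := by
  intro a b hab
  unfold TwAR.reverseAt at hab
  simp only
  by_cases ha : a = i
  · subst ha
    rw [if_pos (Or.inl rfl)] at hab
    have h1 := (hQ.1 _ _ hab).2.2.2.2
    have h2 := hξ _ _ hab
    rw [if_pos rfl, if_neg (by unfold Adj at h1; omega)]
    omega
  · by_cases hb : b = i
    · subst hb
      rw [if_pos (Or.inr rfl)] at hab
      exact absurd hab (hi.2.2 a)
    · rw [if_neg (by tauto)] at hab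
      rw [if_neg ha, if_neg hb]
      exact hξ _ _ hab

lemma qreadable_of_isSink {m : ℕ} {Q : ℕ → ℕ → Prop} (hQ : IsDynkinQuiver m Q) {ξ : ℕ → ℤ}
    (hξ : IsHeight Q ξ) {g : ℕ → ℤ} {C : ℤ} (hg : ∀ r, 1 ≤ r → r ≤ m → g r = 2 * ξ r + C) {i : ℕ}
    (hi : IsSink m Q i) : QReadable m g i := by
  obtain ⟨h1, h2, h3⟩ := hi
  refine ⟨h1, h2, fun h4 => ?_, fun h4 => ?_⟩
  · rcases hQ.2 (i - 1) (by omega) (by omega) with ⟨h5, -⟩ | ⟨h5, -⟩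
    · rw [Nat.sub_add_cancel h1] at h5
      have := hξ _ _ h5
      rw [hg _ (by omega) (by omega), hg _ h1 h2]; omega
    · rw [Nat.sub_add_cancel h1] at h5
      exact absurd h5 (h3 _)
  · rcases hQ.2 i h1 h4 with ⟨h5, -⟩ | ⟨h5, -⟩
    · exact absurd h5 (h3 _)
    · have := hξ _ _ h5
      rw [hg _ (by omega) (by omega), hg _ h1 h2]; omega

/-- Sinks are local maxima of the height function, and reversing a sink lowers ξ by 2, hence the
doubled height by 4. -/
lemma qadm_of_adaptedTo {m : ℕ} {Q : ℕ → ℕ → Prop} (hQ : IsDynkinQuiver m Q) {ξ : ℕ → ℤ}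
    (hξ : IsHeight Q ξ) {g : ℕ → ℤ} {C : ℤ} (hg : ∀ r, 1 ≤ r → r ≤ m → g r = 2 * ξ r + C)
    {u : List ℕ} (hu : AdaptedTo m Q u) : QAdm m g u := by
  induction u generalizing Q ξ g with
  | nil => trivial
  | cons i u ih =>
    refine ⟨qreadable_of_isSink hQ hξ hg hu.1, ih (hQ.reverseAt i) (hξ.reverseAt hQ hu.1) ?_ hu.2⟩
    intro r h1 h2
    simp only [qlow]
    split_ifs with e
    · subst e; rw [hg r h1 h2]; ring
    · exact hg r h1 h2

lemma qvalid_of_height {m : ℕ} {Q : ℕ → ℕ → Prop} (hQ : IsDynkinQuiver m Q) {ξ : ℕ → ℤ}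
    (hξ : IsHeight Q ξ) : QValid m fun r => 2 * ξ r := by
  intro L h1 h2
  rcases hQ.2 L h1 h2 with ⟨h3, -⟩ | ⟨h3, -⟩
  · have := hξ _ _ h3; simp only; omega
  · have := hξ _ _ h3; simp only; omega

/-- Whichever of L and L+1 is read first must be the higher one, so the word itself determines the
sign of the difference. -/
lemma QAdm.diff_eq {m : ℕ} {f g : ℕ → ℤ} {u : List ℕ} (hf : QValid m f) (hg : QValid m g)
    (af : QAdm m f u) (ag : QAdm m g u) {L : ℕ} (h1 : 1 ≤ L) (h2 : L < m) (hL : L ∈ u) :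
    f L - f (L + 1) = g L - g (L + 1) := by
  induction u generalizing f g with
  | nil => simp at hL
  | cons c u ih =>
    have v1 := hf L h1 h2
    have v2 := hg L h1 h2
    by_cases e1 : c = L
    · subst e1
      have := af.1.2.2.2 h2
      have := ag.1.2.2.2 h2
      omega
    · by_cases e2 : c = L + 1
      · subst e2
        have := af.1.2.2.1 (by omega)
        have := ag.1.2.2.1 (by omega)
        simp only [Nat.add_one_sub_one] at *
        omega
      · have := ih (qvalid_low hf af.1) (qvalid_low hg ag.1) af.2 ag.2
          ((List.mem_cons.1 hL).resolve_left (Ne.symm e1))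
        simpa [qlow, Ne.symm e1, Ne.symm e2] using this

/-- The height that determines the image of `ε_a` in type `A_m`. -/
def qedge (m : ℕ) (g : ℕ → ℤ) (a : ℕ) : ℤ :=
  if a = 1 ∨ (a ≤ m ∧ g (a - 1) < g a) then g a + 2 * a else g (a - 1) - 2 * ((a : ℤ) - 1)

/-- `σ` is the Weyl group element of type `A_m` that belongs to the heights `g`. -/
def QLab (m : ℕ) (g : ℕ → ℤ) (σ : ℕ → ℕ) (U : ℤ → ℕ) : Prop :=
  ∀ a, 1 ≤ a → a ≤ m + 1 → σ a = U (qedge m g a)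

/-- `U` labels the diagonals of the grid of type `A_m` by `1, …, m+1`. -/
structure UGood (m : ℕ) (U : ℤ → ℕ) : Prop where
  eq_iff : ∀ x y, 4 ∣ x → 4 ∣ y → (U x = U y ↔ 4 * ((m : ℤ) + 1) ∣ x - y)
  range : ∀ x, 4 ∣ x → 1 ≤ U x ∧ U x ≤ m + 1

/-- The congruence between heights and letters. -/
def QCong (m : ℕ) (g : ℕ → ℤ) : Prop := ∀ L, 1 ≤ L → L ≤ m → 4 ∣ g L + 2 * L

lemma QCong.low {m : ℕ} {g : ℕ → ℤ} (hc : QCong m g) (L : ℕ) : QCong m (qlow g L) := by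
  intro M h1 h2
  have := hc M h1 h2
  simp only [qlow]
  split_ifs with e
  · subst e; omega
  · exact this

lemma qedge_up {m : ℕ} {g : ℕ → ℤ} {L : ℕ} (hr : QReadable m g L) :
    qedge m g L = g L + 2 * L := by
  obtain ⟨h1, h2, h3, h4⟩ := hr
  rw [qedge, if_pos]
  by_cases e : L = 1
  · exact Or.inl e
  · exact Or.inr ⟨h2, h3 (by omega)⟩

lemma qedge_down {m : ℕ} {g : ℕ → ℤ} {L : ℕ} (hr : QReadable m g L) :
    qedge m g (L + 1) = g L - 2 * L := by
  obtain ⟨h1, h2, h3, h4⟩ := hr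
  rw [qedge, if_neg]
  · simp
  · rintro (h5 | ⟨h5, h6⟩)
    · omega
    · have := h4 (by omega)
      simp at h6; omega

lemma qlab_low {m : ℕ} {g : ℕ → ℤ} {σ : ℕ → ℕ} {U : ℤ → ℕ} (hU : UGood m U) (hv : QValid m g)
    (hc : QCong m g) (hl : QLab m g σ U) {L : ℕ} (hr : QReadable m g L) :
    QLab m (qlow g L) (fun a => σ (Equiv.swap L (L + 1) a)) U := by
  intro a ha1 ha2
  obtain ⟨hL1, hL2, h3, h4⟩ := id hr
  by_cases e1 : a = L
  · subst e1
    simp only [Equiv.swap_apply_left]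
    rw [hl _ (by omega) (by omega), qedge_down hr]
    congr 1
    rw [qedge]
    simp only [qlow, if_true]
    by_cases e : a = 1
    · subst e; simp; ring
    · have h5 := h3 (by omega)
      have h6 := hv (a - 1) (by omega) (by omega)
      rw [Nat.sub_add_cancel hL1] at h6
      rw [if_neg (by omega : ¬ a - 1 = a), if_neg (by omega)]
      omega
  · by_cases e2 : a = L + 1
    · subst e2
      simp only [Equiv.swap_apply_right]
      rw [hl _ hL1 (by omega), qedge_up hr, qedge]
      simp only [qlow, if_true, Nat.add_one_sub_one, if_neg (show ¬ L + 1 = L by omega)]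
      by_cases e : L < m
      · have h5 := h4 e
        have h6 := hv L hL1 e
        rw [if_pos (by omega)]
        congr 1
        push_cast
        omega
      · have e : L = m := by omega
        subst e
        rw [if_neg (by omega)]
        have h7 := hc L hL1 le_rfl
        rw [hU.eq_iff _ _ h7 (by push_cast; omega)]
        exact ⟨1, by push_cast; ring⟩
    · simp only [Equiv.swap_apply_of_ne_of_ne e1 e2]
      rw [hl a ha1 ha2]
      congr 1
      have : a ≠ 1 → a - 1 ≠ L := by omega
      by_cases e3 : a = 1
      · simp [qedge, e3, qlow, show 1 ≠ L by omega]
      · simp [qedge, e3, qlow, e1, this e3]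

lemma qlab_st {m : ℕ} {g : ℕ → ℤ} {σ : Equiv.Perm ℕ} {U : ℤ → ℕ} (hU : UGood m U)
    (hv : QValid m g) (hc : QCong m g) (hl : QLab m g σ U) {u : List ℕ} (hu : QAdm m g u) :
    QLab m (qst g u) (σ * wordPerm u : Equiv.Perm ℕ) U := by
  induction u generalizing g σ with
  | nil =>
    have : qst g [] = g := by funext L; simp [qst]
    simpa [wordPerm, this] using hl
  | cons L u ih =>
    rw [qst_cons, wordPerm_cons, ← mul_assoc]
    exact ih (σ := σ * Equiv.swap L (L + 1)) (qvalid_low hv hu.1) (hc.low L)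
      (qlab_low hU hv hc hl hu.1) hu.2

/-! ### Auslander–Reiten coordinates in type A_m. -/

/-- The root at a point of the grid of type `A_m`. -/
def qroot (U : ℤ → ℕ) (i : ℕ) (x : ℤ) : Lat := rt (U (x + 2 * i)) (U (x - 2 * i))

lemma rootAt_eq_qroot {m : ℕ} {g : ℕ → ℤ} {U : ℤ → ℕ} (hU : UGood m U)
    (hv : QValid m g) (hc : QCong m g) (hl : QLab m g id U) {u v : List ℕ} {L : ℕ}
    (hu : QAdm m g (u ++ L :: v)) :
    rootAt (u ++ L :: v) u.length = qroot U L (qst g u L) ∧ 1 ≤ L ∧ L ≤ m := by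
  rw [qadm_append] at hu
  have hr := hu.2.1
  have hl := qlab_st (σ := 1) hU hv hc hl hu.1
  have h1 := hr.1
  have h2 := hr.2.1
  refine ⟨?_, h1, h2⟩
  have e : letter (u ++ L :: v) u.length = L := by simp [letter]
  rw [rootAt, e, List.take_left, act_simpleRoot, qroot]
  rw [one_mul] at hl
  rw [hl _ h1 (by omega), hl _ (by omega) (by omega), qedge_up hr, qedge_down hr]

/-- A Coxeter word reads every letter once, so all heights and all edges drop by 4. -/
lemma wordPerm_coxeter {m : ℕ} {g : ℕ → ℤ} {U : ℤ → ℕ} (hU : UGood m U) (hv : QValid m g)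
    (hc : QCong m g) (hl : QLab m g id U) {c : List ℕ} (hperm : c.Perm (List.range' 1 m))
    (ha : QAdm m g c) {x : ℤ} (hx : 4 ∣ x) (hm : 1 ≤ m) : wordPerm c (U x) = U (x - 4) := by
  have h1 := qlab_st (σ := 1) hU hv hc hl ha
  rw [one_mul] at h1
  have hr := hU.range x hx
  have h2 := hl _ hr.1 hr.2
  have hst : ∀ L, 1 ≤ L → L ≤ m → qst g c L = g L - 4 := by
    intro L h3 h4
    have : c.count L = 1 := by
      rw [hperm.count_eq]
      exact List.count_eq_one_of_mem List.nodup_range' (List.mem_range'_1.2 ⟨h3, by omega⟩)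
    simp [qst, this]
  have hedge : qedge m (qst g c) (U x) = qedge m g (U x) - 4 := by
    by_cases e : U x = 1
    · rw [qedge, qedge, if_pos (Or.inl e), if_pos (Or.inl e), hst _ (by omega) (by omega)]; ring
    · by_cases e2 : U x ≤ m
      · have a1 := hst (U x) (by omega) e2
        have a2 := hst (U x - 1) (by omega) (by omega)
        rw [qedge, qedge, a1, a2]
        split_ifs <;> omega
      · have a2 := hst (U x - 1) (by omega) (by omega)
        rw [qedge, qedge, a2, if_neg (by omega), if_neg (by omega)]
        ring
  have hdvd : 4 ∣ qedge m g (U x) := by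
    by_cases e : U x = 1
    · rw [qedge, if_pos (Or.inl e)]; exact hc _ hr.1 (by omega)
    · have a2 := hc (U x - 1) (by omega) (by omega)
      by_cases e2 : U x ≤ m
      · have a1 := hc (U x) (by omega) e2
        rw [qedge]; split_ifs <;> omega
      · rw [qedge, if_neg (by omega)]; omega
  rw [h1 _ hr.1 hr.2, hedge, hU.eq_iff _ _ (by omega) (by omega), sub_sub_sub_cancel_right]
  rw [← hU.eq_iff _ _ hdvd hx, ← h2, id]

lemma sum_range_shift {N : ℕ} {f : ℕ → ℤ} (hf : ∀ l, f (l + N) = f l) (i : ℕ) :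
    ∑ l ∈ Finset.range N, f (l + i) = ∑ l ∈ Finset.range N, f l := by
  induction i with
  | zero => simp
  | succ i ih =>
    rw [← ih]
    have h1 := Finset.sum_range_succ (fun l => f (l + i)) N
    have h2 := Finset.sum_range_succ' (fun l => f (l + i)) N
    rw [h1] at h2
    simp only [Nat.zero_add, add_comm N i] at h2
    rw [hf] at h2
    have h3 : ∀ l, f (l + 1 + i) = f (l + (i + 1)) := fun l => by congr 1; ring
    simp only [h3] at h2
    linarith

/-- A positive `φ_Q`-chain of roots is shorter than the period. -/
lemma chain_length_lt {m : ℕ} {U : ℤ → ℕ} (hU : UGood m U) {i k : ℕ} {x : ℤ}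
    (hx : 4 ∣ x + 2 * i)
    (hpos : ∀ l : ℕ, 1 ≤ l → l ≤ k → qroot U i (x - 4 * l) ∈ PosRoots m) : k ≤ m := by
  by_contra hk
  set f : ℕ → ℤ := fun l => (U (x + 2 * i - 4 * (l + 1)) : ℤ) with hf
  have hper : ∀ l, f (l + (m + 1)) = f l := by
    intro l
    simp only [hf]
    congr 1
    rw [hU.eq_iff _ _ (by push_cast; omega) (by omega)]
    exact ⟨-1, by push_cast; ring⟩
  -- `f l` and `f (l+i)` are the two indices of one root of the chain. Positivity makes f increase
  -- strictly under a shift by i, although its sum over a period is invariant under shifts.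
  have hlt : ∀ l ∈ Finset.range (m + 1), f l < f (l + i) := by
    intro l hl
    have hl := Finset.mem_range.1 hl
    obtain ⟨a, b, h1, h2, h3, h4⟩ := mem_posRoots.1 (hpos (l + 1) (by omega) (by omega))
    obtain ⟨e1, e2⟩ := rt_inj (show a ≠ b by omega) h4.symm
    have e3 : f l = a := by
      rw [e1]; simp only [hf]; congr 2; push_cast; ring
    have e4 : f (l + i) = b := by
      rw [e2]; simp only [hf]; congr 2; push_cast; ring
    rw [e3, e4]; exact_mod_cast h2
  have := Finset.sum_lt_sum_of_nonempty ⟨0, by simp⟩ hlt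
  rw [sum_range_shift hper i] at this
  exact lt_irrefl _ this

lemma ARCoord.eq_qroot {m : ℕ} (hm : 1 ≤ m) {Q : ℕ → ℕ → Prop} (hQ : IsDynkinQuiver m Q)
    {ξ : ℕ → ℤ} (hξ : IsHeight Q ξ) {g : ℕ → ℤ} {C : ℤ}
    (hg : ∀ r, 1 ≤ r → r ≤ m → g r = 2 * ξ r + C) {U : ℤ → ℕ} (hU : UGood m U)
    (hv : QValid m g) (hc : QCong m g) (hl : QLab m g id U) {β : Lat} {i : ℕ} {p : ℤ}
    (h : ARCoord m Q ξ β i p) :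
    1 ≤ i ∧ i ≤ m ∧ ∃ k : ℕ, k ≤ m ∧ p = ξ i - 2 * k ∧ β = qroot U i (g i - 4 * k) := by
  -- The induction carries the positivity of the whole chain, from which the bound on k follows at
  -- the end.
  suffices h' : 1 ≤ i ∧ i ≤ m ∧ ∃ k : ℕ, p = ξ i - 2 * k ∧ β = qroot U i (g i - 4 * k) ∧
      ∀ l : ℕ, 1 ≤ l → l ≤ k → qroot U i (g i - 4 * l) ∈ PosRoots m by
    obtain ⟨h1, h2, k, h3, h4, h5⟩ := h'
    exact ⟨h1, h2, k, chain_length_lt hU (hc i h1 h2) h5, h3, h4⟩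
  induction h with
  | @base c hcox t ht =>
    have ha := qadm_of_adaptedTo hQ hξ hg hcox.2
    have hsp := split_at ht
    rw [hsp] at ha
    have h1 := rootAt_eq_qroot hU hv hc hl ha
    rw [← hsp, List.length_take_of_le ht.le] at h1
    have hnd : c.Nodup := hcox.1.nodup_iff.2 List.nodup_range'
    have h0 : (c.take t).count (letter c t) = 0 := by
      rw [hsp] at hnd
      rw [List.count_eq_zero]
      intro hmem
      exact (List.nodup_append.1 hnd).2.2 _ hmem _ List.mem_cons_self rfl
    refine ⟨h1.2.1, h1.2.2, 0, by simp, ?_, by intro l _ _; omega⟩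
    rw [h1.1]
    simp [qst, h0]
  | @step c hcox β i p _ hpos ih =>
    obtain ⟨h1, h2, k, h3, h4, h5⟩ := ih
    have ha := qadm_of_adaptedTo hQ hξ hg hcox.2
    have hi := hc i h1 h2
    have key : act (wordPerm c) β = qroot U i (g i - 4 * (k + 1 : ℕ)) := by
      rw [h4, qroot, act_rt, wordPerm_coxeter hU hv hc hl hcox.1 ha (by omega) hm,
        wordPerm_coxeter hU hv hc hl hcox.1 ha (by omega) hm, qroot]
      congr 2 <;> push_cast <;> ring
    refine ⟨h1, h2, k + 1, by rw [h3]; push_cast; ring, key, ?_⟩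
    intro l h6 h7
    rcases Nat.lt_or_ge k l with h8 | h8
    · have : l = k + 1 := by omega
      subst this
      rw [← key]; exact hpos
    · exact h5 l h6 h8

/-- Subtracting the congruences of the two diagonals eliminates the heights and leaves 4(i-j), which
is smaller than the period. -/
lemma qroot_inj {m : ℕ} {g : ℕ → ℤ} {U : ℤ → ℕ} (hU : UGood m U) (hc : QCong m g) {i j k l : ℕ}
    (hi1 : 1 ≤ i) (hi2 : i ≤ m) (hj1 : 1 ≤ j) (hj2 : j ≤ m) (hk : k ≤ m) (hl : l ≤ m)
    (h : qroot U i (g i - 4 * k) = qroot U j (g j - 4 * l)) : i = j ∧ k = l := by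
  have ci := hc i hi1 hi2
  have cj := hc j hj1 hj2
  have hne : U (g i - 4 * k + 2 * i) ≠ U (g i - 4 * k - 2 * i) := by
    intro e
    rw [hU.eq_iff _ _ (by omega) (by omega)] at e
    have := eq_zero_of_dvd e (by omega) (by omega)
    omega
  obtain ⟨e1, e2⟩ := rt_inj hne h
  rw [hU.eq_iff _ _ (by omega) (by omega)] at e1 e2
  have e3 := eq_zero_of_dvd (dvd_sub e1 e2) (by omega) (by omega)
  have hij : i = j := by omega
  subst hij
  have e4 := eq_zero_of_dvd e1 (by omega) (by omega)
  omega

/-! ### Deleting the middle residue -/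

/-- The letter of type `A_{2n+1}` that belongs to a letter of type `A_{2n}`. -/
def plus (n r : ℕ) : ℕ := if r ≤ n then r else r + 1

/-- The heights without the middle residue. -/
def del (n : ℕ) (h : ℕ → ℤ) : ℕ → ℤ := fun r => h (plus n r)

/-- The letter of type `A_{2n}` that belongs to a letter of type `A_{2n+1}`. -/
def minus (n c : ℕ) : ℕ := if c ≤ n then c else c - 1

lemma deleteMiddle_cons_self (n : ℕ) (u : List ℕ) :
    deleteMiddle n ((n + 1) :: u) = deleteMiddle n u := by
  simp [deleteMiddle]

lemma deleteMiddle_cons_of_ne {n c : ℕ} (hc : c ≠ n + 1) (u : List ℕ) :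
    deleteMiddle n (c :: u) = minus n c :: deleteMiddle n u := by
  simp only [deleteMiddle, minus]
  by_cases h : c ≤ n
  · rw [List.filterMap_cons_some (by rw [if_pos h]), if_pos h]
  · rw [List.filterMap_cons_some (by rw [if_neg h, if_neg hc]), if_neg h]

lemma deleteMiddle_append (n : ℕ) (u v : List ℕ) :
    deleteMiddle n (u ++ v) = deleteMiddle n u ++ deleteMiddle n v := by
  simp [deleteMiddle]

lemma del_low_self (n : ℕ) (h : ℕ → ℤ) : del n (low n h (n + 1)) = del n h := by
  funext r
  simp only [del, low_apply, plus]
  split_ifs <;> omega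

lemma del_low_of_ne {n c : ℕ} (h : ℕ → ℤ) (h1 : 1 ≤ c) (hc : c ≠ n + 1) :
    del n (low n h c) = qlow (del n h) (minus n c) := by
  have hp : plus n (minus n c) = c := by
    simp only [plus, minus]; split_ifs <;> omega
  have hs : slack n c = 0 := by rw [slack, if_neg hc]
  funext r
  simp only [qlow, del, low_apply, hp, hs]
  have : plus n r = c ↔ r = minus n c := by
    simp only [plus, minus]; split_ifs <;> omega
  simp only [this]
  split_ifs <;> ring

/-- Only n and n+2 acquire a new neighbour. If n is above the middle, row n+2 is at most as high as
row n, and equality contradicts the congruences; the other side is symmetric. -/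
lemma qreadable_del {n c : ℕ} (hn : 1 ≤ n) {h : ℕ → ℤ} (hv : Valid n h) (hr : Readable n h c)
    (hc : c ≠ n + 1) : QReadable (2 * n) (del n h) (minus n c) := by
  obtain ⟨h1, h2, h3, h4⟩ := hr
  have d1 := hv.le n (n + 1) hn (by omega) (by omega)
  have d2 := hv.le (n + 1) (n + 2) (by omega) (by omega) (by omega)
  have g1 := hv.cong n hn (by omega) (by omega)
  have g2 := hv.cong (n + 2) (by omega) (by omega) (by omega)
  have s0 := rho_slack n n
  have s1 := rho_slack n (n + 1)
  have s2 := rho_slack n (n + 2)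
  by_cases e : c ≤ n
  · simp only [minus, if_pos e, QReadable, del]
    have p0 : plus n c = c := if_pos e
    refine ⟨h1, by omega, fun h5 => ?_, fun h5 => ?_⟩
    · rw [show plus n (c - 1) = c - 1 from if_pos (by omega), p0]
      exact h3 h5
    · have := h4 (by omega)
      by_cases e2 : c = n
      · subst e2
        rw [show plus c (c + 1) = c + 2 from if_neg (by omega), p0]
        omega
      · rw [show plus n (c + 1) = c + 1 from if_pos (by omega), p0]
        exact this
  · simp only [minus, if_neg e, QReadable, del]
    have p0 : plus n (c - 1) = c := by rw [plus, if_neg (by omega)]; omega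
    refine ⟨by omega, by omega, fun h5 => ?_, fun h5 => ?_⟩
    · have := h3 (by omega)
      by_cases e2 : c = n + 2
      · subst e2
        rw [show plus n (n + 2 - 1 - 1) = n by rw [plus, if_pos (by omega)]; omega, p0]
        rw [show n + 2 - 1 = n + 1 by omega] at this
        omega
      · rw [show plus n (c - 1 - 1) = c - 1 by rw [plus, if_neg (by omega)]; omega, p0]
        exact this
    · rw [show plus n (c - 1 + 1) = c + 1 by rw [plus, if_neg (by omega)]; omega, p0]
      exact h4 (by omega)

lemma qadm_del {n : ℕ} (hn : 1 ≤ n) {h : ℕ → ℤ} (hv : Valid n h) {w : List ℕ} (ha : Adm n h w) :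
    QAdm (2 * n) (del n h) (deleteMiddle n w) ∧
      qst (del n h) (deleteMiddle n w) = del n (st n h w) := by
  induction w generalizing h with
  | nil => exact ⟨trivial, by funext L; simp [qst, deleteMiddle]⟩
  | cons c u ih =>
    have := ih (valid_low hn hv ha.1) ha.2
    rw [st_cons]
    by_cases e : c = n + 1
    · subst e
      rw [deleteMiddle_cons_self]
      rwa [del_low_self] at this
    · rw [del_low_of_ne h ha.1.1 e] at this
      rw [deleteMiddle_cons_of_ne e, qst_cons]
      exact ⟨⟨qreadable_del hn hv ha.1 e, this.1⟩, this.2⟩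

lemma qvalid_del {n : ℕ} (hn : 1 ≤ n) {h : ℕ → ℤ} (hv : Valid n h) :
    QValid (2 * n) (del n h) ∧ QCong (2 * n) (del n h) := by
  have d1 := hv.le n (n + 1) hn (by omega) (by omega)
  have d2 := hv.le (n + 1) (n + 2) (by omega) (by omega) (by omega)
  have s0 := rho_slack n n
  have s1 := rho_slack n (n + 1)
  have s2 := rho_slack n (n + 2)
  have hp : ∀ r, (r ≤ n ∧ plus n r = r) ∨ (n < r ∧ plus n r = r + 1) := by
    intro r; simp only [plus]; split_ifs <;> omega
  have hcong : QCong (2 * n) (del n h) := by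
    intro L h1 h2
    simp only [del]
    have s3 := rho_slack n (plus n L)
    have := hp L
    have := hv.cong (plus n L) (by omega) (by omega) (by omega)
    omega
  refine ⟨fun L h1 h2 => ?_, hcong⟩
  have c1 := hcong L h1 (by omega)
  have c2 := hcong (L + 1) (by omega) (by omega)
  simp only [del] at *
  have p1 := hp L
  have p2 := hp (L + 1)
  have s3 := rho_slack n (plus n L)
  have s4 := rho_slack n (plus n (L + 1))
  by_cases e : L = n
  · subst e
    have q1 : plus L L = L := by omega
    have q2 : plus L (L + 1) = L + 2 := by omega
    have g1 := hv.cong L hn (by omega) (by omega)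
    have g2 := hv.cong (L + 2) (by omega) (by omega) (by omega)
    rw [q1, q2]
    omega
  · have := hv.le (plus n L) (plus n (L + 1)) (by omega) (by omega) (by omega)
    push_cast at *
    omega

/-- The labels of the diagonals after deletion of the fixed basis vector. -/
def delDiag (T : ℤ → ℕ) (x : ℤ) : ℕ := if T x < T 1 then T x else T x - 1

lemma delDiag_good {n : ℕ} {T : ℤ → ℕ} (hT : TGood n T) : UGood (2 * n) (delDiag T) := by
  have hne : ∀ x, 4 ∣ x → T x ≠ T 1 := by
    intro x hx e
    rw [hT.eq_iff] at e
    rcases e with ⟨-, e⟩ | ⟨e, -⟩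
    · have := (dvd_trans ⟨2 * n + 1, by ring⟩ e : (4 : ℤ) ∣ x - 1)
      omega
    · exact e hx
  have h1 := hT.range 1
  constructor
  · intro x y hx hy
    have h2 := hne x hx
    have h3 := hne y hy
    have h4 : T x = T y ↔ 4 * (((2 * n : ℕ) : ℤ) + 1) ∣ x - y := by
      rw [hT.eq_iff]
      push_cast
      rw [show 4 * (2 * (n : ℤ) + 1) = 8 * n + 4 by ring]
      tauto
    rw [← h4]
    simp only [delDiag]
    split_ifs <;> omega
  · intro x hx
    have h2 := hne x hx
    have h3 := hT.range x
    simp only [delDiag]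
    split_ifs <;> omega

/-- The common label `T 1` of the diagonals not divisible by 4 sits at index n+1 or n+2. Removing it
leaves the edges of type A_{2n}, with the later indices shifted by one. -/
lemma qlab_del {n : ℕ} (hn : 1 ≤ n) {h : ℕ → ℤ} {T : ℤ → ℕ} (hv : Valid n h) (hT : TGood n T)
    (hl : Lab n h id T) : QLab (2 * n) (del n h) id (delDiag T) := by
  have d1 := hv.le n (n + 1) hn (by omega) (by omega)
  have d2 := hv.le (n + 1) (n + 2) (by omega) (by omega) (by omega)
  have g1 := hv.cong n hn (by omega) (by omega)
  have g2 := hv.cong (n + 2) (by omega) (by omega) (by omega)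
  have g3 := hv.mid
  have s0 := rho_slack n n
  have s1 := rho_slack n (n + 1)
  have s2 := rho_slack n (n + 2)
  have l1 : n + 1 = T (edge n h (n + 1)) := hl (n + 1) (by omega) (by omega)
  have l2 : n + 2 = T (edge n h (n + 2)) := hl (n + 2) (by omega) (by omega)
  have m1 : ∀ x, ¬ 4 ∣ x → T x = T 1 := fun x hx => (hT.eq_iff x 1).2 (Or.inr ⟨hx, by omega⟩)
  have m2 : ∀ x, 4 ∣ x → T x ≠ T 1 := by
    intro x hx e
    rw [hT.eq_iff] at e
    rcases e with ⟨-, e⟩ | ⟨e, -⟩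
    · have := (dvd_trans ⟨2 * n + 1, by ring⟩ e : (4 : ℤ) ∣ x - 1)
      omega
    · exact e hx
  have E1 : edge n h (n + 1) = if h n < h (n + 1) then h (n + 1) + rho n (n + 1)
      else h n - rho n n := by
    rw [edge, Nat.add_one_sub_one]
    split_ifs <;> omega
  have E2 : edge n h (n + 2) = if h (n + 1) < h (n + 2) then h (n + 2) + rho n (n + 2)
      else h (n + 1) - rho n (n + 1) := by
    rw [edge, show n + 2 - 1 = n + 1 by omega]
    split_ifs <;> omega
  have F : qedge (2 * n) (del n h) (n + 1) = if h n < h (n + 2) then h (n + 2) + rho n (n + 2)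
      else h n - rho n n := by
    rw [qedge, Nat.add_one_sub_one]
    simp only [del, show plus n n = n from if_pos le_rfl,
      show plus n (n + 1) = n + 2 from if_neg (by omega)]
    push_cast
    split_ifs <;> omega
  intro a h1 h2
  rw [id]
  rcases Nat.lt_trichotomy a (n + 1) with e | e | e
  -- If the edge at n+1 is divisible by 4, the edge at n+2 is not; its index is then the common
  -- label.
  · have hE : T 1 = n + 1 ∨ T 1 = n + 2 := by
      by_cases h4 : 4 ∣ edge n h (n + 1)
      · right
        rw [l2]
        refine (m1 _ ?_).symm
        omega
      · left; rw [l1]; exact (m1 _ h4).symm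
    have l0 := hl a h1 (by omega)
    rw [id] at l0
    have : qedge (2 * n) (del n h) a = edge n h a := by
      have s3 := rho_slack n a
      have s4 := rho_slack n (a - 1)
      simp only [qedge, edge, del, show plus n a = a from if_pos (by omega),
        show plus n (a - 1) = a - 1 from if_pos (by omega)]
      split_ifs <;> omega
    rw [this, delDiag, ← l0, if_pos (by omega)]
  · subst e
    by_cases h4 : 4 ∣ edge n h (n + 1)
    · have hE : T 1 = n + 2 := by
        rw [l2]
        refine (m1 _ ?_).symm
        omega
      have : qedge (2 * n) (del n h) (n + 1) = edge n h (n + 1) := by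
        omega
      rw [this, delDiag, ← l1, if_pos (by omega)]
    · have hE : T 1 = n + 1 := by rw [l1]; exact (m1 _ h4).symm
      have : qedge (2 * n) (del n h) (n + 1) = edge n h (n + 2) := by
        omega
      rw [this, delDiag, ← l2, if_neg (by omega)]
      rfl
  · have hE : T 1 ≤ n + 2 := by
      by_cases h4 : 4 ∣ edge n h (n + 1)
      · refine le_of_eq ?_
        rw [l2]
        refine (m1 _ ?_).symm
        omega
      · rw [← m1 _ h4, ← l1]; omega
    have l0 := hl (a + 1) (by omega) (by omega)
    rw [id] at l0
    have : qedge (2 * n) (del n h) a = edge n h (a + 1) := by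
      have s3 := rho_slack n a
      have s4 := rho_slack n (a + 1)
      simp only [qedge, edge, del, show plus n a = a + 1 from if_neg (by omega),
        show plus n (a - 1) = a by rw [plus, if_neg (by omega)]; omega, Nat.add_one_sub_one]
      split_ifs <;> omega
    rw [this, delDiag, ← l0, if_neg (by omega)]
    rfl

/-! ### Coordinates -/

lemma count_take_eq {w : List ℕ} {L s t : ℕ} (hst : s ≤ t) (ht : t ≤ w.length)
    (h : ∀ r, s ≤ r → r < t → letter w r ≠ L) : (w.take t).count L = (w.take s).count L := by
  induction t with
  | zero =>
    have : s = 0 := by omega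
    rw [this]
  | succ t ih =>
    rcases Nat.lt_or_ge t s with h1 | h1
    · have : s = t + 1 := by omega
      rw [this]
    · rw [take_succ_letter (by omega), List.count_append, ih h1 (by omega) fun r h2 h3 =>
        h r h2 (by omega)]
      simp [h t h1 (by omega)]

/-- The same word is admissible for `del n h` and for 2ξ; as every letter occurs, `QAdm.diff_eq`
fixes all consecutive differences. -/
lemma Sys.del_eq {n : ℕ} (hn : 1 ≤ n) {w : List ℕ} {h : ℕ → ℤ} {T : ℤ → ℕ} (hs : Sys n w h T)
    {Q : ℕ → ℕ → Prop} (hQ : IsDynkinQuiver (2 * n) Q)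
    (hPQ : AdaptedTo (2 * n) Q (deleteMiddle n w)) {ξ : ℕ → ℤ} (hξ : IsHeight Q ξ) :
    ∃ C, ∀ r, 1 ≤ r → r ≤ 2 * n → del n h r = 2 * ξ r + C := by
  have hv := qvalid_of_height hQ hξ
  have ha := qadm_of_adaptedTo (g := fun r => 2 * ξ r) (C := 0) hQ hξ (by intros; simp) hPQ
  have hv' := (qvalid_del hn hs.valid).1
  have ha' := (qadm_del hn hs.valid hs.adm).1
  have hmem : ∀ r, 1 ≤ r → r ≤ 2 * n → r ∈ deleteMiddle n w := by
    intro r h1 h2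
    have hp : (r ≤ n ∧ plus n r = r) ∨ (n < r ∧ plus n r = r + 1) := by
      simp only [plus]; split_ifs <;> omega
    have hw : plus n r ∈ w := by
      rw [← List.count_pos_iff]
      -- An unread letter would keep its height, but `fin` requires a drop of 4n+2 up to duality,
      -- more than `Valid.le` allows between dual rows.
      by_contra hc
      have hf := hs.fin (plus n r) (by omega) (by omega)
      simp only [st, flip, show w.count (plus n r) = 0 by omega] at hf
      have s1 := rho_slack n (plus n r)
      have s2 := rho_slack n (2 * n + 2 - plus n r)
      rcases Nat.le_total (plus n r) (2 * n + 2 - plus n r) with h3 | h3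
      · have := hs.valid.le _ _ (by omega) h3 (by omega)
        omega
      · have := hs.valid.le _ _ (by omega) h3 (by omega)
        omega
    rw [deleteMiddle, List.mem_filterMap]
    refine ⟨_, hw, ?_⟩
    rcases hp with ⟨h3, h4⟩ | ⟨h3, h4⟩
    · rw [h4, if_pos h3]
    · rw [h4, if_neg (by omega), if_neg (by omega)]; simp
  refine ⟨del n h 1 - 2 * ξ 1, fun r h1 h2 => ?_⟩
  induction r, h1 using Nat.le_induction with
  | base => ring
  | succ r h3 ih =>
    have h4 := ih (by omega)
    have h5 := QAdm.diff_eq hv hv' ha ha' h3 (by omega) (hmem r h3 (by omega))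
    linarith

/-- One root of type A_{2n} is located both by its AR coordinate and by its position in the word;
`qroot_inj` identifies the two points. Heights are doubled coordinates, whence the factor 2. -/
lemma InducedCoord.eq_pt {n : ℕ} (hn : 1 ≤ n) {w : List ℕ} {h : ℕ → ℤ} {T : ℤ → ℕ}
    (hs : Sys n w h T) {Q : ℕ → ℕ → Prop} (hQ : IsDynkinQuiver (2 * n) Q) {ξ : ℕ → ℤ}
    (hξ : IsHeight Q ξ) {C : ℤ} (hC : ∀ r, 1 ≤ r → r ≤ 2 * n → del n h r = 2 * ξ r + C)
    {t i : ℕ} {x : ℚ} (hx : InducedCoord n Q ξ w t i x) :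
    i = (pt n h w t).1 ∧ 2 * x = (((pt n h w t).2 - C : ℤ) : ℚ) := by
  obtain ⟨ht, hne, i', p, hco, hi, rfl⟩ := hx
  obtain ⟨hv, hc⟩ := qvalid_del hn hs.valid
  have hl := qlab_del hn hs.valid hs.good hs.lab
  have hU := delDiag_good hs.good
  obtain ⟨h1, h2, k, hk, hp, hβ⟩ := hco.eq_qroot (by omega) hQ hξ hC hU hv hc hl
  have hsp : deleteMiddle n w = deleteMiddle n (w.take t) ++
      minus n (letter w t) :: deleteMiddle n (w.drop (t + 1)) := by
    conv_lhs => rw [split_at ht]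
    rw [deleteMiddle_append, deleteMiddle_cons_of_ne hne]
  have ha := (qadm_del hn hs.valid hs.adm).1
  rw [hsp] at ha
  have hr := rootAt_eq_qroot hU hv hc hl ha
  rw [← hsp, (qadm_del hn hs.valid (hs.adm.take t)).2, hβ] at hr
  obtain ⟨hr, h3, h4⟩ := hr
  have hL := hs.adm.range _ (letter_mem ht)
  have hplus : plus n (minus n (letter w t)) = letter w t := by
    simp only [plus, minus]; split_ifs <;> omega
  have hst : del n (st n h (w.take t)) (minus n (letter w t)) =
      del n h (minus n (letter w t)) - 4 * ((w.take t).count (letter w t) : ℕ) := by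
    simp only [del, hplus, st, slack, if_neg hne]
    ring
  -- Together with `hk` this keeps both points within one period, as `qroot_inj` needs.
  have hk' : (w.take t).count (letter w t) ≤ 2 * n := by
    have hb := (inS_pt (n := n) (h := h) ht).bounds hs
    simp only [pt, st] at hb
    have s1 := rho_slack n (letter w t)
    have s2 := rho_slack n (2 * n + 2 - letter w t)
    have s3 : slack n (letter w t) = 0 := by rw [slack, if_neg hne]
    rw [s3] at hb
    rcases Nat.le_total (letter w t) (2 * n + 2 - letter w t) with h3 | h3
    · have := hs.valid.le _ _ (by omega) h3 (by omega)
      omega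
    · have := hs.valid.le _ _ (by omega) h3 (by omega)
      omega
  rw [hst] at hr
  obtain ⟨e1, e2⟩ := qroot_inj hU hc h1 h2 h3 h4 hk hk' hr
  constructor
  · simp only [pt]
    rw [hi, e1]
    simp only [minus]
    split_ifs <;> omega
  · have h5 := hC i' h1 h2
    have h6 : (pt n h w t).2 = del n (st n h (w.take t)) (minus n (letter w t)) := by
      simp only [pt, del, hplus]
    rw [h6, hst, ← e1, ← e2, h5, hp]
    push_cast
    ring

/-- A neighbour of the middle residue that is read while the middle residue has height `q` has
height `q + 1`. -/
lemma height_of_adj_mid {n : ℕ} (hn : 1 ≤ n) {h : ℕ → ℤ} (hv : Valid n h) {L : ℕ}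
    (hr : Readable n h L) (hadj : Adj L (n + 1)) : h L = h (n + 1) + 1 := by
  have d1 := hv.le n (n + 1) hn (by omega) (by omega)
  have d2 := hv.le (n + 1) (n + 2) (by omega) (by omega) (by omega)
  have s0 := rho_slack n n
  have s1 := rho_slack n (n + 1)
  have s2 := rho_slack n (n + 2)
  obtain ⟨h1, h2, h3, h4⟩ := hr
  rcases hadj with e | e
  · have e : L = n := by omega
    subst e
    have := h4 (by omega)
    omega
  · have e : L = n + 2 := by omega
    subst e
    have := h3 (by omega)
    rw [show n + 2 - 1 = n + 1 by omega] at this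
    omega

/-- Between the two positions the middle height drops once, by 2, and the neighbour is read 1 above
it. -/
lemma Arrow.height_into {n : ℕ} (hn : 1 ≤ n) {w : List ℕ} {h : ℕ → ℤ} {T : ℤ → ℕ}
    (hs : Sys n w h T) {k t : ℕ} (ht : letter w t = n + 1) (hk : Arrow w k t) :
    (pt n h w t).2 = (pt n h w k).2 + 1 := by
  obtain ⟨h1, h2, h3, h4, -⟩ := hk
  rw [ht] at h3 h4
  have hh := height_of_adj_mid hn (valid_st hn hs.valid (hs.adm.take k)) (hs.adm.readable h2) h3
  have hc := count_take_eq (w := w) (L := n + 1) (show t + 1 ≤ k from h1) h2.le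
    fun r h5 h6 h7 => by have := h4 r h6 h7; omega
  have hc2 : (w.take (t + 1)).count (n + 1) = (w.take t).count (n + 1) + 1 := by
    rw [take_succ_letter (by omega), ht]; simp
  simp only [pt, ht]
  rw [hh]
  simp only [st, hc, hc2, slack, if_true]
  push_cast; ring

lemma Arrow.height_from {n : ℕ} (hn : 1 ≤ n) {w : List ℕ} {h : ℕ → ℤ} {T : ℤ → ℕ}
    (hs : Sys n w h T) {t l : ℕ} (ht : letter w t = n + 1) (hl : Arrow w t l) :
    (pt n h w t).2 = (pt n h w l).2 - 1 := by
  obtain ⟨h1, h2, h3, -, h4⟩ := hl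
  rw [ht] at h3 h4
  have hh := height_of_adj_mid hn (valid_st hn hs.valid (hs.adm.take l))
    (hs.adm.readable (h1.trans h2)) h3.symm
  have hc := count_take_eq (w := w) (L := n + 1) h1.le h2.le fun r h5 h6 h7 => by
    rcases h5.eq_or_lt with rfl | h8
    · rw [h7] at h3; unfold Adj at h3; omega
    · have := h4 r h8 (by omega) h7; omega
  simp only [pt, ht]
  rw [hh]
  simp only [st, hc]
  ring

lemma VertexCoord.eq_pt {n : ℕ} (hn : 1 ≤ n) {w : List ℕ} {h : ℕ → ℤ} {T : ℤ → ℕ}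
    (hs : Sys n w h T) {Q : ℕ → ℕ → Prop} (hQ : IsDynkinQuiver (2 * n) Q) {ξ : ℕ → ℤ}
    (hξ : IsHeight Q ξ) {C : ℤ} (hC : ∀ r, 1 ≤ r → r ≤ 2 * n → del n h r = 2 * ξ r + C)
    {t i : ℕ} {x : ℚ} (hx : VertexCoord n Q ξ w t i x) :
    i = (pt n h w t).1 ∧ 2 * x = (((pt n h w t).2 - C : ℤ) : ℚ) := by
  cases hx with
  | induced hx => exact hx.eq_pt hn hs hQ hξ hC
  | sink ht _ hk hx =>
    refine ⟨ht.symm, ?_⟩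
    rw [hk.height_into hn hs ht, mul_add, (hx.eq_pt hn hs hQ hξ hC).2]
    push_cast; ring
  | source ht _ hl hx =>
    refine ⟨ht.symm, ?_⟩
    rw [hl.height_from hn hs ht, mul_sub, (hx.eq_pt hn hs hQ hξ hC).2]
    push_cast; ring
  | middle ht hk _ hx _ _ =>
    refine ⟨ht.symm, ?_⟩
    rw [hk.height_into hn hs ht, mul_add, (hx.eq_pt hn hs hQ hξ hC).2]
    push_cast; ring

lemma FoldedCoord.exists_point {n : ℕ} (hn : 1 ≤ n) {w : List ℕ} {h : ℕ → ℤ} {T : ℤ → ℕ}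
    (hs : Sys n w h T) {Q : ℕ → ℕ → Prop} (hQ : IsDynkinQuiver (2 * n) Q) {ξ : ℕ → ℤ}
    (hξ : IsHeight Q ξ) {C : ℤ} (hC : ∀ r, 1 ≤ r → r ≤ 2 * n → del n h r = 2 * ξ r + C)
    {β : Lat} {i : ℕ} {p : ℤ} (hx : FoldedCoord n Q ξ w β i p) :
    ∃ P, InS n h w P ∧ β = root n T P ∧ i = min P.1 (2 * n + 2 - P.1) ∧ p = P.2 - C := by
  obtain ⟨i', x, ⟨t, ht, rfl, hv⟩, rfl, rfl⟩ := hx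
  obtain ⟨e1, e2⟩ := hv.eq_pt hn hs hQ hξ hC
  refine ⟨pt n h w t, inS_pt ht, hs.rootAt_eq hn ht, by rw [e1], ?_⟩
  rw [mul_div_cancel₀ _ (by norm_num)] at e2
  exact_mod_cast e2

/-! ### The roots of the slice -/

/-- If the order of a and b is reversed by the word, some letter interchanges them, and the root at
that letter is ε_a - ε_b up to σ. -/
lemma exists_crossing {w : List ℕ} {σ : Equiv.Perm ℕ} {a b : ℕ} (h1 : σ⁻¹ a < σ⁻¹ b)
    (h2 : (σ * wordPerm w)⁻¹ b < (σ * wordPerm w)⁻¹ a) :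
    ∃ t, t < w.length ∧ act σ (rootAt w t) = rt a b := by
  induction w generalizing σ with
  | nil => simp only [wordPerm, List.map_nil, List.prod_nil, mul_one] at h2; omega
  | cons i u ih =>
    by_cases h3 : (σ * Equiv.swap i (i + 1))⁻¹ a < (σ * Equiv.swap i (i + 1))⁻¹ b
    · rw [wordPerm_cons, ← mul_assoc] at h2
      obtain ⟨t, h4, h5⟩ := ih h3 h2
      refine ⟨t + 1, by simpa using h4, ?_⟩
      rw [← h5, rootAt, rootAt, act_simpleRoot, act_simpleRoot, act_rt, act_rt,
        List.take_succ_cons, wordPerm_cons]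
      simp [letter]
    · refine ⟨0, by simp, ?_⟩
      rw [mul_inv_rev, Equiv.Perm.mul_apply, Equiv.Perm.mul_apply, Equiv.swap_inv,
        Equiv.swap_apply_def, Equiv.swap_apply_def] at h3
      have h4 : σ⁻¹ a = i ∧ σ⁻¹ b = i + 1 := by
        split_ifs at h3 <;> omega
      rw [Equiv.Perm.inv_eq_iff_eq, Equiv.Perm.inv_eq_iff_eq] at h4
      rw [rootAt, act_simpleRoot, act_rt, h4.1, h4.2]
      simp [letter, wordPerm]

lemma Sys.wordPerm_eq {n : ℕ} (hn : 1 ≤ n) {w : List ℕ} {h : ℕ → ℤ} {T : ℤ → ℕ}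
    (hs : Sys n w h T) {a : ℕ} (h1 : 1 ≤ a) (h2 : a ≤ 2 * n + 2) :
    wordPerm w (2 * n + 3 - a) = a := by
  have l1 := lab_st (σ := 1) hn hs.good hs.valid hs.lab hs.adm
  have l2 := lab_flip (c := 4 * n + 2) (Or.inl rfl) (valid_st hn hs.valid hs.adm) hs.good l1
  have e : HEq' n (flip n (4 * n + 2) (st n h w)) h := by
    intro L h3 h4
    rw [hs.fin.flip _ L h3 h4, flip_flip n _ _ h L h3 h4]; ring
  have l3 := e.lab l2 a h1 h2
  have l4 := hs.lab a h1 h2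
  rw [← l4] at l3
  simpa using l3

/-- Every positive root is the root of a position. -/
lemma Sys.exists_of_posRoot {n : ℕ} (hn : 1 ≤ n) {w : List ℕ} {h : ℕ → ℤ} {T : ℤ → ℕ}
    (hs : Sys n w h T) {v : Lat} (hv : v ∈ PosRoots (2 * n + 1)) :
    ∃ P, InS n h w P ∧ v = root n T P := by
  obtain ⟨a, b, h1, h2, h3, rfl⟩ := mem_posRoots.1 hv
  have e : ∀ a, 1 ≤ a → a ≤ 2 * n + 2 → (wordPerm w)⁻¹ a = 2 * n + 3 - a := by
    intro a h1 h2
    rw [Equiv.Perm.inv_eq_iff_eq, hs.wordPerm_eq hn h1 h2]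
  obtain ⟨t, ht, h4⟩ := exists_crossing (w := w) (σ := 1) (a := a) (b := b) (by simpa using h2) (by
    rw [one_mul, e a h1 (by omega), e b (by omega) (by omega)]; omega)
  refine ⟨pt n h w t, inS_pt ht, ?_⟩
  rw [← hs.rootAt_eq hn ht, ← h4, rootAt, act_simpleRoot, act_rt]
  simp

/-- Otherwise the negative root occurs at another point of the slice. The lower diagonal of each
point would then match the upper diagonal of the other, which the bounds on the slice forbid. -/
lemma Sys.root_mem {n : ℕ} (hn : 1 ≤ n) {w : List ℕ} {h : ℕ → ℤ} {T : ℤ → ℕ}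
    (hs : Sys n w h T) {P : ℕ × ℤ} (hP : InS n h w P) : root n T P ∈ PosRoots (2 * n + 1) := by
  have r1 := hs.good.range (P.2 + rho n P.1)
  have r2 := hs.good.range (P.2 - rho n P.1)
  have hne := root_ne hs hP
  rw [mem_posRoots]
  by_contra hc
  have hlt : T (P.2 - rho n P.1) < T (P.2 + rho n P.1) := by
    by_contra h'
    exact hc ⟨_, _, r1.1, by omega, by omega, rfl⟩
  obtain ⟨R, hR, e⟩ := hs.exists_of_posRoot hn
    (mem_posRoots.2 ⟨T (P.2 - rho n P.1), T (P.2 + rho n P.1), r2.1, hlt, by omega, rfl⟩)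
  obtain ⟨e1, e2⟩ := rt_inj hlt.ne e
  have a1 := hP.arith hs
  have a2 := hR.arith hs
  have n1 := hP.near hs hR
  have n2 := hR.near hs hP
  have e3 := T_sub_eq_add hs hP hR e1
  have e4 := T_sub_eq_add hs hR hP e2.symm
  omega

/-! ### Sums of two roots of the slice -/

/-- The arithmetic form of `root P + root Q = root S` where `root P` and `root S` start at the
same basis vector. -/
def Dec (n : ℕ) (P Q S : ℕ × ℤ) : Prop :=
  ((P.2 + rho n P.1 = S.2 + rho n S.1 ∧ 4 ∣ P.2 + rho n P.1) ∨
    (¬ 4 ∣ P.2 + rho n P.1 ∧ ¬ 4 ∣ S.2 + rho n S.1)) ∧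
  ((Q.2 - rho n Q.1 = S.2 - rho n S.1 ∧ 4 ∣ Q.2 - rho n Q.1) ∨
    (¬ 4 ∣ Q.2 - rho n Q.1 ∧ ¬ 4 ∣ S.2 - rho n S.1)) ∧
  (((Q.2 + rho n Q.1 = P.2 - rho n P.1 ∨ Q.2 + rho n Q.1 = P.2 - rho n P.1 + (8 * n + 4)) ∧
      4 ∣ P.2 - rho n P.1) ∨
    (¬ 4 ∣ P.2 - rho n P.1 ∧ ¬ 4 ∣ Q.2 + rho n Q.1))

lemma dec_of_root_add {n : ℕ} {w : List ℕ} {h : ℕ → ℤ} {T : ℤ → ℕ} (hs : Sys n w h T)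
    {P Q S : ℕ × ℤ} (hP : InS n h w P) (hQ : InS n h w Q) (hS : InS n h w S)
    (e : root n T P + root n T Q = root n T S) : Dec n P Q S ∨ Dec n Q P S := by
  rcases rt_add_eq (root_ne hs hP) (root_ne hs hQ) (root_ne hs hS) e with
    ⟨e1, e2, e3⟩ | ⟨e1, e2, e3⟩
  · exact Or.inl ⟨T_add_eq hs hP hS e1, T_sub_eq hs hQ hS e3, T_sub_eq_add hs hP hQ e2⟩
  · exact Or.inr ⟨T_add_eq hs hQ hS e1, T_sub_eq hs hP hS e3, T_sub_eq_add hs hQ hP e2⟩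

/-- The three points lie off the middle row, and their folded residues sum up to `2n+1`. -/
def OffMid (n : ℕ) (P Q S : ℕ × ℤ) : Prop :=
  P.1 ≠ n + 1 ∧ Q.1 ≠ n + 1 ∧ S.1 ≠ n + 1 ∧
    min P.1 (2 * n + 2 - P.1) + min Q.1 (2 * n + 2 - Q.1) + min S.1 (2 * n + 2 - S.1) = 2 * n + 1

/-- The possible rows `a`, `b`, `s` and heights `p`, `q`, `r` of two roots, the first one before the
second one, and of their sum; the middle row is `N`. -/
def Pat (N a b s p q r : ℤ) : Prop :=
  (a ≠ N ∧ b ≠ N ∧ s ≠ N ∧ a + b = s ∧ p = r + b ∧ q = r - a) ∨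
  (a ≠ N ∧ b ≠ N ∧ s ≠ N ∧ a + b = s + 2 * N ∧ p = r - s + a ∧ q = r + s - b) ∨
  (a = N ∧ b = N ∧ s < N ∧ p = r + N - s ∧ q = r - N + s) ∨
  (a = N ∧ b = N ∧ N < s ∧ p = r + s - N ∧ q = r - s + N) ∨
  (a < N ∧ b = N ∧ s = N ∧ p = r + N - a ∧ q = r - 2 * a) ∨
  (N < a ∧ b = N ∧ s = N ∧ p = r + a - N ∧ q = r - 2 * (2 * N - a)) ∨
  (a = N ∧ b < N ∧ s = N ∧ q = r - N + b ∧ p = r + 2 * b) ∨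
  (a = N ∧ N < b ∧ s = N ∧ q = r - b + N ∧ p = r + 2 * (2 * N - b))

/-- The pattern of three grid points. -/
abbrev PatP (n : ℕ) (P Q S : ℕ × ℤ) : Prop :=
  Pat (2 * n + 1) (rho n P.1) (rho n Q.1) (rho n S.1) P.2 Q.2 S.2

/-- The two diagonals of a point differ by twice its row. This is 0 modulo 4 off the middle and 2
modulo 4 on it, where exactly one diagonal is a multiple of 4. -/
lemma InS.dvd {n : ℕ} {w : List ℕ} {h : ℕ → ℤ} {T : ℤ → ℕ} (hs : Sys n w h T) {P : ℕ × ℤ}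
    (hP : InS n h w P) :
    (rho n P.1 ≠ 2 * n + 1 ∧ 4 ∣ P.2 + rho n P.1 ∧ 4 ∣ P.2 - rho n P.1) ∨
    (rho n P.1 = 2 * n + 1 ∧ 4 ∣ P.2 + rho n P.1 ∧ ¬ 4 ∣ P.2 - rho n P.1) ∨
    (rho n P.1 = 2 * n + 1 ∧ ¬ 4 ∣ P.2 + rho n P.1 ∧ 4 ∣ P.2 - rho n P.1) := by
  rcases hP.arith hs with a1 | ⟨a1, a2, a3⟩ | a1
  · left; omega
  · right
    have h1 : (P.2 + rho n P.1) % 4 = 0 ∨ (P.2 + rho n P.1) % 4 = 2 := by omega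
    rcases h1 with h1 | h1
    · left; omega
    · right; omega
  · left; omega

lemma InS.rho_range {n : ℕ} (hn : 1 ≤ n) {w : List ℕ} {h : ℕ → ℤ} {T : ℤ → ℕ} (hs : Sys n w h T) {P : ℕ × ℤ}
    (hP : InS n h w P) : 2 ≤ rho n P.1 ∧ rho n P.1 ≤ 2 * (2 * n + 1) - 2 := by
  have := hP.arith hs
  omega

/-- Divisibility of the six diagonals by 4 leaves either no point or exactly two points on the
middle row. A wrap-around by a period exchanges the roles of P and Q. Consecutive patterns of `Pat`
are mirror images under row ↦ 2N - row. -/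
lemma Dec.pat {n : ℕ} (hn : 1 ≤ n) {w : List ℕ} {h : ℕ → ℤ} {T : ℤ → ℕ} (hs : Sys n w h T)
    {P Q S : ℕ × ℤ} (hP : InS n h w P) (hQ : InS n h w Q) (hS : InS n h w S)
    (hd : Dec n P Q S) : PatP n P Q S ∨ PatP n Q P S := by
  obtain ⟨d1, d2, d3⟩ := hd
  obtain ⟨p1, p2⟩ := hP.rho_range hn hs
  obtain ⟨q1, q2⟩ := hQ.rho_range hn hs
  obtain ⟨s1, s2⟩ := hS.rho_range hn hs
  have n1 := hP.near hs hS
  have n2 := hS.near hs hP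
  have n3 := hQ.near hs hS
  have n4 := hS.near hs hQ
  have e1 := hP.dvd hs
  have e2 := hQ.dvd hs
  have e3 := hS.dvd hs
  rw [show 8 * (n : ℤ) + 2 = 4 * (2 * n + 1) - 2 by ring] at n1 n2 n3 n4
  rw [show 8 * (n : ℤ) + 4 = 4 * (2 * n + 1) by ring] at d3
  unfold PatP Pat
  generalize (2 * (n : ℤ) + 1) = N at *
  generalize rho n P.1 = a, rho n Q.1 = b, rho n S.1 = s, P.2 = p, Q.2 = q, S.2 = r at *
  rcases e1 with ⟨m1, a1, b1⟩ | ⟨m1, a1, b1⟩ | ⟨m1, a1, b1⟩ <;>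
  rcases e2 with ⟨m2, a2, b2⟩ | ⟨m2, a2, b2⟩ | ⟨m2, a2, b2⟩ <;>
  rcases e3 with ⟨m3, a3, b3⟩ | ⟨m3, a3, b3⟩ | ⟨m3, a3, b3⟩ <;>
  simp only [a1, a2, a3, b1, b2, b3, not_true, not_false_iff, and_true, and_false,
    or_false, or_self, or_true] at d1 d2 d3
  · rcases d3 with d3 | d3
    · exact Or.inl (Or.inl (by omega))
    · exact Or.inr (Or.inr (Or.inl (by omega)))
  all_goals first
    | (exfalso; omega)
    | (rcases lt_or_gt_of_ne m3 with m | m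
       · exact Or.inr (Or.inr (Or.inr (Or.inl (by omega))))
       · exact Or.inl (Or.inr (Or.inr (Or.inr (Or.inl (by omega))))))
    | (rcases lt_or_gt_of_ne m1 with m | m
       · exact Or.inl (Or.inr (Or.inr (Or.inr (Or.inr (Or.inl (by omega))))))
       · exact Or.inr (Or.inr (Or.inr (Or.inr (Or.inr (Or.inr (Or.inr (Or.inr (by omega)))))))))
    | (rcases lt_or_gt_of_ne m2 with m | m
       · exact Or.inl (Or.inr (Or.inr (Or.inr (Or.inr (Or.inr (Or.inr (Or.inl (by omega))))))))
       · exact Or.inr (Or.inr (Or.inr (Or.inr (Or.inr (Or.inr (Or.inl (by omega))))))))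

lemma Pat.between {n : ℕ} (hn : 1 ≤ n) {w : List ℕ} {h : ℕ → ℤ} {T : ℤ → ℕ} (hs : Sys n w h T)
    {P Q S : ℕ × ℤ} (hP : InS n h w P) (hQ : InS n h w Q) (hS : InS n h w S)
    (hp : PatP n P Q S) : Ge n P S ∧ Ge n S Q ∧ Q.2 < P.2 := by
  obtain ⟨p1, p2⟩ := hP.rho_range hn hs
  obtain ⟨q1, q2⟩ := hQ.rho_range hn hs
  obtain ⟨s1, s2⟩ := hS.rho_range hn hs
  unfold Ge
  rcases hp with hp | hp | hp | hp | hp | hp | hp | hp <;> omega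

lemma Ge.antisymm {n : ℕ} {w : List ℕ} {h : ℕ → ℤ} {T : ℤ → ℕ} (hs : Sys n w h T)
    {P Q : ℕ × ℤ} (hP : InS n h w P) (hQ : InS n h w Q) (h1 : Ge n P Q) (h2 : Ge n Q P) :
    P = Q := by
  have a1 := hP.arith hs
  have a2 := hQ.arith hs
  unfold Ge at *
  apply Prod.ext <;> omega

lemma Ge.lt {n : ℕ} {w : List ℕ} {h : ℕ → ℤ} {T : ℤ → ℕ} (hs : Sys n w h T)
    {P Q : ℕ × ℤ} (hP : InS n h w P) (hQ : InS n h w Q) (h1 : Ge n P Q) (hne : P ≠ Q) :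
    Q.2 < P.2 := by
  by_contra hc
  refine hne (h1.antisymm hs hP hQ ?_)
  unfold Ge at *
  omega

/-- `h1` and `h2` say that the sum is not on the opposite side of the middle row from both summands;
the rest is a comparison of the 64 pairs of patterns. -/
lemma Pat.not_nested_aux {N a b s p q r a' b' p' q' : ℤ} (hs : 2 ≤ s ∧ s ≤ 2 * N - 2) (ha' : 2 ≤ a' ∧ a' ≤ 2 * N - 2)
    (hb' : 2 ≤ b' ∧ b' ≤ 2 * N - 2) (hp : Pat N a b s p q r) (hp' : Pat N a' b' s p' q' r)
    (h1 : a ≠ N → b ≠ N → a + b = s → N < s → N < a ∨ N < b)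
    (h2 : a ≠ N → b ≠ N → a + b = s + 2 * N → s < N → a < N ∨ b < N)
    (g1 : a - a' ≤ p - p' ∧ a' - a ≤ p - p') (g2 : b' - b ≤ q' - q ∧ b - b' ≤ q' - q) :
    a = a' ∧ p = p' := by
  rcases hp with hp | hp | hp | hp | hp | hp | hp | hp <;>
  rcases hp' with hp' | hp' | hp' | hp' | hp' | hp' | hp' | hp' <;> omega

/-- No pair lies inside a pair that is not off the middle row. -/
lemma Pat.not_nested {n : ℕ} (hn : 1 ≤ n) {w : List ℕ} {h : ℕ → ℤ} {T : ℤ → ℕ} (hs : Sys n w h T)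
    {P Q S P' Q' : ℕ × ℤ} (hP : InS n h w P) (hQ : InS n h w Q) (hS : InS n h w S)
    (hP' : InS n h w P') (hQ' : InS n h w Q')
    (hp : PatP n P Q S) (hp' : PatP n P' Q' S) (hoff : ¬ OffMid n P Q S)
    (h1 : Ge n P P') (h2 : Ge n Q' Q) (hne : P ≠ P') : False := by
  have a1 := hP.arith hs
  have a2 := hQ.arith hs
  have a3 := hS.arith hs
  have key := Pat.not_nested_aux (hS.rho_range hn hs) (hP'.rho_range hn hs) (hQ'.rho_range hn hs) hp hp' (by
      intro e1 e2 e3 e4; by_contra hc; apply hoff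
      refine ⟨?_, ?_, ?_, ?_⟩ <;> omega) (by
      intro e1 e2 e3 e4; by_contra hc; apply hoff
      refine ⟨?_, ?_, ?_, ?_⟩ <;> omega) h1 h2
  exact hne (Ge.antisymm hs hP hP' (by unfold Ge; omega) (by unfold Ge; omega))

/-! ### Decompositions of a root into a sequence of positive roots -/

/-- The additive functional on the lattice with the values `f a` at `ε_a`. -/
def functional (f : ℕ → ℤ) : Lat →+ ℤ := Finsupp.liftAddHom fun a => AddMonoidHom.mulRight (f a)

lemma functional_rt (f : ℕ → ℤ) (a b : ℕ) : functional f (rt a b) = f a - f b := by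
  rw [rt, map_sub]
  unfold functional
  rw [Finsupp.liftAddHom_apply_single, Finsupp.liftAddHom_apply_single]
  simp

lemma functional_eq_zero {f : ℕ → ℤ} {s : Multiset Lat} (h : ∀ v ∈ s, 0 ≤ functional f v)
    (hs : functional f s.sum = 0) {v : Lat} (hv : v ∈ s) : functional f v = 0 := by
  rw [map_multiset_sum] at hs
  exact Multiset.all_zero_of_le_zero_le_of_sum_eq_zero (by simpa using h) hs _
    (Multiset.mem_map_of_mem _ hv)

lemma eq_zero_of_sum_eq_zero {m : ℕ} {s : Multiset Lat} (h : ∀ v ∈ s, v ∈ PosRoots m)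
    (hs : s.sum = 0) : s = 0 := by
  refine Multiset.eq_zero_of_forall_notMem fun v hv => ?_
  have := functional_eq_zero (f := fun a => -a) (fun u hu => by
    obtain ⟨a, b, -, h2, -, rfl⟩ := mem_posRoots.1 (h u hu)
    rw [functional_rt]; omega) (by rw [hs, map_zero]) hv
  obtain ⟨a, b, -, h2, -, rfl⟩ := mem_posRoots.1 (h v hv)
  rw [functional_rt] at this
  omega

/-- A sequence of positive roots that sums up to a positive root can be regrouped into at most two
positive roots. -/
lemma eq_or_exists_of_sum_eq {m : ℕ} {K : Lat → Prop}
    (hK : ∀ a b c, 1 ≤ a → a < b → b < c → c ≤ m + 1 → K (rt a b) → K (rt b c) → K (rt a c))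
    {s : Multiset Lat} (h : ∀ v ∈ s, v ∈ PosRoots m ∧ K v) {a b : ℕ} (ha : 1 ≤ a) (hab : a < b)
    (hb : b ≤ m + 1) (hs : s.sum = rt a b) :
    s = {rt a b} ∨ ∃ c, a < c ∧ c < b ∧ K (rt a c) ∧ K (rt c b) := by
  induction s using Multiset.strongInductionOn generalizing a with
  | ih s ih =>
  -- The coefficient of the sum at ε_a is positive, so some member starts at a.
  obtain ⟨v, hv, hva⟩ : ∃ v ∈ s, 0 < functional (fun x => if x = a then 1 else 0) v := by
    by_contra! hc
    have h1 : functional (fun x => if x = a then 1 else 0) s.sum ≤ 0 := by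
      rw [map_multiset_sum]
      refine (Multiset.sum_le_card_nsmul _ 0 fun x hx => ?_).trans (by simp)
      obtain ⟨v, hv, rfl⟩ := Multiset.mem_map.1 hx
      exact hc v hv
    rw [hs, functional_rt, if_pos rfl, if_neg hab.ne'] at h1
    omega
  obtain ⟨x, y, h1, h2, h3, rfl⟩ := mem_posRoots.1 (h _ hv).1
  have hxa : x = a := by
    by_contra hc
    rw [functional_rt, if_neg hc] at hva
    split_ifs at hva <;> omega
  subst hxa
  have hyb : y ≤ b := by
    -- Summing the coefficients at indices ≤ b is nonnegative on positive roots and zero on the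
    -- total, hence zero on each member; so none crosses b.
    have := functional_eq_zero (f := fun x => if x ≤ b then 1 else 0) (fun u hu => by
      obtain ⟨c, d, -, h5, -, rfl⟩ := mem_posRoots.1 (h u hu).1
      rw [functional_rt]
      split_ifs <;> omega) (by
      rw [hs, functional_rt, if_pos hab.le, if_pos le_rfl, sub_self]) hv
    rw [functional_rt, if_pos hab.le] at this
    by_contra hc
    rw [if_neg hc] at this
    omega
  obtain ⟨s', rfl⟩ := Multiset.exists_cons_of_mem hv
  rw [Multiset.sum_cons] at hs
  rcases hyb.eq_or_lt with e | hyb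
  · subst e
    left
    rw [eq_zero_of_sum_eq_zero (m := m) (fun v hv => (h v (Multiset.mem_cons_of_mem hv)).1)
      (by simpa using hs)]
    rfl
  · right
    have hK1 := (h _ hv).2
    rcases ih s' (Multiset.lt_cons_self _ _) (fun v hv => h v (Multiset.mem_cons_of_mem hv))
      (a := y) (by omega) hyb (by rw [← rt_add x y b] at hs; exact add_left_cancel hs) with
      e | ⟨c, c1, c2, c3, c4⟩
    · exact ⟨y, h2, hyb, hK1, (h _ (by simp [e])).2⟩
    · exact ⟨c, by omega, c2, hK _ _ _ ha h2 c1 (by omega) hK1 c3, c4⟩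

/-! ### The bi-lexicographical order -/

lemma bLt_of_between {w : List ℕ}
    (hinj : ∀ s t, s < w.length → t < w.length → rootAt w s = rootAt w t → s = t) {k l : ℕ}
    (hkl : k < l) (hl : l < w.length) {s : Multiset Lat}
    (hs : ∀ v ∈ s, ∃ t, k < t ∧ t < l ∧ rootAt w t = v) :
    BLt w s {rootAt w k, rootAt w l} := by
  have h0 : ∀ t, t < w.length → ¬ (k < t ∧ t < l) → s.count (rootAt w t) = 0 := by
    intro t ht hkt
    refine Multiset.count_eq_zero_of_notMem fun hc => ?_
    obtain ⟨u, h1, h2, h3⟩ := hs _ hc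
    rw [hinj u t (by omega) ht h3] at h1 h2
    exact hkt ⟨h1, h2⟩
  refine ⟨k, l, hkl.le, hl, fun t ht h1 => ?_, ?_, ?_⟩
  · rw [h0 t ht (by omega), eq_comm, Multiset.count_eq_zero]
    simp only [Multiset.insert_eq_cons, Multiset.mem_cons, Multiset.mem_singleton]
    rintro (e | e)
    · have := hinj _ _ ht (by omega) e; omega
    · have := hinj _ _ ht hl e; omega
  · rw [h0 k (by omega) (by omega), Multiset.count_pos]
    simp
  · rw [h0 l hl (by omega), Multiset.count_pos]
    simp

/-- Strict decrease is possible only where the pair has a root, so the two witnesses are among k and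
l. If they are k and l themselves, s vanishes there and outside. -/
lemma between_of_bLt {w : List ℕ}
    (hinj : ∀ s t, s < w.length → t < w.length → rootAt w s = rootAt w t → s = t)
    (hne : ∀ t, t < w.length → rootAt w t ≠ 0) {k l : ℕ}
    (hkl : k < l) (hl : l < w.length) {s : Multiset Lat}
    (hs : ∀ v ∈ s, ∃ t, t < w.length ∧ rootAt w t = v)
    (hsum : s.sum = rootAt w k + rootAt w l) (hb : BLt w s {rootAt w k, rootAt w l}) {v : Lat}
    (hv : v ∈ s) : ∃ t, k < t ∧ t < l ∧ rootAt w t = v := by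
  have hmem : ∀ t, t < w.length → (rootAt w t ∈ ({rootAt w k, rootAt w l} : Multiset Lat) ↔
      t = k ∨ t = l) := by
    intro t ht
    simp only [Multiset.insert_eq_cons, Multiset.mem_cons, Multiset.mem_singleton]
    constructor
    · rintro (e | e)
      · exact Or.inl (hinj _ _ ht (by omega) e)
      · exact Or.inr (hinj _ _ ht hl e)
    · rintro (e | e)
      · exact Or.inl (by rw [e])
      · exact Or.inr (by rw [e])
  have hnd : ({rootAt w k, rootAt w l} : Multiset Lat).Nodup := by
    simp only [Multiset.insert_eq_cons, Multiset.nodup_cons, Multiset.mem_singleton,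
      Multiset.nodup_singleton, and_true]
    intro e
    have := hinj _ _ (by omega) hl e
    omega
  have hcount : ∀ t, t < w.length → ({rootAt w k, rootAt w l} : Multiset Lat).count (rootAt w t) =
      if t = k ∨ t = l then 1 else 0 := by
    intro t ht
    rw [Multiset.count_eq_of_nodup hnd]
    simp only [hmem t ht]
  obtain ⟨k', l', h1, h2, h3, h4, h5⟩ := hb
  rw [hcount _ (by omega)] at h4
  rw [hcount _ h2] at h5
  have hk' : k' = k ∨ k' = l := by by_contra hc; rw [if_neg hc] at h4; omega
  have hl' : l' = k ∨ l' = l := by by_contra hc; rw [if_neg hc] at h5; omega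
  -- If both witnesses were the same position, s would be the other root alone, and equality of
  -- weights would make a root zero.
  have hcase : ∀ x y, (x = k ∧ y = l ∨ x = l ∧ y = k) → k' = x → l' = x → False := by
    rintro x y hxy rfl rfl
    have e : s = {rootAt w y} := by
      have hy : y < w.length := by omega
      ext v
      by_cases hv : ∃ t, t < w.length ∧ rootAt w t = v
      · obtain ⟨t, ht, rfl⟩ := hv
        rw [Multiset.count_singleton]
        by_cases htx : t = l'
        · subst htx
          rw [if_neg fun e => by have := hinj _ _ ht hy e; omega]
          split_ifs at h4; omega
        · rw [h3 t ht (by omega), hcount t ht]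
          by_cases hty : t = y
          · rw [if_pos (by omega), if_pos (by rw [hty])]
          · rw [if_neg (by omega), if_neg fun e => hty (hinj _ _ ht hy e)]
      · rw [Multiset.count_eq_zero_of_notMem fun h => hv (hs v h),
          Multiset.count_eq_zero_of_notMem fun h => hv ⟨y, hy, (Multiset.mem_singleton.1 h).symm⟩]
    rw [e, Multiset.sum_singleton] at hsum
    rcases hxy with ⟨rfl, rfl⟩ | ⟨rfl, rfl⟩
    · exact hne _ h2 (by simpa using hsum)
    · exact hne _ h2 (by simpa using hsum)
  have hk : k' = k ∧ l' = l := by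
    rcases hk' with e1 | e1 <;> rcases hl' with e2 | e2
    · exact (hcase k l (by simp) e1 e2).elim
    · exact ⟨e1, e2⟩
    · omega
    · exact (hcase l k (by simp) e1 e2).elim
  obtain ⟨rfl, rfl⟩ := hk
  obtain ⟨t, ht, rfl⟩ := hs v hv
  have hpos := Multiset.count_pos.2 hv
  refine ⟨t, ?_, ?_, rfl⟩ <;> by_contra hc
  · by_cases e : t = k'
    · subst e; split_ifs at h4; omega
    · rw [h3 t ht (by omega), hcount t ht, if_neg (by omega)] at hpos
      omega
  · by_cases e : t = l'
    · subst e; split_ifs at h5; omega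
    · rw [h3 t ht (by omega), hcount t ht, if_neg (by omega)] at hpos
      omega

lemma not_bLt_self (w : List ℕ) (s : Multiset Lat) : ¬ BLt w s s := by
  rintro ⟨k, l, -, -, -, h, -⟩
  exact lt_irrefl _ h

/-! ### Minimal pairs -/

lemma Sys.rootAt_inj {n : ℕ} (hn : 1 ≤ n) {w : List ℕ} {h : ℕ → ℤ} {T : ℤ → ℕ}
    (hs : Sys n w h T) (s t : ℕ) (h1 : s < w.length) (h2 : t < w.length)
    (e : rootAt w s = rootAt w t) : s = t := by
  rw [hs.rootAt_eq hn h1, hs.rootAt_eq hn h2] at e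
  exact pt_inj h1 h2 (root_inj hs (inS_pt h1) (inS_pt h2) e)

lemma Sys.rootAt_ne_zero {n : ℕ} (hn : 1 ≤ n) {w : List ℕ} {h : ℕ → ℤ} {T : ℤ → ℕ}
    (hs : Sys n w h T) (t : ℕ) (ht : t < w.length) : rootAt w t ≠ 0 := by
  rw [hs.rootAt_eq hn ht, root, rt, sub_ne_zero]
  exact fun e => root_ne hs (inS_pt ht) (Finsupp.single_left_injective one_ne_zero e)

/-- Points strictly between two points of the grid give a smaller sequence. -/
lemma Sys.bPrec {n : ℕ} (hn : 1 ≤ n) {w : List ℕ} {h : ℕ → ℤ} {T : ℤ → ℕ} (hs : Sys n w h T)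
    {P Q : ℕ × ℤ} (hP : InS n h w P) (hQ : InS n h w Q) (hPQ : Ge n P Q) (hne : P ≠ Q)
    {s : Multiset Lat}
    (hb : ∀ v ∈ s, ∃ D, InS n h w D ∧ v = root n T D ∧ Ge n P D ∧ Ge n D Q ∧ D ≠ P ∧ D ≠ Q) :
    BPrec w s {root n T P, root n T Q} := by
  intro w' hw
  have hs' := hs.comm hw
  obtain ⟨k, l, hkl, hl, e1, e2⟩ := before_of_ge hn hs' (hP.comm hw) (hQ.comm hw) hPQ hne
  rw [← e1, ← e2, ← hs'.rootAt_eq hn (by omega), ← hs'.rootAt_eq hn hl]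
  refine bLt_of_between (hs'.rootAt_inj hn) hkl hl fun v hv => ?_
  obtain ⟨D, hD, rfl, g1, g2, n1, n2⟩ := hb v hv
  obtain ⟨k1, t, a1, a2, a3, a4⟩ :=
    before_of_ge hn hs' (hP.comm hw) (hD.comm hw) g1 n1.symm
  obtain ⟨t', l1, b1, b2, b3, b4⟩ := before_of_ge hn hs' (hD.comm hw) (hQ.comm hw) g2 n2
  obtain rfl := pt_inj (by omega) (by omega) (a3.trans e1.symm)
  obtain rfl := pt_inj b2 hl (b4.trans e2.symm)
  obtain rfl := pt_inj a2 (by omega) (a4.trans b3.symm)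
  exact ⟨t, a1, b1, by rw [hs'.rootAt_eq hn a2, a4]⟩

/-- In every word of the class v is read between the two roots, and `prec_iff` turns this into the
grid order. -/
lemma Sys.between {n : ℕ} (hn : 1 ≤ n) {w : List ℕ} {h : ℕ → ℤ} {T : ℤ → ℕ} (hs : Sys n w h T)
    {P Q : ℕ × ℤ} (hP : InS n h w P) (hQ : InS n h w Q) (hPQ : Ge n P Q) (hne : P ≠ Q)
    {s : Multiset Lat} (hseq : IsSeq (2 * n + 1) s) (hsum : s.sum = root n T P + root n T Q)
    (hb : BPrec w s {root n T P, root n T Q}) {v : Lat} (hv : v ∈ s) :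
    ∃ D, InS n h w D ∧ v = root n T D ∧ Ge n P D ∧ Ge n D Q ∧ D ≠ P ∧ D ≠ Q := by
  obtain ⟨D, hD, rfl⟩ := hs.exists_of_posRoot hn (hseq v hv)
  have key : ∀ w', CommEquiv w w' →
      Before w' (root n T P) (root n T D) ∧ Before w' (root n T D) (root n T Q) := by
    intro w' hw
    have hs' := hs.comm hw
    obtain ⟨k, l, hkl, hl, e1, e2⟩ := before_of_ge hn hs' (hP.comm hw) (hQ.comm hw) hPQ hne
    have hb' := hb w' hw
    have r1 := hs'.rootAt_eq hn (hkl.trans hl)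
    have r2 := hs'.rootAt_eq hn hl
    rw [e1] at r1
    rw [e2] at r2
    rw [← r1, ← r2] at hb' hsum ⊢
    obtain ⟨t, h1, h2, h3⟩ := between_of_bLt (hs'.rootAt_inj hn) (hs'.rootAt_ne_zero hn) hkl hl
      (fun v hv => by
        obtain ⟨E, hE, rfl⟩ := hs'.exists_of_posRoot hn (hseq v hv)
        obtain ⟨t, ht, rfl⟩ := hE.exists_pt
        exact ⟨t, ht, hs'.rootAt_eq hn ht⟩) hsum hb' hv
    exact ⟨⟨k, t, h1, by omega, rfl, h3⟩, ⟨t, l, h2, hl, h3, rfl⟩⟩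
  have h1 := (prec_iff hn hs hP hD).1 fun w' hw => (key w' hw).1
  have h2 := (prec_iff hn hs hD hQ).1 fun w' hw => (key w' hw).2
  exact ⟨D, hD, rfl, h1.1, h2.1, h1.2.symm, h2.2⟩

lemma patP_of_sum {n : ℕ} (hn : 1 ≤ n) {w : List ℕ} {h : ℕ → ℤ} {T : ℤ → ℕ} (hs : Sys n w h T)
    {P Q S : ℕ × ℤ} (hP : InS n h w P) (hQ : InS n h w Q) (hS : InS n h w S)
    (e : root n T P + root n T Q = root n T S) : PatP n P Q S ∨ PatP n Q P S := by
  rcases dec_of_root_add hs hP hQ hS e with hd | hd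
  · exact hd.pat hn hs hP hQ hS
  · exact (hd.pat hn hs hQ hP hS).symm

lemma ne_of_root_add {n : ℕ} {w : List ℕ} {h : ℕ → ℤ} {T : ℤ → ℕ} (hs : Sys n w h T)
    {P Q S : ℕ × ℤ} (hP : InS n h w P) (hQ : InS n h w Q)
    (e : root n T P + root n T Q = root n T S) : S ≠ P ∧ S ≠ Q := by
  have h0 : ∀ P, InS n h w P → root n T P ≠ 0 := fun P hP e =>
    root_ne hs hP (Finsupp.single_left_injective one_ne_zero (sub_eq_zero.1 e))
  constructor
  · rintro rfl
    exact h0 Q hQ (by simpa using e)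
  · rintro rfl
    exact h0 P hP (by simpa using e)

lemma isMinimalPair_of_not_offMid {n : ℕ} (hn : 1 ≤ n) {w : List ℕ} {h : ℕ → ℤ} {T : ℤ → ℕ}
    (hs : Sys n w h T) {P Q S : ℕ × ℤ} (hP : InS n h w P) (hQ : InS n h w Q) (hS : InS n h w S)
    (e : root n T P + root n T Q = root n T S) (hp : PatP n P Q S) (hoff : ¬ OffMid n P Q S) :
    IsMinimalPair (2 * n + 1) w (root n T P) (root n T Q) (root n T S) := by
  obtain ⟨g1, g2, hlt⟩ := hp.between hn hs hP hQ hS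
  have hPQ := g1.trans g2
  have hne : P ≠ Q := by rintro rfl; omega
  obtain ⟨n1, n2⟩ := ne_of_root_add hs hP hQ e
  refine ⟨(prec_iff hn hs hP hQ).2 ⟨hPQ, hne⟩, ?_, ?_, ?_, ?_⟩
  · intro v hv
    simp only [Multiset.insert_eq_cons, Multiset.mem_cons, Multiset.mem_singleton] at hv
    rcases hv with rfl | rfl
    · exact hs.root_mem hn hP
    · exact hs.root_mem hn hQ
  · refine hs.bPrec hn hP hQ hPQ hne fun v hv => ⟨S, hS, Multiset.mem_singleton.1 hv, g1, g2, n1, n2⟩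
  · simpa using e
  · rintro ⟨s, hseq, hsum, hb1, hb2⟩
    rw [Multiset.sum_singleton] at hsum
    obtain ⟨a, b, ha, hab, hb, hSr⟩ := mem_posRoots.1 (hs.root_mem hn hS)
    have hbt := fun v hv => hs.between hn hP hQ hPQ hne hseq (hsum.trans e.symm) hb2 (v := v) hv
    obtain ⟨K, hK⟩ : ∃ K : Lat → Prop, ∀ v, K v ↔
        ∃ D, InS n h w D ∧ v = root n T D ∧ Ge n P D ∧ Ge n D Q ∧ D ≠ P ∧ D ≠ Q :=
      ⟨_, fun _ => Iff.rfl⟩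
    simp only [← hK] at hbt
    -- A root that is the sum of two roots lies between them in the grid, so the open interval from
    -- P to Q is closed under such sums.
    have hclosed : ∀ x y z, 1 ≤ x → x < y → y < z → z ≤ 2 * n + 1 + 1 → K (rt x y) → K (rt y z) →
        K (rt x z) := by
      intro x y z h1 h2 h3 h4 h5 h6
      obtain ⟨D, hD, d1, d2, d3, d4, d5⟩ := (hK _).1 h5
      obtain ⟨E, hE, f1, f2, f3, f4, f5⟩ := (hK _).1 h6
      obtain ⟨F, hF, eF⟩ := hs.exists_of_posRoot hn
        (mem_posRoots.2 ⟨x, z, h1, h2.trans h3, h4, rfl⟩)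
      have hsum' : root n T D + root n T E = root n T F := by rw [← d1, ← f1, rt_add, eF]
      have hG : (Ge n D F ∧ Ge n F E) ∨ (Ge n E F ∧ Ge n F D) := by
        rcases patP_of_sum hn hs hD hE hF hsum' with hp' | hp'
        · have := hp'.between hn hs hD hE hF
          exact Or.inl ⟨this.1, this.2.1⟩
        · have := hp'.between hn hs hE hD hF
          exact Or.inr ⟨this.1, this.2.1⟩
      rw [hK]
      rcases hG with ⟨g3, g4⟩ | ⟨g3, g4⟩
      · refine ⟨F, hF, eF, d2.trans g3, g4.trans f3, ?_, ?_⟩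
        · rintro rfl; exact d4 (g3.antisymm hs hD hF d2)
        · rintro rfl; exact f5 (f3.antisymm hs hE hF g4)
      · refine ⟨F, hF, eF, f2.trans g3, g4.trans d3, ?_, ?_⟩
        · rintro rfl; exact f4 (g3.antisymm hs hE hF f2)
        · rintro rfl; exact d5 (d3.antisymm hs hD hF g4)
    rcases eq_or_exists_of_sum_eq hclosed (fun v hv => ⟨hseq v hv, hbt v hv⟩)
      ha hab hb (hsum.trans hSr) with e1 | ⟨c, h1, h2, h3, h4⟩
    · rw [e1, ← hSr] at hb1
      exact not_bLt_self w _ (hb1 w .refl)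
    · obtain ⟨D, hD, d1, d2, d3, d4, d5⟩ := (hK _).1 h3
      obtain ⟨E, hE, f1, f2, f3, f4, f5⟩ := (hK _).1 h4
      have e2 : root n T D + root n T E = root n T S := by rw [← d1, ← f1, rt_add, hSr]
      rcases patP_of_sum hn hs hD hE hS e2 with hp' | hp'
      · exact hp.not_nested hn hs hP hQ hS hD hE hp' hoff d2 f3 d4.symm
      · exact hp.not_nested hn hs hP hQ hS hE hD hp' hoff f2 d3 f4.symm

/-- A point of the middle row between two other points of the slice lies in the slice. -/
lemma Sys.inS_mid {n : ℕ} {w : List ℕ} {h : ℕ → ℤ} {T : ℤ → ℕ} (hs : Sys n w h T)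
    {P Q : ℕ × ℤ} (hP : InS n h w P) (hQ : InS n h w Q) (hP' : P.1 ≠ n + 1) (hQ' : Q.1 ≠ n + 1)
    {x : ℤ} (hx : ¬ 2 ∣ x) (g1 : Ge n P (n + 1, x)) (g2 : Ge n (n + 1, x) Q) :
    InS n h w (n + 1, x) := by
  have hm := hs.valid.mid
  have hf := hs.fin (n + 1) (by omega) (by omega)
  have b1 := (hP.bounds hs).1
  have b2 := (hQ.bounds hs).2
  have r1 := hP.range hs
  have r2 := hQ.range hs
  have s1 := rho_slack n P.1
  have s2 := rho_slack n Q.1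
  have s3 := rho_slack n (2 * n + 2 - Q.1)
  have s4 := rho_slack n (n + 1)
  simp only [st, flip, show 2 * n + 2 - (n + 1) = n + 1 by omega] at hf
  rw [show slack n (n + 1) = 2 by omega] at hf
  unfold Ge at g1 g2
  simp only at g1 g2
  have u1 : x ≤ h (n + 1) := by
    rcases lt_or_gt_of_ne hP' with e | e
    · have := hs.valid.le P.1 (n + 1) (by omega) (by omega) (by omega)
      omega
    · have := hs.valid.le (n + 1) P.1 (by omega) (by omega) (by omega)
      omega
  -- The middle row may exceed the dual row of Q by an extra slack of 2; this matches the 2 gained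
  -- in `InS.bounds` for a point off the middle.
  have u2 : h (n + 1) - 4 * n ≤ x := by
    rcases lt_or_gt_of_ne hQ' with e | e
    · have := hs.valid.le (n + 1) (2 * n + 2 - Q.1) (by omega) (by omega) (by omega)
      omega
    · have := hs.valid.le (2 * n + 2 - Q.1) (n + 1) (by omega) (by omega) (by omega)
      omega
  refine ⟨((h (n + 1) - x) / 2).toNat, ?_, ?_⟩
  · change _ < w.count (n + 1)
    omega
  · change x = h (n + 1) - (4 - slack n (n + 1)) * _
    rw [show slack n (n + 1) = 2 by omega]
    omega

lemma not_isMinimalPair_of_offMid {n : ℕ} (hn : 1 ≤ n) {w : List ℕ} {h : ℕ → ℤ} {T : ℤ → ℕ}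
    (hs : Sys n w h T) {P Q S : ℕ × ℤ} (hP : InS n h w P) (hQ : InS n h w Q) (hS : InS n h w S)
    (hp : PatP n P Q S) (hoff : OffMid n P Q S) :
    ¬ IsMinimalPair (2 * n + 1) w (root n T P) (root n T Q) (root n T S) := by
  obtain ⟨o1, o2, o3, o4⟩ := hoff
  have a1 := hP.arith hs
  have a2 := hQ.arith hs
  have a3 := hS.arith hs
  have s4 := rho_slack n (n + 1)
  have hr : rho n (n + 1) = 2 * n + 1 := by omega
  obtain ⟨g1, g2, hlt⟩ := hp.between hn hs hP hQ hS
  have f : ∀ {R : ℕ × ℤ}, R.1 ≠ n + 1 → InS n h w R →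
      (2 * ((min R.1 (2 * n + 2 - R.1) : ℕ) : ℤ) = rho n R.1 ∧ rho n R.1 < 2 * n + 1) ∨
      (2 * ((min R.1 (2 * n + 2 - R.1) : ℕ) : ℤ) = 2 * (2 * n + 1) - rho n R.1 ∧
        2 * n + 1 < rho n R.1) := by
    intro R hR hR'
    have := hR'.arith hs
    omega
  have f1 := f o1 hP
  have f2 := f o2 hQ
  have f3 := f o3 hS
  have m1 : rho n P.1 ≠ 2 * n + 1 := by omega
  have m2 : rho n Q.1 ≠ 2 * n + 1 := by omega
  -- The folded sum 2n+1 forces S to the side of the middle row opposite to both P and Q.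
  have hcase : (2 * n + 1 < rho n S.1 ∧ rho n P.1 < 2 * n + 1 ∧ rho n Q.1 < 2 * n + 1 ∧
      rho n P.1 + rho n Q.1 = rho n S.1 ∧ P.2 = S.2 + rho n Q.1 ∧ Q.2 = S.2 - rho n P.1) ∨
      (rho n S.1 < 2 * n + 1 ∧ 2 * n + 1 < rho n P.1 ∧ 2 * n + 1 < rho n Q.1 ∧
      rho n P.1 + rho n Q.1 = rho n S.1 + 2 * (2 * n + 1) ∧ P.2 = S.2 - rho n S.1 + rho n P.1 ∧
      Q.2 = S.2 + rho n S.1 - rho n Q.1) := by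
    clear a1 a2 a3 s4 f g1 g2
    generalize min P.1 (2 * n + 2 - P.1) = x1, min Q.1 (2 * n + 2 - Q.1) = x2,
      min S.1 (2 * n + 2 - S.1) = x3 at *
    rcases hp with hp | hp | hp | hp | hp | hp | hp | hp
    · left; omega
    · right; omega
    all_goals exfalso; omega
  clear f f1 f2 f3 o4
  -- d is the distance of S from the middle row; the diagonals through S meet that row at the
  -- heights S.2 ± d.
  obtain ⟨d, hd0, hd, gPX, gYQ⟩ : ∃ d, 0 < d ∧
      (d = rho n S.1 - (2 * n + 1) ∨ d = 2 * n + 1 - rho n S.1) ∧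
      Ge n P (n + 1, S.2 + d) ∧ Ge n (n + 1, S.2 - d) Q := by
    simp only [Ge, hr]
    rcases hcase with c | c
    · exact ⟨rho n S.1 - (2 * n + 1), by omega, Or.inl rfl, by omega, by omega⟩
    · exact ⟨2 * n + 1 - rho n S.1, by omega, Or.inr rfl, by omega, by omega⟩
  have gXS : Ge n (n + 1, S.2 + d) S := by simp only [Ge, hr]; omega
  have gSY : Ge n S (n + 1, S.2 - d) := by simp only [Ge, hr]; omega
  have hX := hs.inS_mid hP hQ o1 o2 (x := S.2 + d) (by omega) gPX (gXS.trans g2)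
  have hY := hs.inS_mid hP hQ o1 o2 (x := S.2 - d) (by omega) (g1.trans gSY) gYQ
  have gXY := gXS.trans gSY
  have hXY : ((n + 1, S.2 + d) : ℕ × ℤ) ≠ (n + 1, S.2 - d) := by
    intro e; have := (Prod.mk.inj e).2; omega
  have nP : ∀ x : ℤ, ((n + 1, x) : ℕ × ℤ) ≠ P := by rintro x rfl; exact o1 rfl
  have nQ : ∀ x : ℤ, ((n + 1, x) : ℕ × ℤ) ≠ Q := by rintro x rfl; exact o2 rfl
  have nS : ∀ x : ℤ, S ≠ ((n + 1, x) : ℕ × ℤ) := by rintro x rfl; exact o3 rfl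
  have hsum : root n T (n + 1, S.2 + d) + root n T (n + 1, S.2 - d) = root n T S := by
    -- The diagonals of the two middle points that do not pass through S are not multiples of 4.
    -- They share a label, which cancels in the sum.
    have hT : ∀ x y, ¬ 4 ∣ x → ¬ 4 ∣ y → T x = T y := fun x y h1 h2 =>
      (hs.good.eq_iff x y).2 (Or.inr ⟨h1, h2⟩)
    simp only [root, hr]
    rcases hd with hd | hd
    · rw [hT (S.2 + d - (2 * n + 1)) (S.2 - d + (2 * n + 1)) (by omega) (by omega), rt_add]
      congr 2 <;> omega
    · rw [add_comm, hT (S.2 - d - (2 * n + 1)) (S.2 + d + (2 * n + 1)) (by omega) (by omega),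
        rt_add]
      congr 2 <;> omega
  rintro ⟨-, -, -, -, hmin⟩
  refine hmin ⟨{root n T (n + 1, S.2 + d), root n T (n + 1, S.2 - d)}, ?_, ?_, ?_, ?_⟩
  · intro v hv
    simp only [Multiset.insert_eq_cons, Multiset.mem_cons, Multiset.mem_singleton] at hv
    rcases hv with rfl | rfl
    · exact hs.root_mem hn hX
    · exact hs.root_mem hn hY
  · simpa using hsum
  · exact hs.bPrec hn hX hY gXY hXY fun v hv =>
      ⟨S, hS, Multiset.mem_singleton.1 hv, gXS, gSY, nS _, nS _⟩
  · refine hs.bPrec hn hP hQ (g1.trans g2) (by rintro rfl; omega) fun v hv => ?_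
    simp only [Multiset.insert_eq_cons, Multiset.mem_cons, Multiset.mem_singleton] at hv
    rcases hv with rfl | rfl
    · exact ⟨_, hX, rfl, gPX, gXS.trans g2, nP _, nQ _⟩
    · exact ⟨_, hY, rfl, g1.trans gSY, gYQ, nP _, nQ _⟩

/-- The minimal pairs in terms of the points of the grid. -/
lemma isMinimalPair_iff {n : ℕ} (hn : 1 ≤ n) {w : List ℕ} {h : ℕ → ℤ} {T : ℤ → ℕ}
    (hs : Sys n w h T) {P Q S : ℕ × ℤ} (hP : InS n h w P) (hQ : InS n h w Q) (hS : InS n h w S)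
    (e : root n T P + root n T Q = root n T S) :
    IsMinimalPair (2 * n + 1) w (root n T P) (root n T Q) (root n T S) ↔
      PatP n P Q S ∧ ¬ OffMid n P Q S := by
  constructor
  · intro hm
    obtain ⟨hg, hne⟩ := (prec_iff hn hs hP hQ).1 hm.1
    have hlt := hg.lt hs hP hQ hne
    have hp : PatP n P Q S := by
      rcases patP_of_sum hn hs hP hQ hS e with hp | hp
      · exact hp
      · have := (hp.between hn hs hQ hP hS).2.2
        omega
    exact ⟨hp, fun ho => not_isMinimalPair_of_offMid hn hs hP hQ hS hp ho hm⟩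
  · rintro ⟨hp, ho⟩
    exact isMinimalPair_of_not_offMid hn hs hP hQ hS e hp ho

/-! ### Translation of the patterns into folded coordinates. -/

lemma half_sub_eq_iff (q r y : ℤ) : ((q : ℚ) - r) / 2 = y ↔ q - r = 2 * y := by
  rw [div_eq_iff two_ne_zero, ← @Int.cast_inj ℚ]
  push_cast
  rw [mul_comm]

/-- The patterns off the excluded case in terms of the folded residues. -/
lemma pat_iff {n i j k : ℕ} {a b s p q r : ℤ}
    (ha : i ≤ n ∧ (a = 2 * i ∨ a = 2 * (2 * n + 1) - 2 * i) ∨ i = n + 1 ∧ a = 2 * n + 1)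
    (hb : j ≤ n ∧ (b = 2 * j ∨ b = 2 * (2 * n + 1) - 2 * j) ∨ j = n + 1 ∧ b = 2 * n + 1)
    (hs : k ≤ n ∧ (s = 2 * k ∨ s = 2 * (2 * n + 1) - 2 * k) ∨ k = n + 1 ∧ s = 2 * n + 1)
    (hi : 1 ≤ i) (hj : 1 ≤ j) (hk : 1 ≤ k)
    (hp : Pat (2 * n + 1) a b s p q r ∨ Pat (2 * n + 1) b a s q p r) :
    (Pat (2 * n + 1) a b s p q r ∧ ¬ (i ≤ n ∧ j ≤ n ∧ k ≤ n ∧ i + j + k = 2 * n + 1)) ↔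
      (max i (max j k) ≤ n ∧ i + j + k = 2 * max i (max j k) ∧
        ((max i (max j k) = k ∧ q - r = 2 * -i ∧ p - r = 2 * j) ∨
          (max i (max j k) = i ∧ q - r = 2 * (i - (2 * n + 1)) ∧ p - r = 2 * j) ∨
          (max i (max j k) = j ∧ q - r = 2 * -i ∧ p - r = 2 * (2 * n + 1 - j)))) ∨
      ((k ≤ n ∧ i = n + 1 ∧ j = n + 1 ∧ q - r = -2 * ((n : ℤ) - k) - 1 ∧
          p - r = 2 * ((n : ℤ) - k) + 1) ∨
        (i ≤ n ∧ j = n + 1 ∧ k = n + 1 ∧ q - r = -4 * (i : ℤ) ∧ p - r = 2 * ((n : ℤ) - i) + 1) ∨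
        (j ≤ n ∧ i = n + 1 ∧ k = n + 1 ∧ q - r = -2 * ((n : ℤ) - j) - 1 ∧ p - r = 4 * (j : ℤ))) := by
  obtain ⟨l, hl⟩ : ∃ l, l = max i (max j k) := ⟨_, rfl⟩
  rw [← hl]
  have hl' : i ≤ l ∧ j ≤ l ∧ k ≤ l ∧ (l = i ∨ l = j ∨ l = k) := by omega
  clear hl
  constructor
  · rintro ⟨h, ho⟩
    clear hp
    rcases h with h | h | h | h | h | h | h | h
    · left
      rcases ha with ⟨ha, rfl | rfl⟩ | ha <;> rcases hb with ⟨hb, rfl | rfl⟩ | hb <;>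
        rcases hs with ⟨hs, rfl | rfl⟩ | hs <;> omega
    · left
      rcases ha with ⟨ha, rfl | rfl⟩ | ha <;> rcases hb with ⟨hb, rfl | rfl⟩ | hb <;>
        rcases hs with ⟨hs, rfl | rfl⟩ | hs <;> omega
    · exact Or.inr (Or.inl (by omega))
    · exact Or.inr (Or.inl (by omega))
    · exact Or.inr (Or.inr (Or.inl (by omega)))
    · exact Or.inr (Or.inr (Or.inl (by omega)))
    · exact Or.inr (Or.inr (Or.inr (by omega)))
    · exact Or.inr (Or.inr (Or.inr (by omega)))
  · intro h
    -- Every listed case has q < p, whereas the reversed pattern would give p < q. The exceptional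
    -- sum 2n+1 is ruled out by parity in (i) and by a residue n+1 in (ii).
    have hlt : q < p ∧ ¬ (i ≤ n ∧ j ≤ n ∧ k ≤ n ∧ i + j + k = 2 * n + 1) := by
      clear hp ha hb hs
      rcases h with ⟨h1, h2, h | h | h⟩ | h | h | h <;> omega
    refine ⟨hp.resolve_right fun hp => ?_, hlt.2⟩
    clear h
    rcases hp with h | h | h | h | h | h | h | h <;> omega

lemma InS.fold {n : ℕ} {w : List ℕ} {h : ℕ → ℤ} {T : ℤ → ℕ} (hs : Sys n w h T) {P : ℕ × ℤ}
    (hP : InS n h w P) {i : ℕ} (hi : i = min P.1 (2 * n + 2 - P.1)) :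
    (i ≤ n ∧ (rho n P.1 = 2 * i ∨ rho n P.1 = 2 * (2 * n + 1) - 2 * i) ∨
      i = n + 1 ∧ rho n P.1 = 2 * n + 1) ∧ 1 ≤ i ∧ (i ≤ n ↔ P.1 ≠ n + 1) := by
  have := hP.arith hs
  omega

end

end TwAR

theorem mainTheorem8 (n : ℕ) (hn : 1 ≤ n)
    (w : List ℕ) (hw : TwAR.TwistedAdapted n w)
    (Q : ℕ → ℕ → Prop) (hQ : TwAR.IsDynkinQuiver (2 * n) Q)
    (hPQ : TwAR.AdaptedTo (2 * n) Q (TwAR.deleteMiddle n w))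
    (ξ : ℕ → ℤ) (hξ : TwAR.IsHeight Q ξ)
    (α β γ : TwAR.Lat)
    (hα : α ∈ TwAR.PosRoots (2 * n + 1)) (hβ : β ∈ TwAR.PosRoots (2 * n + 1))
    (hγ : γ ∈ TwAR.PosRoots (2 * n + 1))
    (i j k : ℕ) (p q r : ℤ)
    (hαc : TwAR.FoldedCoord n Q ξ w α i p)
    (hβc : TwAR.FoldedCoord n Q ξ w β j q)
    (hγc : TwAR.FoldedCoord n Q ξ w γ k r)
    (hsum : α + β = γ) :
    TwAR.IsMinimalPair (2 * n + 1) w α β γ ↔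
      (∃ l : ℕ, l = max i (max j k) ∧ l ≤ n ∧ i + j + k = 2 * l ∧
        ((l = k ∧ (((q : ℚ) - r) / 2, ((p : ℚ) - r) / 2) = (-(i : ℚ), (j : ℚ))) ∨
         (l = i ∧ (((q : ℚ) - r) / 2, ((p : ℚ) - r) / 2) =
            ((i : ℚ) - (2 * (n : ℚ) + 1), (j : ℚ))) ∨
         (l = j ∧ (((q : ℚ) - r) / 2, ((p : ℚ) - r) / 2) =
            (-(i : ℚ), 2 * (n : ℚ) + 1 - (j : ℚ))))) ∨
      ((k ≤ n ∧ i = n + 1 ∧ j = n + 1 ∧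
          (q - r, p - r) = (-2 * ((n : ℤ) - k) - 1, 2 * ((n : ℤ) - k) + 1)) ∨
       (i ≤ n ∧ j = n + 1 ∧ k = n + 1 ∧
          (q - r, p - r) = (-4 * (i : ℤ), 2 * ((n : ℤ) - i) + 1)) ∨
       (j ≤ n ∧ i = n + 1 ∧ k = n + 1 ∧
          (q - r, p - r) = (-2 * ((n : ℤ) - j) - 1, 4 * (j : ℤ)))) := by
  obtain ⟨h, T, hs⟩ := TwAR.sys_of_twistedAdapted hn hw
  obtain ⟨C, hC⟩ := hs.del_eq hn hQ hPQ hξ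
  obtain ⟨A, hA, rfl, hi, hp⟩ := hαc.exists_point hn hs hQ hξ hC
  obtain ⟨B, hB, rfl, hj, hq⟩ := hβc.exists_point hn hs hQ hξ hC
  obtain ⟨D, hD, rfl, hk, hr⟩ := hγc.exists_point hn hs hQ hξ hC
  rw [TwAR.isMinimalPair_iff hn hs hA hB hD hsum]
  have hpat := TwAR.patP_of_sum hn hs hA hB hD hsum
  obtain ⟨a1, a2, a3⟩ := hA.fold hs hi
  obtain ⟨b1, b2, b3⟩ := hB.fold hs hj
  obtain ⟨d1, d2, d3⟩ := hD.fold hs hk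
  have key := TwAR.pat_iff a1 b1 d1 a2 b2 d2 hpat
  have ho : TwAR.OffMid n A B D ↔ i ≤ n ∧ j ≤ n ∧ k ≤ n ∧ i + j + k = 2 * n + 1 := by
    rw [TwAR.OffMid, a3, b3, d3, hi, hj, hk]
  rw [ho, key]
  have c1 : (-(i : ℚ)) = ((-i : ℤ) : ℚ) := by push_cast; rfl
  have c2 : (j : ℚ) = ((j : ℤ) : ℚ) := by push_cast; rfl
  have c3 : (i : ℚ) - (2 * (n : ℚ) + 1) = ((i - (2 * n + 1) : ℤ) : ℚ) := by push_cast; rfl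
  have c4 : 2 * (n : ℚ) + 1 - (j : ℚ) = ((2 * n + 1 - j : ℤ) : ℚ) := by push_cast; rfl
  -- The normalizing constant C of the height function cancels in differences.
  have hpr : p - r = A.2 - D.2 := by omega
  have hqr : q - r = B.2 - D.2 := by omega
  simp only [Prod.mk.injEq]
  rw [c1, c3, c4, c2]
  simp only [TwAR.half_sub_eq_iff, exists_eq_left, hpr, hqr]
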